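/- Let $\Omega\subset\mathbb{R}^3$ be a bounded open set with $C^1$ boundary and outward unit normal $n(x)$; write $\Lambda=\partial\Omega\times\mathbb{R}^3$ (with the measure $dS(x)\,dv$, $dS$ the surface measure), $\Lambda^-=\{(x,v)\in\Lambda:\ v\cdot n(x)<0\}$ and $\mathcal{R}_x(v)=v-2(v\cdot n(x))n(x)$. Let $C_\Phi>0$, $\gamma\in[0,1]$, let $b\circ\cos$ be positive and continuous on $(0,\pi)$ with $b\in L^\infty([-1,1])$, and let $$\nu(v)=\int_{\mathbb{R}^3\times\mathbb{S}^2}C_\Phi\,|v-v_*|^\gamma\, b(\cos\theta)\,\mu(v_*)\,d\sigma\,dv_*,\qquad \cos\theta=\Big\langle\frac{v-v_*}{|v-v_*|},\sigma\Big\rangle,\qquad \mu(v)=(2\pi)^{-3/2}e^{-|v|^2/2}.$$ Let $m(v)=e^{\kappa|v|^\alpha}$ with $\kappa>0$, $\alpha\in(0,2)$, or $m(v)=(1+|v|^2)^{k/2}$ with $k\in\mathbb{N}$. Put $\|f\|_{L^\infty_{x,v}(m)}=\operatorname{ess\,sup}_{\Omega\times\mathbb{R}^3}|f(x,v)|m(v)$,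 and define $L^\infty_\Lambda(m)$ in the same way with $\Lambda$ in place of $\Omega\times\mathbb{R}^3$. Let $f_0\in L^\infty_{x,v}(m)$. A solution with initial datum $f_0$ is a measurable function $f(t,x,v)$, $t\ge0$, with $f(t)\in L^\infty_{x,v}(m)$ for every $t\geq 0$, locally uniformly in $t$, which has a trace $f|_\Lambda$, measurable on $[0,\infty)\times\Lambda$ and in $L^\infty_\Lambda(m)$ locally uniformly in $t$, such that $$\partial_t f+v\cdot\nabla_x f+\nu(v)f=0,\qquad f(0)=f_0$$ holds weakly, that is, for all $\varphi\in C^1_c(\mathbb{R}\times\mathbb{R}^3\times\mathbb{R}^3)$ and all $t\ge0$, $$\int_{\Omega\times\mathbb{R}^3}f(t)\varphi(t)\,dx\,dv-\int_{\Omega\times\mathbb{R}^3}f_0\,\varphi(0)\,dx\,dv=\int_0^t\!\!\int_{\Omega\times\mathbb{R}^3}f\,(\partial_s\varphi+v\cdot\nabla_x\varphi-\nu\varphi)\,dx\,dv\,ds-\int_0^t\!\!\int_\Lambda f|_\Lambda\,\varphi\,(v\cdot n(x))\,dS(x)\,dv\,ds,$$ and such that the specular reflection condition $f|_\Lambda(t,x,v)=f|_\Lambda(t,x,\mathcal{R}_x(v))$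 holds for almost every $t>0$ and almost every $(x,v)\in\Lambda^-$. Then $\nu_0:=\inf_{v}\nu(v)>0$, and there is a unique solution $S_{G_\nu}(t)f_0$ with initial datum $f_0$: any solution with initial datum $f_0$ agrees with it almost everywhere on $\Omega\times\mathbb{R}^3$ for every $t\ge0$, and the traces agree almost everywhere on $\Lambda$ for almost every $t>0$. The trace of $S_{G_\nu}(t)f_0$ is bounded in $L^\infty_\Lambda(m)$ uniformly in almost every $t>0$, and $$\forall t\ge0,\qquad \|S_{G_\nu}(t)f_0\|_{L^\infty_{x,v}(m)}\le e^{-\nu_0t}\|f_0\|_{L^\infty_{x,v}(m)}.$$ -/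

import Mathlib

open MeasureTheory Set
open scoped ENNReal NNReal

noncomputable section

namespace SpecularTransport

/-- The Euclidean space `ℝ³` of positions and of velocities. -/
abbrev R3 : Type := EuclideanSpace ℝ (Fin 3)

/-! ### The spatial domain -/

/-- Near the point `x` the set `Ω` is the sublevel set `{ξ < 0}` of the `C¹` function `ξ`,
whose gradient does not vanish at `x`. -/
structure IsLocalDefiningFunction (Ω : Set R3) (x : R3) (ξ : R3 → ℝ) : Prop where
  contDiff : ContDiff ℝ 1 ξ
  gradient_ne_zero : gradient ξ x ≠ 0
  eventually_mem_iff : ∀ᶠ y in nhds x, (y ∈ Ω ↔ ξ y < 0)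

/-- A bounded open subset of `ℝ³` with `C¹` boundary. -/
structure IsBoundedC1Domain (Ω : Set R3) : Prop where
  isOpen : IsOpen Ω
  isBounded : Bornology.IsBounded Ω
  exists_defining : ∀ x ∈ frontier Ω, ∃ ξ : R3 → ℝ, IsLocalDefiningFunction Ω x ξ

open Classical in
/-- The outward unit normal `n(x) = ∇ξ(x) / |∇ξ(x)|` at a boundary point `x` (it does not depend
on the choice of the local defining function `ξ`). -/
def outwardNormal (Ω : Set R3) (x : R3) : R3 :=
  if h : ∃ ξ : R3 → ℝ, IsLocalDefiningFunction Ω x ξ then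
    ‖gradient h.choose x‖⁻¹ • gradient h.choose x
  else 0

/-- The specular reflection `R_x(v) = v - 2 (v · n(x)) n(x)`. -/
def reflection (Ω : Set R3) (x v : R3) : R3 :=
  v - (2 * inner ℝ v (outwardNormal Ω x)) • outwardNormal Ω x

/-- The measure `dx dv` on `Ω × ℝ³`. -/
def phaseMeasure (Ω : Set R3) : Measure (R3 × R3) :=
  (volume.restrict Ω).prod volume

/-- The measure `dS(x) dv` on `Λ = ∂Ω × ℝ³`, where `dS` is the surface area measure, i.e. the
two-dimensional Hausdorff measure normalized so as to extend the area of plane sets. -/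
def boundaryMeasure (Ω : Set R3) : Measure (R3 × R3) :=
  ((Measure.euclideanHausdorffMeasure 2 : Measure R3).restrict (frontier Ω)).prod volume

/-! ### Weights and collision frequency -/

/-- The weight `m` is a stretched exponential `exp (κ |v| ^ α)` with `κ > 0` and `0 < α < 2`,
or a polynomial `⟨v⟩ ^ k` with `k ∈ ℕ`, where `⟨v⟩ = √(1 + |v|²)`. -/
def IsAdmissibleWeight (m : R3 → ℝ) : Prop :=
  (∃ κ α : ℝ, 0 < κ ∧ 0 < α ∧ α < 2 ∧ ∀ v, m v = Real.exp (κ * ‖v‖ ^ α)) ∨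
    (∃ k : ℕ, ∀ v, m v = Real.sqrt (1 + ‖v‖ ^ 2) ^ k)

/-- The norm of `L^∞(m)` with respect to a measure on phase space (`Ω × ℝ³` or `Λ`):
the essential supremum of `|h(x,v)| m(v)`. -/
def weightedNorm (ρ : Measure (R3 × R3)) (m : R3 → ℝ) (h : R3 × R3 → ℝ) : ℝ≥0∞ :=
  eLpNorm (fun z => h z * m z.2) ∞ ρ

/-- The global Maxwellian `μ(v) = (2π)^{-3/2} exp (-|v|²/2)`. -/
def maxwellian (v : R3) : ℝ :=
  (2 * Real.pi) ^ (-(3 / 2) : ℝ) * Real.exp (-(‖v‖ ^ 2) / 2)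

/-- The kernel `B = CΦ |v - v_*|^γ b(cos θ)` is a hard potential (`CΦ > 0`, `0 ≤ γ ≤ 1`) with
strong angular cutoff: `b ∘ cos` is positive and continuous on `(0, π)`, and `b` is essentially
bounded on `[-1, 1]`. -/
structure IsHardPotentialCutoff (CΦ γ : ℝ) (b : ℝ → ℝ) : Prop where
  CΦ_pos : 0 < CΦ
  γ_mem : γ ∈ Icc (0 : ℝ) 1
  continuousOn : ContinuousOn (fun θ => b (Real.cos θ)) (Ioo 0 Real.pi)
  pos : ∀ θ ∈ Ioo 0 Real.pi, 0 < b (Real.cos θ)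
  bounded : eLpNorm b ∞ (volume.restrict (Icc (-1) 1)) < ∞

/-- The collision frequency
`ν(v) = ∫_{ℝ³ × S²} CΦ |v - v_*|^γ b(cos θ) μ(v_*) dσ dv_*` with
`cos θ = ⟨(v - v_*) / |v - v_*|, σ⟩`, where `dσ` is the surface measure of the unit sphere. -/
def collisionFrequency (CΦ γ : ℝ) (b : ℝ → ℝ) (v : R3) : ℝ :=
  ∫ w : R3, ∫ σ : Metric.sphere (0 : R3) 1,
    CΦ * ‖v - w‖ ^ γ * b (inner ℝ (‖v - w‖⁻¹ • (v - w)) (σ : R3)) * maxwellian w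
    ∂(volume : Measure R3).toSphere

/-! ### Solutions -/

/-- The transport derivative `∂_t φ + v · ∇_x φ` of a function `φ(t, x, v)` at `p = (t, x, v)`. -/
def transportDeriv (φ : ℝ × R3 × R3 → ℝ) (p : ℝ × R3 × R3) : ℝ :=
  fderiv ℝ φ p (1, p.2.2, 0)

/-- `f(t, x, v)` (for `t ≥ 0`) is a weak solution of `∂_t f + v · ∇_x f + ν f = 0` in
`(0, ∞) × Ω × ℝ³` with initial datum `f₀` and with trace `g(t, x, v)` on `Λ`: for every time `t`
and every compactly supported `C¹` test function, which need not vanish on `∂Ω` nor at time `0`,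
Green's formula holds. -/
def IsWeakSolutionWithTrace (Ω : Set R3) (ν : R3 → ℝ) (f₀ : R3 × R3 → ℝ)
    (f g : ℝ → R3 × R3 → ℝ) : Prop :=
  ∀ φ : ℝ × R3 × R3 → ℝ, ContDiff ℝ 1 φ → HasCompactSupport φ → ∀ t : ℝ, 0 ≤ t →
    (∫ z, f t z * φ (t, z) ∂phaseMeasure Ω) - ∫ z, f₀ z * φ (0, z) ∂phaseMeasure Ω =
      (∫ s in (0 : ℝ)..t, ∫ z,
        f s z * (transportDeriv φ (s, z) - ν z.2 * φ (s, z)) ∂phaseMeasure Ω)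
      - ∫ s in (0 : ℝ)..t, ∫ z,
        g s z * φ (s, z) * inner ℝ z.2 (outwardNormal Ω z.1) ∂boundaryMeasure Ω

/-- `f` is a solution, with values in `L^∞_{x,v}(m)` and locally bounded in time, of
`∂_t f + v · ∇_x f + ν f = 0` with initial datum `f₀`, whose trace `g` on `Λ` is in `L^∞_Λ(m)`,
locally uniformly in time, and satisfies the specular reflection boundary condition. -/
structure IsSpecularSolution (Ω : Set R3) (ν m : R3 → ℝ) (f₀ : R3 × R3 → ℝ)
    (f g : ℝ → R3 × R3 → ℝ) : Prop where
  /-- `f` is jointly measurable on `[0, ∞) × Ω × ℝ³`. -/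
  aestronglyMeasurable_uncurry :
    AEStronglyMeasurable (Function.uncurry f) ((volume.restrict (Ici 0)).prod (phaseMeasure Ω))
  aestronglyMeasurable : ∀ t : ℝ, 0 ≤ t → AEStronglyMeasurable (f t) (phaseMeasure Ω)
  bounded : ∀ T : ℝ, ∃ C : ℝ≥0, ∀ t ∈ Icc 0 T, weightedNorm (phaseMeasure Ω) m (f t) ≤ C
  /-- `g` is jointly measurable on `[0, ∞) × Λ`. -/
  trace_aestronglyMeasurable :
    AEStronglyMeasurable (Function.uncurry g)
      ((volume.restrict (Ici 0)).prod (boundaryMeasure Ω))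
  trace_bounded : ∀ T : ℝ, ∃ C : ℝ≥0, ∀ᵐ t ∂(volume.restrict (Icc 0 T)),
    weightedNorm (boundaryMeasure Ω) m (g t) ≤ C
  weakSolution : IsWeakSolutionWithTrace Ω ν f₀ f g
  /-- `g(t, x, v) = g(t, x, R_x(v))` for almost all `t > 0` and `(x, v) ∈ Λ⁻`. -/
  specular : ∀ᵐ t ∂(volume.restrict (Ioi (0 : ℝ))), ∀ᵐ z ∂boundaryMeasure Ω,
    inner ℝ z.2 (outwardNormal Ω z.1) < 0 → g t z = g t (z.1, reflection Ω z.1 z.2)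

end SpecularTransport

end

namespace SpecularTransport

open Filter Topology

/-! ### Geometry of `C¹` domains -/

/-! Existence is proved by duality instead of by following characteristics, whose repeated
reflections are hard to control on a boundary that is only `C¹`. Put `ω = 1/m`. It depends on `|v|`
only, so specular reflection `R` preserves it. Green's formula for `e^{-ν₀t} ω(v) |φ|`, with the
absolute value smoothed, bounds the `L¹(ω)` norm of `φ(0)` by the `L¹` norms, with weight `e^{-ν₀t}
ω`, of `∂_tφ + v·∇_xφ - νφ` inside and of the jump `φ - φ∘R`, times the normal velocity, on the
outgoing boundary (`integral_abs_le`). The inequality `ν ≥ ν₀` absorbs the derivative of the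
exponential.

Consequently `φ ↦ ∫ f₀ φ(0)` depends only on that pair of functions and is bounded in `L¹` with
constant `M = ‖f₀‖`. Hahn–Banach and `(L¹)' = L^∞` (`exists_repr`) represent it by densities bounded
by `M`. Multiplied by `e^{-ν₀t} ω`, these are the solution and its outgoing trace; the incoming
trace is defined by reflection. The equation, the boundary condition and the decay thus come out
together (`exists_spacetime_solution`). To have a value at every time, the pairing of the solution
with a test function is shown to be a primitive, and the same representation theorem is applied at
each fixed time (`exists_slice`, `exists_weakSolution`).

Uniqueness rests on an energy identity for solutions with zero datum: formally, `∫ g² φ (v·n) = ∫ f²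
(∂_tφ + v·∇_xφ - 2νφ)`. It is proved near each point of space with mollifiers that look into the
past and into `Ω`, so that they see neither the boundary nor the initial time
(`exists_regularization`). Weak convergence is enough, because the smooth approximation is always
paired with a fixed `f` or `g`. For a cutoff `φ` radial in `v`, constant in `x` on `Ω` and
decreasing in time, reflection cancels the left side and the right side has a sign, so `f = 0`; then
`g (v·n) = 0`, and grazing velocities are negligible (`ae_eq_zero_of_isSpacetimeSolution`).

Two preliminaries are needed: the divergence theorem on `C¹` domains with Hausdorff surface measure
(`setIntegral_fderiv_eq`), obtained from Fubini along lines transversal to the boundary; and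
continuity and a positive lower bound for the collision frequency, which follow from rotation
invariance and the evenness of the Maxwellian (`collisionFrequency_eq`, `radialFrequency_ge`). -/

lemma frontier_notMem {Ω : Set R3} (hΩ : IsOpen Ω) {x : R3} (hx : x ∈ frontier Ω) : x ∉ Ω := by
  rw [hΩ.frontier_eq] at hx
  exact hx.2

lemma IsLocalDefiningFunction.apply_eq_zero {Ω : Set R3} (hΩ : IsOpen Ω) {x : R3}
    (hx : x ∈ frontier Ω) {ξ : R3 → ℝ} (h : IsLocalDefiningFunction Ω x ξ) : ξ x = 0 := by
  have h1 : ¬ ξ x < 0 := fun h' => frontier_notMem hΩ hx (h.eventually_mem_iff.self_of_nhds.2 h')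
  have h2 : ξ x ≤ 0 := by
    by_contra! h'
    have hc : ∀ᶠ y in 𝓝 x, 0 < ξ y := h.contDiff.continuous.continuousAt.eventually_const_lt h'
    have hcl : x ∈ closure Ω := frontier_subset_closure hx
    obtain ⟨y, ⟨hy1, hy2⟩, hy3⟩ :=
      mem_closure_iff_nhds.1 hcl _ (hc.and h.eventually_mem_iff)
    exact absurd (hy2.1 hy3) (not_lt.2 hy1.le)
  linarith

lemma IsLocalDefiningFunction.hasStrictFDerivAt {Ω : Set R3} {x : R3} {ξ : R3 → ℝ}
    (h : IsLocalDefiningFunction Ω x ξ) (y : R3) :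
    HasStrictFDerivAt ξ (fderiv ℝ ξ y) y :=
  h.contDiff.contDiffAt.hasStrictFDerivAt one_ne_zero

lemma IsLocalDefiningFunction.hasDerivAt_line {Ω : Set R3} {x : R3} {ξ : R3 → ℝ}
    (h : IsLocalDefiningFunction Ω x ξ) (w : R3) :
    HasDerivAt (fun s : ℝ => ξ (x + s • w)) (inner ℝ (gradient ξ x) w) 0 := by
  have h1 : HasFDerivAt ξ (fderiv ℝ ξ x) (x + (0 : ℝ) • w) := by
    simpa using (h.hasStrictFDerivAt x).hasFDerivAt
  have h2 : HasDerivAt (fun s : ℝ => x + s • w) w 0 := by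
    simpa using ((hasDerivAt_id (0 : ℝ)).smul_const w).const_add x
  have := h1.comp_hasDerivAt (0 : ℝ) h2
  rw [inner_gradient_left]
  exact this

/-- A direction along which `ξ` decreases enters `Ω` at once, and there `η` is negative too. The
slope of `η` is then a limit of nonpositive quotients. -/
lemma IsLocalDefiningFunction.inner_le {Ω : Set R3} (hΩ : IsOpen Ω) {x : R3}
    (hx : x ∈ frontier Ω) {ξ η : R3 → ℝ} (h : IsLocalDefiningFunction Ω x ξ)
    (h' : IsLocalDefiningFunction Ω x η) {w : R3} (hw : inner ℝ (gradient ξ x) w < 0) :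
    inner ℝ (gradient η x) w ≤ 0 := by
  have h1 := (h.hasDerivAt_line w).tendsto_slope_zero_right
  have h2 := (h'.hasDerivAt_line w).tendsto_slope_zero_right
  have hl : Tendsto (fun s : ℝ => x + s • w) (𝓝[>] 0) (𝓝 x) := by
    have : Continuous fun s : ℝ => x + s • w := by fun_prop
    simpa using (this.tendsto 0).mono_left nhdsWithin_le_nhds
  refine le_of_tendsto h2 ?_
  filter_upwards [h1.eventually_lt_const hw, hl.eventually h.eventually_mem_iff,
    hl.eventually h'.eventually_mem_iff, self_mem_nhdsWithin] with s hs h3 h4 hs0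
  have hs0' : (0 : ℝ) < s := hs0
  simp only [zero_add, zero_smul, add_zero, h.apply_eq_zero hΩ hx, h'.apply_eq_zero hΩ hx,
    sub_zero, smul_eq_mul] at hs ⊢
  have h5 : ξ (x + s • w) < 0 := by
    by_contra! h6
    exact absurd hs (not_lt.2 (by positivity))
  have h6 := h4.1 (h3.2 h5)
  exact mul_nonpos_of_nonneg_of_nonpos (by positivity) h6.le

/-- An open half-space contained in a closed one forces the two normals to be positively parallel.
With `inner_le`, this makes the normal independent of the defining function. -/
lemma exists_smul_of_inner_le {a b : R3} (ha : a ≠ 0)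
    (h : ∀ w : R3, inner ℝ a w < 0 → inner ℝ b w ≤ 0) : ∃ c : ℝ, 0 ≤ c ∧ b = c • a := by
  have ha' : 0 < inner ℝ a a := by rw [real_inner_self_eq_norm_sq]; positivity
  set c := inner ℝ a b / inner ℝ a a with hc
  have hca : c * inner ℝ a a = inner ℝ a b := by rw [hc]; field_simp
  have hc0 : 0 ≤ c := by
    have := h (-a) (by simpa using ha')
    rw [inner_neg_right, real_inner_comm] at this
    exact div_nonneg (by linarith) ha'.le
  refine ⟨c, hc0, ?_⟩
  set p := b - c • a with hp
  have hpa : inner ℝ a p = 0 := by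
    rw [hp, inner_sub_right, inner_smul_right, hca, sub_self]
  have hbp : inner ℝ b p = inner ℝ p p := by
    have : b = p + c • a := by rw [hp]; abel
    conv_lhs => rw [this]
    rw [inner_add_left, inner_smul_left, hpa]; simp
  -- Here `p` is the part of `b` orthogonal to `a`. The vector `p - t a` lies in the open half-space
  -- for every `t > 0`, and `t → 0` gives `p = 0`.
  have key : ∀ t : ℝ, 0 < t → inner ℝ p p ≤ t * inner ℝ a b := by
    intro t ht
    have := h (p - t • a) (by
      rw [inner_sub_right, inner_smul_right, hpa]; simp only [zero_sub, Left.neg_neg_iff]; positivity)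
    rw [inner_sub_right, inner_smul_right, hbp, real_inner_comm a b] at this
    linarith
  have h0 : inner ℝ p p ≤ 0 := by
    have hl : Tendsto (fun t : ℝ => t * inner ℝ a b) (𝓝[>] 0) (𝓝 0) := by
      have : Continuous fun t : ℝ => t * inner ℝ a b := by fun_prop
      simpa using (this.tendsto 0).mono_left nhdsWithin_le_nhds
    exact ge_of_tendsto hl (by filter_upwards [self_mem_nhdsWithin] with t ht using key t ht)
  have hp0 : p = 0 := by
    rw [real_inner_self_eq_norm_sq] at h0
    have : ‖p‖ = 0 := by nlinarith [norm_nonneg p]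
    simpa using this
  rw [hp, sub_eq_zero] at hp0
  exact hp0

lemma IsLocalDefiningFunction.outwardNormal_eq {Ω : Set R3} (hΩ : IsOpen Ω) {x : R3}
    (hx : x ∈ frontier Ω) {ξ : R3 → ℝ} (h : IsLocalDefiningFunction Ω x ξ) :
    outwardNormal Ω x = ‖gradient ξ x‖⁻¹ • gradient ξ x := by
  have hex : ∃ ξ : R3 → ℝ, IsLocalDefiningFunction Ω x ξ := ⟨ξ, h⟩
  rw [outwardNormal, dif_pos hex]
  obtain ⟨c, hc, hb⟩ := exists_smul_of_inner_le h.gradient_ne_zero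
    (fun w => h.inner_le hΩ hx hex.choose_spec (w := w))
  have hne := hex.choose_spec.gradient_ne_zero
  rw [hb] at hne ⊢
  have hc0 : 0 < c := lt_of_le_of_ne hc (by rintro rfl; simp at hne)
  rw [norm_smul, smul_smul, Real.norm_of_nonneg hc]
  congr 1
  field_simp

/-- One defining function serves all nearby boundary points, so locally the normal is a single
normalized continuous gradient. -/
lemma IsLocalDefiningFunction.eventually {Ω : Set R3} {x : R3} {ξ : R3 → ℝ}
    (h : IsLocalDefiningFunction Ω x ξ) : ∀ᶠ y in 𝓝 x, IsLocalDefiningFunction Ω y ξ := by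
  have hc : Continuous fun y => gradient ξ y := by
    have := h.contDiff.continuous_fderiv one_ne_zero
    exact (InnerProductSpace.toDual ℝ R3).symm.continuous.comp this
  filter_upwards [h.eventually_mem_iff.eventually_nhds,
    hc.continuousAt.eventually_ne h.gradient_ne_zero] with y h1 h2
  exact ⟨h.contDiff, h2, h1⟩

lemma IsBoundedC1Domain.norm_outwardNormal {Ω : Set R3} (hΩ : IsBoundedC1Domain Ω) {x : R3}
    (hx : x ∈ frontier Ω) : ‖outwardNormal Ω x‖ = 1 := by
  obtain ⟨ξ, hξ⟩ := hΩ.exists_defining x hx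
  rw [hξ.outwardNormal_eq hΩ.isOpen hx, norm_smul, norm_inv, norm_norm]
  exact inv_mul_cancel₀ (by simpa using hξ.gradient_ne_zero)

lemma IsBoundedC1Domain.continuousOn_outwardNormal {Ω : Set R3} (hΩ : IsBoundedC1Domain Ω) :
    ContinuousOn (outwardNormal Ω) (frontier Ω) := by
  intro x hx
  obtain ⟨ξ, hξ⟩ := hΩ.exists_defining x hx
  have hc : Continuous fun y => gradient ξ y :=
    (InnerProductSpace.toDual ℝ R3).symm.continuous.comp
      (hξ.contDiff.continuous_fderiv one_ne_zero)
  have h1 : ContinuousWithinAt (fun y => ‖gradient ξ y‖⁻¹ • gradient ξ y) (frontier Ω) x :=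
    ((hc.norm.continuousAt.inv₀ (by simpa using hξ.gradient_ne_zero)).smul
      hc.continuousAt).continuousWithinAt
  refine h1.congr_of_eventuallyEq ?_ (hξ.outwardNormal_eq hΩ.isOpen hx)
  filter_upwards [nhdsWithin_le_nhds hξ.eventually, self_mem_nhdsWithin] with y h2 h3
  exact h2.outwardNormal_eq hΩ.isOpen h3

lemma IsBoundedC1Domain.isCompact_frontier {Ω : Set R3} (hΩ : IsBoundedC1Domain Ω) :
    IsCompact (frontier Ω) :=
  Metric.isCompact_of_isClosed_isBounded isClosed_frontier
    (hΩ.isBounded.closure.subset frontier_subset_closure)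

/-- On the ball of radius `r` around `x`, `Ω` is the sublevel set of a function `ξ` that is
`c`-close, in the Lipschitz sense, to the linear form given by the unit vector `e`. -/
structure IsFlatChart (Ω : Set R3) (x e : R3) (c r : ℝ) (ξ : R3 → ℝ) : Prop where
  pos : 0 < r
  norm_eq : ‖e‖ = 1
  mem_iff : ∀ y ∈ Metric.ball x r, (y ∈ Ω ↔ ξ y < 0)
  approx : ∀ y ∈ Metric.ball x r, ∀ z ∈ Metric.ball x r,
    |ξ y - ξ z - inner ℝ e (y - z)| ≤ c * ‖y - z‖

lemma IsFlatChart.mono {Ω : Set R3} {x e : R3} {c r : ℝ} {ξ : R3 → ℝ}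
    (h : IsFlatChart Ω x e c r ξ) {r' : ℝ} (hr' : 0 < r') (hr : r' ≤ r) :
    IsFlatChart Ω x e c r' ξ :=
  ⟨hr', h.norm_eq, fun y hy => h.mem_iff y (Metric.ball_subset_ball hr hy),
    fun y hy z hz => h.approx y (Metric.ball_subset_ball hr hy) z (Metric.ball_subset_ball hr hz)⟩

lemma IsFlatChart.continuousOn {Ω : Set R3} {x e : R3} {c r : ℝ} {ξ : R3 → ℝ}
    (h : IsFlatChart Ω x e c r ξ) : ContinuousOn ξ (Metric.ball x r) := by
  have : LipschitzOnWith (Real.toNNReal (|c| + 1)) ξ (Metric.ball x r) := by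
    refine LipschitzOnWith.of_dist_le_mul fun y hy z hz => ?_
    rw [Real.coe_toNNReal _ (by positivity), Real.dist_eq, dist_eq_norm]
    have h1 := h.approx y hy z hz
    have h2 := abs_real_inner_le_norm e (y - z)
    rw [h.norm_eq, one_mul] at h2
    have h3 : c * ‖y - z‖ ≤ |c| * ‖y - z‖ := by gcongr; exact le_abs_self c
    have h4 := abs_sub_abs_le_abs_sub (ξ y - ξ z) (inner ℝ e (y - z))
    linarith
  exact this.continuousOn

/-- This is strict differentiability at `x`, after division by `|∇ξ(x)|`. Such charts with small `c`
are used in place of coordinates that straighten the boundary. -/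
lemma IsBoundedC1Domain.exists_flatChart {Ω : Set R3} (hΩ : IsBoundedC1Domain Ω) {x : R3}
    (hx : x ∈ frontier Ω) {c : ℝ} (hc : 0 < c) :
    ∃ ξ r, IsFlatChart Ω x (outwardNormal Ω x) c r ξ := by
  obtain ⟨ξ, hξ⟩ := hΩ.exists_defining x hx
  set N := gradient ξ x
  have hN : 0 < ‖N‖ := norm_pos_iff.2 hξ.gradient_ne_zero
  have hcN : 0 < c * ‖N‖ := by positivity
  obtain ⟨s, hs, hs'⟩ := (hξ.hasStrictFDerivAt x).approximates_deriv_on_nhds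
    (c := ⟨c * ‖N‖, hcN.le⟩) (Or.inr hcN)
  obtain ⟨r, hr, hrs⟩ := Metric.mem_nhds_iff.1 (inter_mem hs hξ.eventually_mem_iff)
  refine ⟨fun y => ‖N‖⁻¹ * ξ y, r, hr, hΩ.norm_outwardNormal hx, fun y hy => ?_,
    fun y hy z hz => ?_⟩
  · refine (hrs hy).2.trans ?_
    constructor
    · intro h; exact mul_neg_of_pos_of_neg (by positivity) h
    · intro h; by_contra! h'; exact absurd h (not_lt.2 (by positivity))
  · have h1 := hs' y (hrs hy).1 z (hrs hz).1
    rw [hξ.outwardNormal_eq hΩ.isOpen hx, inner_smul_left, inner_gradient_left]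
    have : ‖N‖⁻¹ * ξ y - ‖N‖⁻¹ * ξ z - (starRingEnd ℝ) ‖N‖⁻¹ * (fderiv ℝ ξ x) (y - z)
        = ‖N‖⁻¹ * (ξ y - ξ z - (fderiv ℝ ξ x) (y - z)) := by
      simp only [conj_trivial]; ring
    rw [this, abs_mul, abs_of_pos (by positivity : 0 < ‖N‖⁻¹)]
    have h2 : |ξ y - ξ z - (fderiv ℝ ξ x) (y - z)| ≤ c * ‖N‖ * ‖y - z‖ := h1
    calc ‖N‖⁻¹ * |ξ y - ξ z - (fderiv ℝ ξ x) (y - z)| ≤ ‖N‖⁻¹ * (c * ‖N‖ * ‖y - z‖) := by gcongr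
      _ = c * ‖y - z‖ := by field_simp

lemma IsFlatChart.apply_eq_zero {Ω : Set R3} (hΩ : IsOpen Ω) {x e : R3} {c r : ℝ} {ξ : R3 → ℝ}
    (h : IsFlatChart Ω x e c r ξ) {y : R3} (hy : y ∈ Metric.ball x r) (hyf : y ∈ frontier Ω) :
    ξ y = 0 := by
  have hB : Metric.ball x r ∈ 𝓝 y := Metric.isOpen_ball.mem_nhds hy
  have h1 : ¬ ξ y < 0 := fun h' => frontier_notMem hΩ hyf ((h.mem_iff y hy).2 h')
  have h2 : ξ y ≤ 0 := by
    by_contra! h'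
    have hc : ∀ᶠ z in 𝓝 y, 0 < ξ z := (h.continuousOn.continuousAt hB).eventually_const_lt h'
    obtain ⟨z, ⟨hz1, hz2⟩, hz3⟩ :=
      mem_closure_iff_nhds.1 (frontier_subset_closure hyf) _ (hc.and hB)
    exact absurd ((h.mem_iff z hz2).1 hz3) (not_lt.2 hz1.le)
  linarith

/-- Along directions `w` transversal to the chart, `ξ` is strictly increasing. -/
lemma IsFlatChart.lt_of_lt {Ω : Set R3} {x e : R3} {c r : ℝ} {ξ : R3 → ℝ}
    (h : IsFlatChart Ω x e c r ξ) {w : R3} (hw : c * ‖w‖ < inner ℝ e w) {y : R3} {s t : ℝ}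
    (hs : y + s • w ∈ Metric.ball x r) (ht : y + t • w ∈ Metric.ball x r) (hst : s < t) :
    ξ (y + s • w) < ξ (y + t • w) := by
  have h1 := h.approx _ ht _ hs
  have h2 : y + t • w - (y + s • w) = (t - s) • w := by rw [sub_smul]; abel
  rw [h2, inner_smul_right, norm_smul, Real.norm_of_nonneg (by linarith)] at h1
  have h3 := (abs_le.1 h1).1
  nlinarith [mul_lt_mul_of_pos_left hw (sub_pos.2 hst)]

/-- Moving backwards along `e`, which is transversal since `⟨e, e⟩ = 1 > c`, makes `ξ` negative. So
a zero of `ξ` is a limit of points of `Ω`. -/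
lemma IsFlatChart.mem_frontier {Ω : Set R3} (hΩ : IsOpen Ω) {x e : R3} {c r : ℝ} {ξ : R3 → ℝ}
    (h : IsFlatChart Ω x e c r ξ) (hc : c < 1) {y : R3} (hy : y ∈ Metric.ball x r)
    (hξ : ξ y = 0) : y ∈ frontier Ω := by
  have hB : Metric.ball x r ∈ 𝓝 y := Metric.isOpen_ball.mem_nhds hy
  rw [hΩ.frontier_eq]
  refine ⟨?_, fun h' => by have := (h.mem_iff y hy).1 h'; linarith⟩
  have hl : Tendsto (fun s : ℝ => y + s • e) (𝓝[<] 0) (𝓝 y) := by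
    have : Continuous fun s : ℝ => y + s • e := by fun_prop
    simpa using (this.tendsto 0).mono_left nhdsWithin_le_nhds
  refine mem_closure_of_tendsto hl ?_
  filter_upwards [hl.eventually hB, self_mem_nhdsWithin] with s h1 h2
  have he : c * ‖e‖ < inner ℝ e e := by
    rw [real_inner_self_eq_norm_sq, h.norm_eq]; linarith
  have := h.lt_of_lt he (y := y) (s := s) (t := 0) h1 (by simpa using hy) h2
  rw [(h.mem_iff _ h1)]
  simpa [hξ] using this

/-- Small inward shifts of small balls around points of `closure Ω` stay inside `Ω`. -/
lemma IsBoundedC1Domain.exists_shift {Ω : Set R3} (hΩ : IsBoundedC1Domain Ω) (x₀ : R3) :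
    ∃ a : R3, ∃ r > 0, ∃ ε₀ > 0, ∀ x ∈ closure Ω ∩ Metric.ball x₀ r, ∀ ε ∈ Ioo 0 ε₀,
      Metric.ball (x - ε • a) ε ⊆ Ω := by
  by_cases h0 : x₀ ∈ closure Ω
  swap
  · obtain ⟨r, hr, hrs⟩ := Metric.mem_nhds_iff.1 (isClosed_closure.isOpen_compl.mem_nhds h0)
    exact ⟨0, r, hr, 1, one_pos, fun x hx => absurd hx.1 (hrs hx.2)⟩
  by_cases hf : x₀ ∈ frontier Ω
  · set e := outwardNormal Ω x₀
    -- For `y` within `ε` of `x - 2εe` one has `|y - x| ≤ 3ε` and `⟨e, y - x⟩ < -ε`. With `c = 1/6`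
    -- the chart error is at most `ε/2`, hence `ξ y < ξ x - ε/2 < 0`.
    obtain ⟨ξ, r, h⟩ := hΩ.exists_flatChart hf (c := 1 / 6) (by norm_num)
    have hr := h.pos
    have he : ‖e‖ = 1 := h.norm_eq
    refine ⟨(2 : ℝ) • e, r / 2, by positivity, r / 6, by positivity, ?_⟩
    rintro x ⟨hxc, hxb⟩ ε ⟨hε, hε'⟩ y hy
    rw [Metric.mem_ball, dist_eq_norm] at hy hxb
    have hxr : x ∈ Metric.ball x₀ r := by
      rw [Metric.mem_ball, dist_eq_norm]; linarith
    have hyx : ‖y - x‖ ≤ 3 * ε := by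
      have : y - x = (y - (x - ε • (2 : ℝ) • e)) - ε • (2 : ℝ) • e := by abel
      rw [this]
      refine (norm_sub_le _ _).trans ?_
      rw [norm_smul, norm_smul, he, Real.norm_of_nonneg hε.le, Real.norm_of_nonneg (by norm_num)]
      linarith
    have hyr : y ∈ Metric.ball x₀ r := by
      rw [Metric.mem_ball, dist_eq_norm]
      have := norm_add_le (y - x) (x - x₀)
      rw [sub_add_sub_cancel] at this
      linarith
    have hξx : ξ x ≤ 0 := by
      rcases (closure_eq_self_union_frontier Ω ▸ hxc : x ∈ Ω ∪ frontier Ω) with hx | hx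
      · exact ((h.mem_iff x hxr).1 hx).le
      · exact (h.apply_eq_zero hΩ.isOpen hxr hx).le
    rw [h.mem_iff y hyr]
    have h1 := (abs_le.1 (h.approx y hyr x hxr)).2
    have h2 : inner ℝ e (y - x) < -ε := by
      have : y - x = (y - (x - ε • (2 : ℝ) • e)) - ε • (2 : ℝ) • e := by abel
      rw [this, inner_sub_right, inner_smul_right, inner_smul_right, real_inner_self_eq_norm_sq, he]
      have := real_inner_le_norm e (y - (x - ε • (2 : ℝ) • e))
      rw [he] at this
      linarith
    have h3 : inner ℝ (outwardNormal Ω x₀) (y - x) < -ε := h2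
    linarith
  · have hx : x₀ ∈ Ω := by
      rcases (closure_eq_self_union_frontier Ω ▸ h0 : x₀ ∈ Ω ∪ frontier Ω) with hx | hx
      · exact hx
      · exact absurd hx hf
    obtain ⟨r, hr, hrs⟩ := Metric.mem_nhds_iff.1 (hΩ.isOpen.mem_nhds hx)
    refine ⟨0, r / 2, by positivity, r / 2, by positivity, ?_⟩
    rintro x ⟨-, hxb⟩ ε ⟨hε, hε'⟩ y hy
    apply hrs
    rw [Metric.mem_ball] at hy hxb ⊢
    simp only [smul_zero, sub_zero] at hy
    linarith [dist_triangle y x x₀]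

/-! ### Surface measure and projections onto planes -/

/-- The Euclidean plane. -/
abbrev R2 : Type := EuclideanSpace ℝ (Fin 2)

/-- `ι` is an isometric parametrization of the plane orthogonal to the unit vector `w`. -/
structure IsPlane (w : R3) (ι : R2 →ₗᵢ[ℝ] R3) : Prop where
  norm_eq : ‖w‖ = 1
  inner_eq : ∀ y, inner ℝ w (ι y) = 0

lemma exists_isPlane {w : R3} (hw : ‖w‖ = 1) : ∃ ι, IsPlane w ι := by
  have hw0 : w ≠ 0 := by rintro rfl; simp at hw
  have : Fact (Module.finrank ℝ R3 = 2 + 1) := ⟨by simp⟩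
  let b := OrthonormalBasis.fromOrthogonalSpanSingleton (𝕜 := ℝ) 2 hw0
  refine ⟨(Submodule.subtypeₗᵢ _).comp b.repr.symm.toLinearIsometry, hw, fun y => ?_⟩
  exact (Submodule.mem_orthogonal_singleton_iff_inner_right).1 (b.repr.symm y).2

/-- The coordinates, in the plane parametrized by `ι`, of the orthogonal projection of a point. -/
noncomputable def planeProj (ι : R2 →ₗᵢ[ℝ] R3) : R3 →L[ℝ] R2 :=
  ContinuousLinearMap.adjoint ι.toContinuousLinearMap

lemma inner_planeProj_left (ι : R2 →ₗᵢ[ℝ] R3) (x : R3) (y : R2) :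
    inner ℝ (planeProj ι x) y = inner ℝ x (ι y) := by
  rw [planeProj, ContinuousLinearMap.adjoint_inner_left]; rfl

lemma planeProj_apply_map (ι : R2 →ₗᵢ[ℝ] R3) (y : R2) : planeProj ι (ι y) = y := by
  refine ext_inner_right ℝ fun z => ?_
  rw [inner_planeProj_left, LinearIsometry.inner_map_map]

/-- The isometry between `ℝ² × ℝ` and `ℝ³` associated with an orthogonal plane. -/
noncomputable def IsPlane.isometry {w : R3} {ι : R2 →ₗᵢ[ℝ] R3} (h : IsPlane w ι) :
    WithLp 2 (R2 × ℝ) →ₗᵢ[ℝ] R3 where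
  toFun q := ι q.fst + q.snd • w
  map_add' a b := by simp [add_smul]; abel
  map_smul' c a := by simp [mul_smul]
  norm_map' q := by
    have h1 : ‖ι q.fst + q.snd • w‖ ^ 2 = ‖q‖ ^ 2 := by
      rw [norm_add_sq_real, WithLp.prod_norm_sq_eq_of_L2, LinearIsometry.norm_map, norm_smul,
        h.norm_eq, inner_smul_right, real_inner_comm, h.inner_eq]
      ring
    exact (sq_eq_sq₀ (norm_nonneg _) (norm_nonneg _)).1 h1

lemma finrank_withLp_R2 : Module.finrank ℝ (WithLp 2 (R2 × ℝ)) = Module.finrank ℝ R3 := by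
  rw [(WithLp.linearEquiv 2 ℝ (R2 × ℝ)).finrank_eq]
  simp

lemma IsPlane.measurePreserving {w : R3} {ι : R2 →ₗᵢ[ℝ] R3} (h : IsPlane w ι) :
    MeasurePreserving (fun q : R2 × ℝ => ι q.1 + q.2 • w) (volume.prod volume) volume :=
  (LinearIsometryEquiv.measurePreserving
    (h.isometry.toLinearIsometryEquiv finrank_withLp_R2)).comp
      (WithLp.volume_preserving_toLp R2 ℝ)

lemma IsPlane.map_planeProj {w : R3} {ι : R2 →ₗᵢ[ℝ] R3} (h : IsPlane w ι) (x : R3) :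
    ι (planeProj ι x) = x - (inner ℝ w x) • w := by
  obtain ⟨q, rfl⟩ := (h.isometry.toLinearIsometryEquiv finrank_withLp_R2).surjective x
  have h1 : (h.isometry.toLinearIsometryEquiv finrank_withLp_R2) q = ι q.fst + q.snd • w := rfl
  have h2 : planeProj ι w = 0 := by
    refine ext_inner_right ℝ fun z => ?_
    rw [inner_planeProj_left, h.inner_eq, inner_zero_left]
  rw [h1, map_add, map_smul, h2, planeProj_apply_map, inner_add_right, h.inner_eq,
    inner_smul_right, real_inner_self_eq_norm_sq, h.norm_eq]
  simp

lemma IsPlane.norm_sq_eq {w : R3} {ι : R2 →ₗᵢ[ℝ] R3} (h : IsPlane w ι) (x : R3) :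
    ‖x‖ ^ 2 = ‖planeProj ι x‖ ^ 2 + (inner ℝ w x) ^ 2 := by
  have h1 : x = ι (planeProj ι x) + (inner ℝ w x) • w := by rw [h.map_planeProj]; abel
  conv_lhs => rw [h1]
  rw [norm_add_sq_real, LinearIsometry.norm_map, norm_smul, h.norm_eq, inner_smul_right,
    real_inner_comm w, h.inner_eq]
  simp

lemma IsPlane.norm_planeProj_le {w : R3} {ι : R2 →ₗᵢ[ℝ] R3} (h : IsPlane w ι) (x : R3) :
    ‖planeProj ι x‖ ≤ ‖x‖ := by
  refine le_of_sq_le_sq ?_ (norm_nonneg _)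
  rw [h.norm_sq_eq x]
  nlinarith [sq_nonneg (inner ℝ w x)]

/-- For `M` the projection from one plane to the other, `M*M = 1 - a ⊗ a`, where `a` is the
projection of `w` to the plane orthogonal to `q`. Its determinant `1 - |a|²` equals `⟨w, q⟩²` by
Pythagoras. -/
lemma abs_det_planeProj {w q : R3} {ι κ : R2 →ₗᵢ[ℝ] R3} (hι : IsPlane w ι) (hκ : IsPlane q κ) :
    |(planeProj ι ∘L κ.toContinuousLinearMap).det| = |inner ℝ w q| := by
  set M := planeProj ι ∘L κ.toContinuousLinearMap with hM
  set a := planeProj κ w with ha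
  have h1 : (((ContinuousLinearMap.adjoint M ∘L M : R2 →L[ℝ] R2)) : R2 →ₗ[ℝ] R2)
      = LinearMap.transvection (-(innerₛₗ ℝ a)) a := by
    ext1 y
    refine ext_inner_right ℝ fun z => ?_
    have h2 : inner ℝ ((ContinuousLinearMap.adjoint M) (M y)) z = inner ℝ (M y) (M z) :=
      ContinuousLinearMap.adjoint_inner_left _ _ _
    have h3 : ∀ y, M y = planeProj ι (κ y) := fun y => rfl
    have h4 : inner ℝ (M y) (M z) = inner ℝ y z - inner ℝ a y * inner ℝ a z := by
      rw [h3, h3, inner_planeProj_left, hι.map_planeProj, inner_sub_right, inner_smul_right,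
        LinearIsometry.inner_map_map, ha, inner_planeProj_left, inner_planeProj_left,
        real_inner_comm w (κ y)]
      ring
    simp only [ContinuousLinearMap.toLinearMap_comp, LinearMap.coe_comp,
      ContinuousLinearMap.coe_coe, Function.comp_apply, h2, h4, LinearMap.transvection.apply,
      LinearMap.neg_apply, innerₛₗ_apply_apply, inner_add_left, inner_smul_left, inner_neg_left,
      neg_smul, conj_trivial]
    ring
  have h2 := ContinuousLinearMap.normDet_sq M
  have h3 : (ContinuousLinearMap.adjoint M ∘L M).det = 1 - ‖a‖ ^ 2 := by
    rw [ContinuousLinearMap.det, h1, LinearMap.transvection.det]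
    simp [sub_eq_add_neg]
  have h4 : ‖a‖ ^ 2 = 1 - (inner ℝ w q) ^ 2 := by
    have := hκ.norm_sq_eq w
    rw [hι.norm_eq, real_inner_comm] at this
    rw [ha]; linarith
  rw [h3, LinearMap.normDet_eq_abs_det] at h2
  have h5 : |M.det| ^ 2 = |inner ℝ w q| ^ 2 := by
    rw [sq_abs (inner ℝ w q)]
    have : (RCLike.ofReal (|M.det| ^ 2) : ℝ) = |M.det| ^ 2 := rfl
    have h6 : |M.det| ^ 2 = 1 - ‖a‖ ^ 2 := h2
    rw [h6, h4]; ring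
  exact (sq_eq_sq₀ (abs_nonneg _) (abs_nonneg _)).1 h5

lemma euclideanHausdorffMeasure_image_le_of_lipschitzOn {X Y : Type*} [EMetricSpace X]
    [EMetricSpace Y] [MeasurableSpace X] [BorelSpace X] [MeasurableSpace Y] [BorelSpace Y]
    {K : ℝ≥0} {f : X → Y} {s : Set X} (h : LipschitzOnWith K f s) (d : ℕ) :
    (Measure.euclideanHausdorffMeasure d : Measure Y) (f '' s) ≤
      (K : ℝ≥0∞) ^ d * (Measure.euclideanHausdorffMeasure d : Measure X) s := by
  simp only [Measure.euclideanHausdorffMeasure_def, Measure.smul_apply, ENNReal.smul_def,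
    smul_eq_mul]
  have := h.hausdorffMeasure_image_le (d := (d : ℝ)) (by positivity)
  rw [ENNReal.rpow_natCast] at this
  calc _ ≤ _ * ((K : ℝ≥0∞) ^ d * (Measure.hausdorffMeasure (d : ℝ) : Measure X) s) :=
        mul_le_mul_right this _
    _ = _ := by ring

/-- The two-dimensional surface measure in space. -/
noncomputable abbrev surf : Measure R3 := Measure.euclideanHausdorffMeasure 2

/-- The set `A` is almost contained in a plane orthogonal to `q`. -/
def IsNearlyFlat (q : R3) (c : ℝ) (A : Set R3) : Prop :=
  ∀ x ∈ A, ∀ y ∈ A, |inner ℝ q (x - y)| ≤ c * ‖x - y‖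

lemma IsPlane.volume_image_le {w : R3} {ι : R2 →ₗᵢ[ℝ] R3} (h : IsPlane w ι) (A : Set R3) :
    volume (planeProj ι '' A) ≤ surf A := by
  have h1 : LipschitzOnWith 1 (planeProj ι) A := by
    refine LipschitzOnWith.of_dist_le_mul fun x _ y _ => ?_
    rw [dist_eq_norm, dist_eq_norm, ← map_sub]
    simpa using h.norm_planeProj_le (x - y)
  have := euclideanHausdorffMeasure_image_le_of_lipschitzOn h1 2
  rw [EuclideanSpace.euclideanHausdorffMeasure_eq_volume] at this
  simpa using this

/-- The normal component of `x - y` takes at most a fraction `c` of its length, so by Pythagoras the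
set is a Lipschitz graph over the plane, with a constant that tends to `1` as `c → 0`. -/
lemma IsPlane.norm_le_of_nearlyFlat {q : R3} {κ : R2 →ₗᵢ[ℝ] R3} (h : IsPlane q κ) {c : ℝ}
    (hc0 : 0 ≤ c) (hc : c < 1) {A : Set R3} (hA : IsNearlyFlat q c A) {x y : R3} (hx : x ∈ A)
    (hy : y ∈ A) : ‖x - y‖ ≤ (Real.sqrt (1 - c ^ 2))⁻¹ * ‖planeProj κ x - planeProj κ y‖ := by
  have hpos : 0 < 1 - c ^ 2 := by nlinarith
  have h1 := h.norm_sq_eq (x - y)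
  have h2 := hA x hx y hy
  have h3 : (inner ℝ q (x - y)) ^ 2 ≤ c ^ 2 * ‖x - y‖ ^ 2 := by
    rw [← sq_abs, ← mul_pow]; gcongr
  rw [inv_mul_eq_div, le_div_iff₀ (Real.sqrt_pos.2 hpos), ← map_sub]
  refine le_of_sq_le_sq ?_ (norm_nonneg _)
  rw [mul_pow, Real.sq_sqrt hpos.le]
  linarith

/-- Orthogonal projection in a direction `w` multiplies the area of nearly flat pieces with
normal `q` by approximately `⟨w, q⟩`. -/
lemma exists_area_bounds {w q : R3} {ι : R2 →ₗᵢ[ℝ] R3} (hι : IsPlane w ι) (hq : ‖q‖ = 1)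
    {m₁ m₂ : ℝ≥0} (h₁ : (m₁ : ℝ) < inner ℝ w q) (h₂ : inner ℝ w q < m₂) :
    ∃ c > 0, ∀ A : Set R3, IsNearlyFlat q c A →
      m₁ * surf A ≤ volume (planeProj ι '' A) ∧ volume (planeProj ι '' A) ≤ m₂ * surf A := by
  -- The projection along `w` is compared with `M` acting on the coordinates in the tangent plane
  -- `κ`. The area of `A` is close to that of its shadow in this plane, and plane areas are
  -- distorted by about `|det M| = ⟨w, q⟩`.
  obtain ⟨κ, hκ⟩ := exists_isPlane hq
  set M := planeProj ι ∘L κ.toContinuousLinearMap with hM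
  have hin : 0 ≤ inner ℝ w q := m₁.2.trans h₁.le
  have hdet : |M.det| = inner ℝ w q := by rw [abs_det_planeProj hι hκ, abs_of_nonneg hin]
  obtain ⟨m', hm1, hm2⟩ := exists_between h₁
  have hm0 : 0 < m' := lt_of_le_of_lt m₁.2 hm1
  lift m' to ℝ≥0 using hm0.le
  obtain ⟨δ₂, hδ₂, hδ₂0⟩ := ((addHaar_image_le_mul_of_det_lt (volume : Measure R2) M (m := m₂)
    (by rw [hdet, ENNReal.ofReal_lt_coe_iff hin]; exact h₂)).and
      self_mem_nhdsWithin).exists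
  obtain ⟨δ₁, hδ₁, hδ₁0⟩ := ((mul_le_addHaar_image_of_lt_det (volume : Measure R2) M
    (m := m') (by
      rw [hdet, ENNReal.coe_lt_ofReal]; exact hm2)).and self_mem_nhdsWithin).exists
  replace hδ₁0 : 0 < (δ₁ : ℝ) := hδ₁0
  replace hδ₂0 : 0 < (δ₂ : ℝ) := hδ₂0
  -- The graph over the tangent plane may enlarge area by `1/(1 - c²)`. The gap between `m₁` and
  -- `m'` leaves room for this loss.
  obtain ⟨c₀, hc₀, hc₀'⟩ : ∃ c₀ > 0, ∀ c, 0 < c → c < c₀ → (m₁ : ℝ) ≤ m' * (1 - c ^ 2) := by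
    have hl : ∀ᶠ c : ℝ in 𝓝 0, (m₁ : ℝ) < m' * (1 - c ^ 2) := by
      have : Continuous fun c : ℝ => m' * (1 - c ^ 2) := by fun_prop
      have h := this.tendsto 0
      simp only [ne_eq, OfNat.ofNat_ne_zero, not_false_eq_true, zero_pow, sub_zero, mul_one] at h
      exact h.eventually_const_lt hm1
    obtain ⟨r, hr, h⟩ := Metric.eventually_nhds_iff.1 hl
    exact ⟨r, hr, fun c hc hcr => (h (by rw [Real.dist_eq, sub_zero, abs_of_pos hc]; exact hcr)).le⟩
  set c := min (c₀ / 2) (min (1 / 2) (min (δ₁ / 2) (δ₂ / 2))) with hc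
  have hc0 : 0 < c := by positivity
  have hc1 : c < c₀ := lt_of_le_of_lt (min_le_left _ _) (by linarith)
  have hc2 : c ≤ 1 / 2 := (min_le_right _ _).trans (min_le_left _ _)
  have hc3 : c ≤ δ₁ / 2 := (min_le_right _ _).trans ((min_le_right _ _).trans (min_le_left _ _))
  have hc4 : c ≤ δ₂ / 2 := (min_le_right _ _).trans ((min_le_right _ _).trans (min_le_right _ _))
  refine ⟨c, hc0, fun A hA => ?_⟩
  set k : ℝ := (Real.sqrt (1 - c ^ 2))⁻¹ with hk
  have hpos : 0 < 1 - c ^ 2 := by nlinarith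
  have hk0 : 0 < k := by rw [hk]; exact inv_pos.2 (Real.sqrt_pos.2 hpos)
  have hk2 : k ^ 2 * (1 - c ^ 2) = 1 := by
    rw [hk, inv_pow, Real.sq_sqrt hpos.le]; field_simp
  have hk3 : k ≤ 2 := by
    have : 3 / 4 ≤ 1 - c ^ 2 := by nlinarith
    by_contra! h'
    nlinarith [mul_le_mul_of_nonneg_left this (sq_nonneg k)]
  have hdist := fun x (hx : x ∈ A) y (hy : y ∈ A) =>
    hκ.norm_le_of_nearlyFlat hc0.le (by linarith : c < 1) hA hx hy
  set D := planeProj κ '' A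
  have hinj : InjOn (planeProj κ) A := by
    intro x hx y hy hxy
    have := hdist x hx y hy
    rw [hxy, sub_self, norm_zero, mul_zero] at this
    exact sub_eq_zero.1 (norm_le_zero_iff.1 this)
  have : Nonempty R3 := ⟨0⟩
  set Q := Function.invFunOn (planeProj κ) A
  have hQ : ∀ x ∈ A, Q (planeProj κ x) = x := fun x hx => hinj.leftInvOn_invFunOn hx
  have hQD : Q '' D = A := by
    rw [← image_comp]
    exact (image_congr fun x hx => hQ x hx).trans (image_id _)
  have hQL : LipschitzOnWith (Real.toNNReal k) Q D := by
    refine LipschitzOnWith.of_dist_le_mul ?_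
    rintro _ ⟨x, hx, rfl⟩ _ ⟨y, hy, rfl⟩
    rw [hQ x hx, hQ y hy, dist_eq_norm, dist_eq_norm, Real.coe_toNNReal _ hk0.le]
    exact hdist x hx y hy
  have hsurf : surf A ≤ ENNReal.ofReal (k ^ 2) * volume D := by
    have := euclideanHausdorffMeasure_image_le_of_lipschitzOn hQL 2
    rw [hQD, EuclideanSpace.euclideanHausdorffMeasure_eq_volume] at this
    rwa [ENNReal.ofReal_pow hk0.le]
  have himg : (fun y => planeProj ι (Q y)) '' D = planeProj ι '' A := by
    conv_rhs => rw [← hQD, ← image_comp]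
    rfl
  have happ : ∀ δ : ℝ≥0, c ≤ δ / 2 →
      ApproximatesLinearOn (fun y => planeProj ι (Q y)) M D δ := by
    intro δ hδ
    rintro _ ⟨x, hx, rfl⟩ _ ⟨y, hy, rfl⟩
    simp only [hQ x hx, hQ y hy]
    -- The two maps differ only through the component of `x - y` along `q`, which is small on a
    -- nearly flat set.
    have h1 : planeProj ι x - planeProj ι y - M (planeProj κ x - planeProj κ y)
        = (inner ℝ q (x - y)) • planeProj ι q := by
      have : M (planeProj κ x - planeProj κ y) = planeProj ι (κ (planeProj κ (x - y))) := by
        rw [map_sub (planeProj κ)]; rfl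
      rw [this, hκ.map_planeProj, ← map_sub, ← map_sub, ← map_smul]
      congr 1
      abel
    rw [h1, norm_smul, Real.norm_eq_abs]
    have h2 : ‖planeProj ι q‖ ≤ 1 := (hι.norm_planeProj_le q).trans hq.le
    calc |inner ℝ q (x - y)| * ‖planeProj ι q‖ ≤ (c * ‖x - y‖) * 1 := by
          gcongr
          exact hA x hx y hy
      _ ≤ c * (k * ‖planeProj κ x - planeProj κ y‖) := by
          rw [mul_one]; gcongr; exact hdist x hx y hy
      _ = (c * k) * ‖planeProj κ x - planeProj κ y‖ := by ring
      _ ≤ δ * ‖planeProj κ x - planeProj κ y‖ := by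
          gcongr
          nlinarith [δ.2]
  constructor
  · have h1 := hδ₁ D _ (happ δ₁ hc3)
    rw [himg] at h1
    refine le_trans ?_ h1
    calc (m₁ : ℝ≥0∞) * surf A ≤ m₁ * (ENNReal.ofReal (k ^ 2) * volume D) := by gcongr
      _ = (m₁ * ENNReal.ofReal (k ^ 2)) * volume D := by ring
      _ ≤ _ := by
        gcongr
        rw [← ENNReal.ofReal_coe_nnreal (p := m₁), ← ENNReal.ofReal_coe_nnreal (p := m'),
          ← ENNReal.ofReal_mul m₁.coe_nonneg]
        apply ENNReal.ofReal_le_ofReal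
        have := hc₀' c hc0 hc1
        calc (m₁ : ℝ) * k ^ 2 ≤ m' * (1 - c ^ 2) * k ^ 2 := by gcongr
          _ = m' * (k ^ 2 * (1 - c ^ 2)) := by ring
          _ = m' := by rw [hk2, mul_one]
  · have h1 := hδ₂ D _ (happ δ₂ hc4)
    rw [himg] at h1
    exact h1.trans (by gcongr; exact hκ.volume_image_le A)

/-- Comparison of measures is a local property. -/
lemma measure_le_of_locally_le {X : Type*} [TopologicalSpace X] [SecondCountableTopology X]
    [MeasurableSpace X] [OpensMeasurableSpace X] {μ ν : Measure X}
    (h : ∀ x, ∃ U ∈ 𝓝 x, ∀ A ⊆ U, MeasurableSet A → μ A ≤ ν A) : μ ≤ ν := by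
  choose U hU hUA using h
  obtain ⟨s, hs, hs'⟩ := TopologicalSpace.countable_cover_nhds (f := fun x => interior (U x))
    (fun x => interior_mem_nhds.2 (hU x))
  have := hs.to_subtype
  by_cases hX : s.Nonempty
  swap
  · rw [not_nonempty_iff_eq_empty] at hX
    simp only [hX, mem_empty_iff_false, iUnion_of_empty, iUnion_empty] at hs'
    have : IsEmpty X := univ_eq_empty_iff.1 hs'.symm
    refine Measure.le_iff.2 fun A _ => ?_
    rw [eq_empty_of_isEmpty A]; simp
  obtain ⟨u, hu⟩ := hs.exists_eq_range hX
  have hcov : ⋃ n, interior (U (u n)) = univ := by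
    rw [← hs', hu, biUnion_range]
  set V := disjointed fun n => interior (U (u n))
  have hVm : ∀ n, MeasurableSet (V n) :=
    MeasurableSet.disjointed fun n => isOpen_interior.measurableSet
  have hVU : ⋃ n, V n = univ := by rw [iUnion_disjointed, hcov]
  refine Measure.le_iff.2 fun A hA => ?_
  have hA' : A = ⋃ n, A ∩ V n := by rw [← inter_iUnion, hVU, inter_univ]
  have hd : Pairwise (Function.onFun Disjoint fun n => A ∩ V n) := fun i j hij =>
    (disjoint_disjointed _ hij).mono inter_subset_right inter_subset_right
  rw [hA', measure_iUnion hd fun n => hA.inter (hVm n),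
    measure_iUnion hd fun n => hA.inter (hVm n)]
  refine ENNReal.tsum_le_tsum fun n => hUA (u n) _ ?_ (hA.inter (hVm n))
  exact inter_subset_right.trans ((disjointed_subset _ n).trans interior_subset)

/-- Integration over a piece `S` of a surface through an injective projection whose local area
distortion is `g`. -/
lemma integral_eq_of_area_bounds {S : Set R3} (hS : MeasurableSet S) {p : R3 → R2}
    (hp : Continuous p) (hinj : InjOn p S) {g : R3 → ℝ} (hg : ContinuousOn g S)
    (hg0 : ∀ x ∈ S, 0 < g x)
    (hloc : ∀ x ∈ S, ∀ m₁ m₂ : ℝ≥0, (m₁ : ℝ) < g x → g x < m₂ → ∃ r > 0, ∀ A ⊆ S ∩ Metric.ball x r,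
      m₁ * surf A ≤ volume (p '' A) ∧ volume (p '' A) ≤ m₂ * surf A)
    {φ : R3 → ℝ} {G : R2 → ℝ} (hG : ∀ x ∈ S, G (p x) = φ x) (hG0 : ∀ y, y ∉ p '' S → G y = 0) :
    ∫ y, G y = ∫ x in S, g x * φ x ∂surf := by
  have hemb : MeasurableEmbedding fun x : S => p x := by
    have := hS.standardBorel
    exact (hp.comp continuous_subtype_val).measurable.measurableEmbedding
      (injOn_iff_injective.1 hinj)
  have hval : MeasurableEmbedding (Subtype.val : S → R3) := MeasurableEmbedding.subtype_coe hS
  set μ : Measure S := Measure.comap (fun x : S => p x) volume with hμ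
  set H : Measure S := Measure.comap Subtype.val surf with hH
  have hgS : Continuous fun x : S => g x := continuousOn_iff_continuous_domRestrict.1 hg
  have hgm : Measurable fun x : S => ENNReal.ofReal (g x) := hgS.measurable.ennreal_ofReal
  set ν := H.withDensity fun x : S => ENNReal.ofReal (g x) with hν
  have hμA : ∀ A : Set S, μ A = volume (p '' (Subtype.val '' A)) := fun A => by
    rw [hμ, hemb.comap_apply, ← image_comp]; rfl
  have hHA : ∀ A : Set S, H A = surf (Subtype.val '' A) := fun A => by
    rw [hH, hval.comap_apply]
  -- Near each point the two measures are comparable up to any factor `t > 1`: continuity of `g` and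
  -- the area bounds each cost `√t`. A countable cover makes this global, and `t → 1` gives equality
  -- of the measures.
  have key : ∀ t : ℝ≥0, 1 < t → μ ≤ (t : ℝ≥0∞) • ν ∧ ν ≤ (t : ℝ≥0∞) • μ := by
    intro t ht
    have hloc' : ∀ x : S, ∃ U ∈ 𝓝 x, ∀ A ⊆ U, MeasurableSet A →
        μ A ≤ ((t : ℝ≥0∞) • ν) A ∧ ν A ≤ ((t : ℝ≥0∞) • μ) A := by
      intro x
      have hgx := hg0 x x.2
      obtain ⟨s, hs1, hs2⟩ : ∃ s : ℝ, 1 < s ∧ s * s ≤ t := by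
        refine ⟨Real.sqrt t, ?_, (Real.mul_self_sqrt t.2).le⟩
        rw [Real.lt_sqrt zero_le_one]; simpa using ht
      have hs0 : 0 < s := by linarith
      set m₁ : ℝ≥0 := Real.toNNReal (g x / s)
      set m₂ : ℝ≥0 := Real.toNNReal (g x * s)
      have hm₁ : (m₁ : ℝ) = g x / s := Real.coe_toNNReal _ (by positivity)
      have hm₂ : (m₂ : ℝ) = g x * s := Real.coe_toNNReal _ (by positivity)
      have hlt1 : (m₁ : ℝ) < g x := by rw [hm₁, div_lt_iff₀ hs0]; nlinarith
      have hlt2 : g x < m₂ := by rw [hm₂]; nlinarith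
      have hm : m₂ ≤ t * m₁ := by
        rw [← NNReal.coe_le_coe, NNReal.coe_mul, hm₁, hm₂, mul_div_assoc', le_div_iff₀ hs0]
        nlinarith
      obtain ⟨r, hr, hA⟩ := hloc x x.2 m₁ m₂ hlt1 hlt2
      refine ⟨{y : S | (m₁ : ℝ) < g y ∧ g y < m₂} ∩ Subtype.val ⁻¹' Metric.ball (x : R3) r,
        inter_mem ?_ ?_, fun A hAU hAm => ?_⟩
      · exact (hgS.continuousAt.eventually_const_lt hlt1).and
          (hgS.continuousAt.eventually_lt_const hlt2)
      · exact continuous_subtype_val.continuousAt.preimage_mem_nhds (Metric.ball_mem_nhds _ hr)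
      have hAS : Subtype.val '' A ⊆ S ∩ Metric.ball (x : R3) r := by
        rintro _ ⟨y, hy, rfl⟩
        exact ⟨y.2, (hAU hy).2⟩
      obtain ⟨b1, b2⟩ := hA _ hAS
      rw [← hμA, ← hHA] at b1 b2
      have hνA : ν A = ∫⁻ y in A, ENNReal.ofReal (g y) ∂H := withDensity_apply _ hAm
      have c1 : m₁ * H A ≤ ν A := by
        rw [hνA, ← setLIntegral_const]
        refine setLIntegral_mono hgm fun y hy => ?_
        rw [← ENNReal.ofReal_coe_nnreal]
        exact ENNReal.ofReal_le_ofReal (hAU hy).1.1.le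
      have c2 : ν A ≤ m₂ * H A := by
        rw [hνA, ← setLIntegral_const]
        refine setLIntegral_mono measurable_const fun y hy => ?_
        rw [← ENNReal.ofReal_coe_nnreal]
        exact ENNReal.ofReal_le_ofReal (hAU hy).1.2.le
      have hmE : (m₂ : ℝ≥0∞) ≤ t * m₁ := by exact_mod_cast hm
      simp only [Measure.smul_apply, smul_eq_mul]
      constructor
      · calc μ A ≤ m₂ * H A := b2
          _ ≤ t * m₁ * H A := by gcongr
          _ = t * (m₁ * H A) := by ring
          _ ≤ t * ν A := by gcongr
      · calc ν A ≤ m₂ * H A := c2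
          _ ≤ t * m₁ * H A := by gcongr
          _ = t * (m₁ * H A) := by ring
          _ ≤ t * μ A := by gcongr
    constructor
    · refine measure_le_of_locally_le fun x => ?_
      obtain ⟨U, hU, h⟩ := hloc' x
      exact ⟨U, hU, fun A h1 h2 => (h A h1 h2).1⟩
    · refine measure_le_of_locally_le fun x => ?_
      obtain ⟨U, hU, h⟩ := hloc' x
      exact ⟨U, hU, fun A h1 h2 => (h A h1 h2).2⟩
  have hlim : ∀ a b : ℝ≥0∞, (∀ t : ℝ≥0, 1 < t → a ≤ t * b) → a ≤ b := by
    intro a b h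
    have : Tendsto (fun t : ℝ≥0 => (t : ℝ≥0∞) * b) (𝓝[>] 1) (𝓝 ((1 : ℝ≥0) * b)) := by
      refine ENNReal.Tendsto.mul_const ?_ (Or.inl (by simp))
      exact (ENNReal.tendsto_coe.2 tendsto_id).mono_left nhdsWithin_le_nhds
    rw [ENNReal.coe_one, one_mul] at this
    exact ge_of_tendsto this (by filter_upwards [self_mem_nhdsWithin] with t ht using h t ht)
  have hμν : μ = ν := by
    refine le_antisymm (Measure.le_iff.2 fun A hA => hlim _ _ fun t ht => ?_)
      (Measure.le_iff.2 fun A hA => hlim _ _ fun t ht => ?_)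
    · exact (key t ht).1 A
    · exact (key t ht).2 A
  have h1 : ∫ y, G y = ∫ y in p '' S, G y := by
    rw [setIntegral_eq_integral_of_forall_compl_eq_zero hG0]
  have hrange : p '' S = range fun x : S => p x := by
    rw [image_eq_range]
  have h2 : ∫ y in p '' S, G y = ∫ x : S, φ x ∂μ := by
    rw [hrange, ← hemb.map_comap, hemb.integral_map]
    exact integral_congr_ae (Eventually.of_forall fun x => hG x x.2)
  have h3 : ∫ x in S, g x * φ x ∂surf = ∫ x : S, g x * φ x ∂H := by
    rw [hH, ← hval.integral_map (fun x => g x * φ x), hval.map_comap, Subtype.range_coe]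
  rw [h1, h2, h3, hμν, hν, integral_withDensity_eq_integral_toReal_smul hgm (by simp)]
  refine integral_congr_ae (Eventually.of_forall fun x => ?_)
  simp [ENNReal.toReal_ofReal (hg0 x x.2).le]

/-! ### The divergence theorem on `C¹` domains -/

lemma IsBoundedC1Domain.exists_isNearlyFlat {Ω : Set R3} (hΩ : IsBoundedC1Domain Ω) {x : R3}
    (hx : x ∈ frontier Ω) {c : ℝ} (hc : 0 < c) :
    ∃ r > 0, IsNearlyFlat (outwardNormal Ω x) c (frontier Ω ∩ Metric.ball x r) := by
  obtain ⟨ξ, r, h⟩ := hΩ.exists_flatChart hx hc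
  refine ⟨r, h.pos, fun y hy z hz => ?_⟩
  have := h.approx y hy.2 z hz.2
  rw [h.apply_eq_zero hΩ.isOpen hy.2 hy.1, h.apply_eq_zero hΩ.isOpen hz.2 hz.1] at this
  simpa [abs_neg] using this

lemma IsNearlyFlat.mono {q : R3} {c : ℝ} {A B : Set R3} (h : IsNearlyFlat q c A) (hBA : B ⊆ A) :
    IsNearlyFlat q c B := fun x hx y hy => h x (hBA hx) y (hBA hy)

/-- By compactness it is enough to look near one point, where the area is at most twice that of the
bounded projection to the tangent plane. -/
lemma IsBoundedC1Domain.surf_frontier_lt_top {Ω : Set R3} (hΩ : IsBoundedC1Domain Ω) :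
    surf (frontier Ω) < ∞ := by
  refine hΩ.isCompact_frontier.measure_lt_top_of_nhdsWithin fun x hx => ?_
  have hn := hΩ.norm_outwardNormal hx
  obtain ⟨ι, hι⟩ := exists_isPlane hn
  have hin : inner ℝ (outwardNormal Ω x) (outwardNormal Ω x) = (1 : ℝ) := by
    rw [real_inner_self_eq_norm_sq, hn]; norm_num
  obtain ⟨c, hc, hA⟩ := exists_area_bounds hι hn (m₁ := 1 / 2) (m₂ := 2)
    (by rw [hin]; norm_num) (by rw [hin]; norm_num)
  obtain ⟨r, hr, hflat⟩ := hΩ.exists_isNearlyFlat hx hc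
  refine ⟨frontier Ω ∩ Metric.ball x r,
    inter_mem self_mem_nhdsWithin (nhdsWithin_le_nhds (Metric.ball_mem_nhds x hr)), ?_⟩
  have h1 := (hA _ hflat).1
  have h2 : volume (planeProj ι '' (frontier Ω ∩ Metric.ball x r)) < ∞ := by
    refine Bornology.IsBounded.measure_lt_top ?_
    have : Bornology.IsBounded (frontier Ω ∩ Metric.ball x r) :=
      Metric.isBounded_ball.subset inter_subset_right
    exact ((planeProj ι).lipschitz.isBounded_image this)
  have h3 := lt_of_le_of_lt h1 h2
  by_contra h4
  rw [not_lt, top_le_iff] at h4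
  rw [h4, ENNReal.mul_top (by simp)] at h3
  exact lt_irrefl _ h3

/-- The fundamental theorem of calculus on the part inside `Ω` of a line crossing a flat chart. -/
lemma IsFlatChart.integral_line {Ω : Set R3} (hΩ : IsOpen Ω) {x₀ e : R3} {c r : ℝ} {ξ : R3 → ℝ}
    (h : IsFlatChart Ω x₀ e c r ξ) (hc1 : c < 1) {w : R3} (hw1 : ‖w‖ = 1)
    (hw : c < inner ℝ e w) {φ : R3 → ℝ} (hφ : ContDiff ℝ 1 φ)
    (hsupp : tsupport φ ⊆ Metric.ball x₀ r) (y : R3) :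
    (∀ s : ℝ, y + s • w ∈ frontier Ω ∩ Metric.ball x₀ r →
      ∫ s : ℝ, indicator Ω (fun x => fderiv ℝ φ x w) (y + s • w) = φ (y + s • w)) ∧
    ((∀ s : ℝ, y + s • w ∉ frontier Ω ∩ Metric.ball x₀ r) →
      ∫ s : ℝ, indicator Ω (fun x => fderiv ℝ φ x w) (y + s • w) = 0) := by
  have hw' : c * ‖w‖ < inner ℝ e w := by rwa [hw1, mul_one]
  set l : ℝ → R3 := fun s => y + s • w with hl
  have hlc : Continuous l := by fun_prop
  have hliso : Isometry l := by
    refine Isometry.of_dist_eq fun s t => ?_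
    rw [hl, dist_eq_norm, Real.dist_eq]
    simp only
    rw [add_sub_add_left_eq_sub, ← sub_smul, norm_smul, hw1, mul_one, Real.norm_eq_abs]
  have hφc : HasCompactSupport φ :=
    HasCompactSupport.of_support_subset_isCompact (isCompact_closedBall x₀ r)
      ((subset_tsupport φ).trans (hsupp.trans Metric.ball_subset_closedBall))
  have hhc : HasCompactSupport (φ ∘ l) := hφc.comp_isClosedEmbedding hliso.isClosedEmbedding
  have hhd : ContDiff ℝ 1 (φ ∘ l) := hφ.comp (by fun_prop)
  have hder : ∀ s, deriv (φ ∘ l) s = fderiv ℝ φ (l s) w := by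
    intro s
    have h1 : HasDerivAt l w s := by
      have := ((hasDerivAt_id s).smul_const w).const_add y
      rw [one_smul] at this
      exact this
    exact ((hφ.differentiable one_ne_zero (l s)).hasFDerivAt.comp_hasDerivAt s h1).deriv
  have hzero : ∀ s, l s ∉ Metric.ball x₀ r → fderiv ℝ φ (l s) w = 0 := by
    intro s hs
    have : l s ∉ tsupport (fderiv ℝ φ) := fun h' => hs (hsupp (tsupport_fderiv_subset ℝ h'))
    rw [image_eq_zero_of_notMem_tsupport this]; simp
  have hind : ∀ s, l s ∉ Metric.ball x₀ r → indicator Ω (fun x => fderiv ℝ φ x w) (l s) = 0 :=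
    fun s hs => indicator_apply_eq_zero.2 fun _ => hzero s hs
  have htot : ∫ s, deriv (φ ∘ l) s = 0 := by
    refine integral_eq_zero_of_hasDerivAt_of_integrable
      (fun s => (hhd.differentiable one_ne_zero s).hasDerivAt) ?_ ?_
    · exact (hhd.continuous_deriv le_rfl).integrable_of_hasCompactSupport hhc.deriv
    · exact hhd.continuous.integrable_of_hasCompactSupport hhc
  constructor
  · intro t ht
    have h0 : ξ (l t) = 0 := h.apply_eq_zero hΩ ht.2 ht.1
    -- Since `ξ` increases strictly along the line, inside the ball the line lies in `Ω` exactly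
    -- before the crossing time `t`.
    have : ∀ s, indicator Ω (fun x => fderiv ℝ φ x w) (l s)
        = indicator (Iio t) (fun s => deriv (φ ∘ l) s) s := by
      intro s
      by_cases hs : l s ∈ Metric.ball x₀ r
      · have : l s ∈ Ω ↔ s < t := by
          rw [h.mem_iff _ hs]
          constructor
          · intro h1
            by_contra! h2
            rcases h2.eq_or_lt with rfl | h2
            · rw [h0] at h1; exact lt_irrefl _ h1
            · have : ξ (l t) < ξ (l s) := h.lt_of_lt hw' ht.2 hs h2
              linarith
          · intro h1
            have : ξ (l s) < ξ (l t) := h.lt_of_lt hw' hs ht.2 h1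
            linarith
        by_cases hst : s < t
        · rw [indicator_of_mem (this.2 hst), indicator_of_mem (show s ∈ Iio t from hst), hder]
        · rw [indicator_of_notMem (fun h' => hst (this.1 h')),
            indicator_of_notMem (show s ∉ Iio t from hst)]
      · have h2 : indicator (Iio t) (fun s => deriv (φ ∘ l) s) s = 0 :=
          indicator_apply_eq_zero.2 fun _ => (hder s).trans (hzero s hs)
        rw [hind s hs, h2]
    change ∫ s, indicator Ω (fun x => fderiv ℝ φ x w) (l s) = φ (l t)
    simp_rw [this]
    rw [integral_indicator measurableSet_Iio, ← integral_Iic_eq_integral_Iio,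
      HasCompactSupport.integral_Iic_deriv_eq hhd hhc]
    rfl
  · intro hno
    -- The chord is connected, so without a zero of `ξ` it lies wholly in `Ω` or wholly outside. The
    -- integral is then that of a compactly supported derivative, or of zero.
    have hpre : IsPreconnected (l ⁻¹' Metric.ball x₀ r) := by
      have hconv : Convex ℝ (l ⁻¹' Metric.ball x₀ r) := by
        have : l = AffineMap.lineMap y (y + w) := by
          ext1 s
          simp [hl, AffineMap.lineMap_apply, add_comm]
        rw [this]
        exact (convex_ball x₀ r).affine_preimage _
      exact hconv.isPreconnected
    have hcont : ContinuousOn (ξ ∘ l) (l ⁻¹' Metric.ball x₀ r) :=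
      h.continuousOn.comp hlc.continuousOn (mapsTo_preimage _ _)
    have hne : ∀ s ∈ l ⁻¹' Metric.ball x₀ r, ξ (l s) ≠ 0 := fun s hs h0 =>
      hno s ⟨h.mem_frontier hΩ hc1 hs h0, hs⟩
    change ∫ s, indicator Ω (fun x => fderiv ℝ φ x w) (l s) = 0
    by_cases hex : ∃ s ∈ l ⁻¹' Metric.ball x₀ r, ξ (l s) < 0
    · obtain ⟨s₀, hs₀, hs₀'⟩ := hex
      have hall : ∀ s ∈ l ⁻¹' Metric.ball x₀ r, l s ∈ Ω := by
        intro s hs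
        rw [h.mem_iff _ hs]
        by_contra! h1
        obtain ⟨t, ht, ht0⟩ := hpre.intermediate_value hs₀ hs hcont ⟨hs₀'.le, h1⟩
        exact hne t ht ht0
      rw [← htot]
      refine integral_congr_ae (Eventually.of_forall fun s => ?_)
      simp only [hder]
      by_cases hs : l s ∈ Metric.ball x₀ r
      · rw [indicator_of_mem (hall s hs)]
      · rw [hzero s hs, hind s hs]
    · push Not at hex
      have : ∀ s, indicator Ω (fun x => fderiv ℝ φ x w) (l s) = 0 := by
        intro s
        refine indicator_apply_eq_zero.2 fun hs => ?_
        by_cases hsb : l s ∈ Metric.ball x₀ r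
        · exact absurd ((h.mem_iff _ hsb).1 hs) (not_lt.2 (hex s hsb))
        · exact hzero s hsb
      simp [this]

lemma IsBoundedC1Domain.integrableOn_frontier {Ω : Set R3} (hΩ : IsBoundedC1Domain Ω)
    {φ : R3 → ℝ} (hφ : ContinuousOn φ (frontier Ω)) : IntegrableOn φ (frontier Ω) surf :=
  hφ.integrableOn_of_subset_isCompact hΩ.isCompact_frontier hΩ.isCompact_frontier.measurableSet
    subset_rfl hΩ.surf_frontier_lt_top.ne

/-- Fubini over the lines of direction `w`: near `x₀` each line crosses the boundary at most once
and contributes the boundary value of `φ`. Projecting the boundary along `w` has Jacobian `⟨w, n⟩`,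
which turns the plane integral into the surface integral. -/
lemma setIntegral_fderiv_of_transversal {Ω : Set R3} (hΩ : IsBoundedC1Domain Ω) {x₀ : R3}
    (hx₀ : x₀ ∈ frontier Ω) :
    ∃ r > 0, ∀ w : R3, ‖w‖ = 1 → 1 / 2 < inner ℝ (outwardNormal Ω x₀) w → ∀ φ : R3 → ℝ,
      ContDiff ℝ 1 φ → tsupport φ ⊆ Metric.ball x₀ r →
      ∫ x in Ω, fderiv ℝ φ x w = ∫ x in frontier Ω, φ x * inner ℝ w (outwardNormal Ω x) ∂surf := by
  set e := outwardNormal Ω x₀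
  obtain ⟨ξ, r₁, h⟩ := hΩ.exists_flatChart hx₀ (c := 1 / 4) (by norm_num)
  obtain ⟨r₂, hr₂, hn⟩ := Metric.continuousWithinAt_iff.1
    (hΩ.continuousOn_outwardNormal x₀ hx₀) (1 / 4) (by norm_num)
  set r := min r₁ r₂
  have hr : 0 < r := lt_min h.pos hr₂
  replace h := h.mono hr (min_le_left _ _)
  refine ⟨r, hr, fun w hw hew φ hφ hsupp => ?_⟩
  obtain ⟨ι, hι⟩ := exists_isPlane hw
  set S := frontier Ω ∩ Metric.ball x₀ r
  have hSm : MeasurableSet S := isClosed_frontier.measurableSet.inter Metric.isOpen_ball.measurableSet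
  set g : R3 → ℝ := fun x => inner ℝ w (outwardNormal Ω x)
  have hgc : ContinuousOn g (frontier Ω) := by
    exact continuousOn_const.inner hΩ.continuousOn_outwardNormal
  -- On this ball the normal differs from `e` by less than `1/4`, while `⟨e, w⟩ > 1/2`.
  have hg0 : ∀ x ∈ S, 0 < g x := by
    intro x hx
    have h1 := hn hx.1 (lt_of_lt_of_le hx.2 (min_le_right _ _))
    have h2 : |inner ℝ w (outwardNormal Ω x - e)| < 1 / 4 := by
      refine (abs_real_inner_le_norm _ _).trans_lt ?_
      rw [hw, one_mul, ← dist_eq_norm]; exact h1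
    rw [inner_sub_right, real_inner_comm e w] at h2
    have := (abs_lt.1 h2).1
    change 0 < inner ℝ w (outwardNormal Ω x)
    linarith
  have hdecomp : ∀ x, ι (planeProj ι x) + (inner ℝ w x) • w = x := fun x => by
    rw [hι.map_planeProj]; abel
  have hinj : InjOn (planeProj ι) S := by
    intro x hx y hy hxy
    have hx' := hdecomp x
    have hy' := hdecomp y
    rw [hxy] at hx'
    have hxb : ι (planeProj ι y) + (inner ℝ w x) • w ∈ Metric.ball x₀ r := by rw [hx']; exact hx.2
    have hyb : ι (planeProj ι y) + (inner ℝ w y) • w ∈ Metric.ball x₀ r := by rw [hy']; exact hy.2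
    have hξx := h.apply_eq_zero hΩ.isOpen hx.2 hx.1
    have hξy := h.apply_eq_zero hΩ.isOpen hy.2 hy.1
    have hwc : 1 / 4 * ‖w‖ < inner ℝ e w := by rw [hw]; linarith
    rcases lt_trichotomy (inner ℝ w x : ℝ) (inner ℝ w y) with hlt | heq | hlt
    · have := h.lt_of_lt hwc hxb hyb hlt
      rw [hx', hy', hξx, hξy] at this
      exact absurd this (lt_irrefl _)
    · exact hx'.symm.trans (by rw [heq]; exact hy')
    · have := h.lt_of_lt hwc hyb hxb hlt
      rw [hx', hy', hξx, hξy] at this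
      exact absurd this (lt_irrefl _)
  set F : R3 → ℝ := indicator Ω fun x => fderiv ℝ φ x w
  have hφc : HasCompactSupport φ :=
    HasCompactSupport.of_support_subset_isCompact (isCompact_closedBall x₀ r)
      ((subset_tsupport φ).trans (hsupp.trans Metric.ball_subset_closedBall))
  have hdc : Continuous fun x => fderiv ℝ φ x w :=
    (hφ.continuous_fderiv one_ne_zero).clm_apply continuous_const
  have hdi : Integrable fun x => fderiv ℝ φ x w :=
    hdc.integrable_of_hasCompactSupport (hφc.fderiv_apply ℝ w)
  have hFi : Integrable F := hdi.indicator hΩ.isOpen.measurableSet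
  have hmp := hι.measurePreserving
  have hFub : ∫ x, F x = ∫ y : R2, ∫ s : ℝ, F (ι y + s • w) := by
    have h1 : Integrable (fun q : R2 × ℝ => F (ι q.1 + q.2 • w)) (volume.prod volume) :=
      hmp.integrable_comp_of_integrable hFi
    rw [← integral_prod _ h1]
    have h2 := integral_map (μ := (volume : Measure R2).prod (volume : Measure ℝ))
      hmp.measurable.aemeasurable (f := F) (by rw [hmp.map_eq]; exact hFi.aestronglyMeasurable)
    rw [hmp.map_eq] at h2
    exact h2
  have hline := fun y => h.integral_line hΩ.isOpen (by norm_num) hw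
    (by linarith : (1 : ℝ) / 4 < inner ℝ e w) hφ hsupp (ι y)
  rw [← integral_indicator hΩ.isOpen.measurableSet]
  change ∫ x, F x = _
  rw [hFub, integral_eq_of_area_bounds hSm (planeProj ι).continuous hinj
    (hgc.mono inter_subset_left) hg0 (φ := φ)
    (G := fun y => ∫ s : ℝ, F (ι y + s • w))]
  · have hzero : ∀ x ∈ frontier Ω \ S, g x * φ x = 0 := by
      intro x hx
      have : x ∉ tsupport φ := fun h' => hx.2 ⟨hx.1, hsupp h'⟩
      rw [image_eq_zero_of_notMem_tsupport this, mul_zero]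
    rw [← setIntegral_eq_of_subset_of_forall_sdiff_eq_zero isClosed_frontier.measurableSet
      inter_subset_left hzero]
    simp_rw [g, mul_comm]
  · intro x hx m₁ m₂ h1 h2
    obtain ⟨c, hc, hA⟩ := exists_area_bounds hι (hΩ.norm_outwardNormal hx.1) h1 h2
    obtain ⟨ρ, hρ, hflat⟩ := hΩ.exists_isNearlyFlat hx.1 hc
    exact ⟨ρ, hρ, fun A hAS => hA A (hflat.mono fun y hy => ⟨(hAS hy).1.1, (hAS hy).2⟩)⟩
  · intro x hx
    have := (hline (planeProj ι x)).1 (inner ℝ w x) (by rw [hdecomp]; exact hx)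
    rw [hdecomp] at this
    exact this
  · intro y hy
    refine (hline y).2 fun s hs => hy ⟨_, hs, ?_⟩
    have h0 : planeProj ι w = 0 := by
      refine ext_inner_right ℝ fun z => ?_
      rw [inner_planeProj_left, hι.inner_eq, inner_zero_left]
    rw [map_add, map_smul, h0, smul_zero, add_zero, planeProj_apply_map]

/-- Both sides are linear in `u`, and every vector is a combination of two directions transversal to
the boundary at `x₀`. Away from the boundary both sides vanish. -/
lemma setIntegral_fderiv_local {Ω : Set R3} (hΩ : IsBoundedC1Domain Ω) (x₀ : R3) :
    ∃ r > 0, ∀ (u : R3) (φ : R3 → ℝ), ContDiff ℝ 1 φ → tsupport φ ⊆ Metric.ball x₀ r →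
      ∫ x in Ω, fderiv ℝ φ x u = ∫ x in frontier Ω, φ x * inner ℝ u (outwardNormal Ω x) ∂surf := by
  by_cases hx₀ : x₀ ∈ frontier Ω
  · obtain ⟨r, hr, h⟩ := setIntegral_fderiv_of_transversal hΩ hx₀
    refine ⟨r, hr, fun u φ hφ hsupp => ?_⟩
    set e := outwardNormal Ω x₀
    have he : ‖e‖ = 1 := hΩ.norm_outwardNormal hx₀
    have hφc : HasCompactSupport φ :=
      HasCompactSupport.of_support_subset_isCompact (isCompact_closedBall x₀ r)
        ((subset_tsupport φ).trans (hsupp.trans Metric.ball_subset_closedBall))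
    have hee : inner ℝ e e = (1 : ℝ) := by rw [real_inner_self_eq_norm_sq, he]; norm_num
    -- With this `t`, `⟨e, v⟩ ≥ 3|u| + 1` while `|v| ≤ 5|u| + 1`, so the normalized `v` satisfies
    -- the transversality condition `> 1/2`.
    set t : ℝ := 4 * ‖u‖ + 1 with ht
    set v := u + t • e with hv
    have hin : inner ℝ e v = inner ℝ e u + t := by
      rw [hv, inner_add_right, inner_smul_right, hee, mul_one]
    have h1 := (abs_le.1 (abs_real_inner_le_norm e u)).1
    rw [he, one_mul] at h1
    have h2 : ‖v‖ ≤ ‖u‖ + t := by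
      refine (norm_add_le _ _).trans ?_
      rw [norm_smul, he, mul_one, Real.norm_of_nonneg (by positivity)]
    have hv0 : 0 < ‖v‖ := by
      rw [norm_pos_iff]
      intro h0
      rw [h0, inner_zero_right] at hin
      linarith [norm_nonneg u]
    have hvn : ‖‖v‖⁻¹ • v‖ = 1 := by
      rw [norm_smul, norm_inv, norm_norm, inv_mul_cancel₀ hv0.ne']
    have hvin : 1 / 2 < inner ℝ e (‖v‖⁻¹ • v) := by
      rw [inner_smul_right, inv_mul_eq_div, lt_div_iff₀ hv0, hin]
      linarith [norm_nonneg u]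
    have eq1 := h _ hvn hvin φ hφ hsupp
    have eq2 := h e he (by linarith) φ hφ hsupp
    have hu : u = ‖v‖ • (‖v‖⁻¹ • v) - t • e := by
      rw [smul_smul, mul_inv_cancel₀ hv0.ne', one_smul, hv]; abel
    have hdi : ∀ w, IntegrableOn (fun x => fderiv ℝ φ x w) Ω := fun w =>
      (((hφ.continuous_fderiv one_ne_zero).clm_apply
        continuous_const).integrable_of_hasCompactSupport (hφc.fderiv_apply ℝ w)).integrableOn
    have hbi : ∀ w : R3, IntegrableOn (fun x => φ x * inner ℝ w (outwardNormal Ω x))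
        (frontier Ω) surf := fun w => hΩ.integrableOn_frontier
      (hφ.continuous.continuousOn.mul (continuousOn_const.inner hΩ.continuousOn_outwardNormal))
    set z := ‖v‖⁻¹ • v
    have e1 : ∀ x, fderiv ℝ φ x u = ‖v‖ * fderiv ℝ φ x z - t * fderiv ℝ φ x e := fun x => by
      conv_lhs => rw [hu]
      simp
    have e2 : ∀ x, φ x * inner ℝ u (outwardNormal Ω x)
        = ‖v‖ * (φ x * inner ℝ z (outwardNormal Ω x))
          - t * (φ x * inner ℝ e (outwardNormal Ω x)) := fun x => by
      conv_lhs => rw [hu]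
      rw [inner_sub_left, real_inner_smul_left z _ ‖v‖, real_inner_smul_left e _ t]
      ring
    simp_rw [e1, e2]
    rw [integral_sub ((hdi z).const_mul _) ((hdi e).const_mul _),
      integral_sub ((hbi z).const_mul _) ((hbi e).const_mul _), integral_const_mul,
      integral_const_mul, integral_const_mul, integral_const_mul, eq1, eq2]
  · have hbd : ∀ r, ∀ φ : R3 → ℝ, Metric.ball x₀ r ∩ frontier Ω = ∅ →
        tsupport φ ⊆ Metric.ball x₀ r → ∀ u : R3,
        ∫ x in frontier Ω, φ x * inner ℝ u (outwardNormal Ω x) ∂surf = 0 := by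
      intro r φ hr hsupp u
      refine setIntegral_eq_zero_of_forall_eq_zero fun x hx => ?_
      have : x ∉ tsupport φ := fun h' => by
        have : x ∈ Metric.ball x₀ r ∩ frontier Ω := ⟨hsupp h', hx⟩
        rw [hr] at this; exact this
      rw [image_eq_zero_of_notMem_tsupport this, zero_mul]
    have hz : ∀ φ : R3 → ℝ, ∀ u x, x ∉ tsupport φ → fderiv ℝ φ x u = 0 := by
      intro φ u x hx
      have : x ∉ tsupport (fderiv ℝ φ) := fun h' => hx (tsupport_fderiv_subset ℝ h')
      rw [image_eq_zero_of_notMem_tsupport this]; simp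
    by_cases hxΩ : x₀ ∈ Ω
    · obtain ⟨r, hr, hrΩ⟩ := Metric.isOpen_iff.1 hΩ.isOpen x₀ hxΩ
      refine ⟨r, hr, fun u φ hφ hsupp => ?_⟩
      rw [hbd r φ _ hsupp]
      · rw [setIntegral_eq_integral_of_forall_compl_eq_zero
          (fun x hx => hz φ u x fun h' => hx (hrΩ (hsupp h')))]
        have hφc : HasCompactSupport φ :=
          HasCompactSupport.of_support_subset_isCompact (isCompact_closedBall x₀ r)
            ((subset_tsupport φ).trans (hsupp.trans Metric.ball_subset_closedBall))
        have := integral_mul_fderiv_eq_neg_fderiv_mul_of_integrable (μ := (volume : Measure R3))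
          (f := fun _ => (1 : ℝ)) (g := φ) (v := u) (by simp)
          (by simpa using ((hφ.continuous_fderiv one_ne_zero).clm_apply
            continuous_const).integrable_of_hasCompactSupport (hφc.fderiv_apply ℝ u))
          (by simpa using hφ.continuous.integrable_of_hasCompactSupport hφc)
          (fun x _ => differentiableAt_const _)
          (fun x _ => hφ.differentiable one_ne_zero x)
        simpa using this
      · ext y
        simp only [mem_inter_iff, mem_empty_iff_false, iff_false, not_and]
        intro hy hyf
        exact frontier_notMem hΩ.isOpen hyf (hrΩ hy)
    · have hcl : x₀ ∉ closure Ω := by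
        rw [closure_eq_self_union_frontier]
        exact fun h' => h'.elim hxΩ hx₀
      obtain ⟨r, hr, hrΩ⟩ := Metric.isOpen_iff.1 isClosed_closure.isOpen_compl x₀ hcl
      refine ⟨r, hr, fun u φ hφ hsupp => ?_⟩
      rw [hbd r φ _ hsupp]
      · exact setIntegral_eq_zero_of_forall_eq_zero fun x hx =>
          hz φ u x fun h' => hrΩ (hsupp h') (subset_closure hx)
      · ext y
        simp only [mem_inter_iff, mem_empty_iff_false, iff_false, not_and]
        intro hy hyf
        exact hrΩ hy (frontier_subset_closure hyf)

/-- A finite smooth partition of unity on a compact set, subordinate to given balls. -/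
lemma exists_finite_partition {K : Set R3} (hK : IsCompact K) {r : R3 → ℝ} (hr : ∀ x, 0 < r x) :
    ∃ (s : Finset R3) (ρ : R3 → R3 → ℝ), (∀ i ∈ s, ContDiff ℝ 1 (ρ i)) ∧
      (∀ i ∈ s, tsupport (ρ i) ⊆ Metric.ball i (r i)) ∧ ∀ x ∈ K, ∑ i ∈ s, ρ i x = 1 := by
  obtain ⟨f, hf⟩ := SmoothPartitionOfUnity.exists_isSubordinate (modelWithCornersSelf ℝ R3)
    hK.isClosed (fun i => Metric.ball i (r i)) (fun i => Metric.isOpen_ball)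
    (fun x _ => mem_iUnion.2 ⟨x, Metric.mem_ball_self (hr x)⟩)
  have hfin := f.locallyFinite.finite_nonempty_inter_compact hK
  refine ⟨hfin.toFinset, fun i => f i, fun i _ => ?_, fun i _ => hf i, fun x hx => ?_⟩
  · exact (f i).contMDiff.contDiff.of_le (by exact_mod_cast le_top)
  · rw [← f.sum_eq_one hx, finsum_eq_sum_of_support_subset]
    intro i hi
    simp only [Finite.coe_toFinset, mem_ofPred_eq]
    exact ⟨x, hi, hx⟩

/-- The divergence theorem. -/
theorem setIntegral_fderiv_eq {Ω : Set R3} (hΩ : IsBoundedC1Domain Ω) (u : R3) {φ : R3 → ℝ}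
    (hφ : ContDiff ℝ 1 φ) (hφc : HasCompactSupport φ) :
    ∫ x in Ω, fderiv ℝ φ x u = ∫ x in frontier Ω, φ x * inner ℝ u (outwardNormal Ω x) ∂surf := by
  choose r hr h using setIntegral_fderiv_local hΩ
  obtain ⟨s, ρ, hρ, hρs, hsum⟩ := exists_finite_partition hφc.isCompact hr
  have hφeq : φ = fun x => ∑ i ∈ s, ρ i x * φ x := by
    ext x
    rw [← Finset.sum_mul]
    by_cases hx : x ∈ tsupport φ
    · rw [hsum x hx, one_mul]
    · rw [image_eq_zero_of_notMem_tsupport hx, mul_zero]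
  have hd : ∀ i ∈ s, ContDiff ℝ 1 fun x => ρ i x * φ x := fun i hi => (hρ i hi).mul hφ
  have hsup : ∀ i ∈ s, tsupport (fun x => ρ i x * φ x) ⊆ Metric.ball i (r i) := fun i hi =>
    (tsupport_mul_subset_left).trans (hρs i hi)
  have hcs : ∀ i ∈ s, HasCompactSupport fun x => ρ i x * φ x := fun i hi => hφc.mul_left
  have hfd : ∀ x, fderiv ℝ φ x u = ∑ i ∈ s, fderiv ℝ (fun x => ρ i x * φ x) x u := by
    intro x
    conv_lhs => rw [hφeq]
    rw [fderiv_fun_sum fun i hi => (hd i hi).differentiable one_ne_zero x]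
    simp
  have hb : ∀ x, φ x * inner ℝ u (outwardNormal Ω x)
      = ∑ i ∈ s, ρ i x * φ x * inner ℝ u (outwardNormal Ω x) := by
    intro x
    rw [← Finset.sum_mul]
    congr 1
    exact congrFun hφeq x
  simp_rw [hfd, hb]
  rw [integral_finsetSum, integral_finsetSum]
  · exact Finset.sum_congr rfl fun i hi => h i u _ (hd i hi) (hsup i hi)
  · exact fun i hi => hΩ.integrableOn_frontier
      ((hd i hi).continuous.continuousOn.mul
        (continuousOn_const.inner hΩ.continuousOn_outwardNormal))
  · exact fun i hi => ((((hd i hi).continuous_fderiv one_ne_zero).clm_apply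
        continuous_const).integrable_of_hasCompactSupport
          ((hcs i hi).fderiv_apply ℝ u)).integrableOn

/-! ### Locally bounded functions -/

/-- A measurable function that is essentially bounded on compact sets. -/
structure LocBdd {X : Type*} [TopologicalSpace X] [MeasurableSpace X] (f : X → ℝ)
    (μ : Measure X) : Prop where
  aesm : AEStronglyMeasurable f μ
  bound : ∀ K : Set X, IsCompact K → ∃ C : ℝ, ∀ᵐ z ∂(μ.restrict K), |f z| ≤ C

section LocBdd

variable {X : Type*} [TopologicalSpace X] [MeasurableSpace X] {μ : Measure X} {f g : X → ℝ}

lemma LocBdd.mul (hf : LocBdd f μ) (hg : LocBdd g μ) : LocBdd (fun z => f z * g z) μ := by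
  refine ⟨hf.aesm.mul hg.aesm, fun K hK => ?_⟩
  obtain ⟨C, hC⟩ := hf.bound K hK
  obtain ⟨D, hD⟩ := hg.bound K hK
  refine ⟨|C| * |D|, ?_⟩
  filter_upwards [hC, hD] with z h1 h2
  rw [abs_mul]
  exact mul_le_mul (h1.trans (le_abs_self _)) (h2.trans (le_abs_self _)) (abs_nonneg _)
    (abs_nonneg _)

lemma LocBdd.add (hf : LocBdd f μ) (hg : LocBdd g μ) : LocBdd (fun z => f z + g z) μ := by
  refine ⟨hf.aesm.add hg.aesm, fun K hK => ?_⟩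
  obtain ⟨C, hC⟩ := hf.bound K hK
  obtain ⟨D, hD⟩ := hg.bound K hK
  refine ⟨C + D, ?_⟩
  filter_upwards [hC, hD] with z h1 h2
  exact (abs_add_le _ _).trans (add_le_add h1 h2)

lemma LocBdd.const_mul (c : ℝ) (hf : LocBdd f μ) : LocBdd (fun z => c * f z) μ := by
  refine ⟨hf.aesm.const_mul c, fun K hK => ?_⟩
  obtain ⟨C, hC⟩ := hf.bound K hK
  refine ⟨|c| * C, ?_⟩
  filter_upwards [hC] with z h1
  rw [abs_mul]; gcongr

lemma LocBdd.sub (hf : LocBdd f μ) (hg : LocBdd g μ) : LocBdd (fun z => f z - g z) μ := by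
  have := hf.add (hg.const_mul (-1))
  simpa [sub_eq_add_neg] using this

lemma locBdd_of_bound {C : ℝ} (hf : AEStronglyMeasurable f μ) (h : ∀ᵐ z ∂μ, |f z| ≤ C) :
    LocBdd f μ := ⟨hf, fun _ _ => ⟨C, ae_restrict_of_ae h⟩⟩

lemma _root_.Continuous.locBdd [T2Space X] [OpensMeasurableSpace X] [SecondCountableTopology X]
    (hf : Continuous f) : LocBdd f μ := by
  refine ⟨hf.aestronglyMeasurable, fun K hK => ?_⟩
  obtain ⟨C, hC⟩ := hK.exists_bound_of_continuousOn hf.continuousOn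
  exact ⟨C, ae_restrict_of_forall_mem hK.measurableSet hC⟩

lemma LocBdd.integrableOn [IsFiniteMeasureOnCompacts μ] (hf : LocBdd f μ) {K : Set X}
    (hK : IsCompact K) : IntegrableOn f K μ := by
  obtain ⟨C, hC⟩ := hf.bound K hK
  exact Measure.integrableOn_of_bounded hK.measure_lt_top.ne hf.aesm hC

lemma LocBdd.integrable_of_support [IsFiniteMeasureOnCompacts μ] (hf : LocBdd f μ) {K : Set X}
    (hK : IsCompact K) (h : ∀ z, z ∉ K → f z = 0) : Integrable f μ :=
  (integrableOn_iff_integrable_of_support_subset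
    (Function.support_subset_iff'.2 h)).1 (hf.integrableOn hK)

lemma LocBdd.integrable_mul [T2Space X] [OpensMeasurableSpace X] [SecondCountableTopology X]
    [IsFiniteMeasureOnCompacts μ] (hf : LocBdd f μ)
    (hg : Continuous g) (hgc : HasCompactSupport g) : Integrable (fun z => f z * g z) μ :=
  (hf.mul hg.locBdd).integrable_of_support hgc.isCompact fun z hz => by
    rw [image_eq_zero_of_notMem_tsupport hz, mul_zero]

lemma LocBdd.locallyIntegrable [WeaklyLocallyCompactSpace X] [IsFiniteMeasureOnCompacts μ]
    (hf : LocBdd f μ) : LocallyIntegrable f μ := fun x => by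
  obtain ⟨K, hK, hx⟩ := exists_compact_mem_nhds x
  exact ⟨K, hx, hf.integrableOn hK⟩

end LocBdd

/-! ### Measures on phase space-time -/

/-- Space-time phase space, with points `(t, x, v)`. -/
abbrev Z : Type := ℝ × R3 × R3

/-- The measure `dt dx dv` on `[0, ∞) × Ω × ℝ³`. -/
noncomputable def interiorM (Ω : Set R3) : Measure Z := (volume.restrict (Ici 0)).prod (phaseMeasure Ω)

/-- The measure `dt dS(x) dv` on `[0, ∞) × ∂Ω × ℝ³`. -/
noncomputable def boundaryM (Ω : Set R3) : Measure Z :=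
  (volume.restrict (Ici 0)).prod (boundaryMeasure Ω)

/-- The normal velocity `v · n(x)`. -/
noncomputable def flux (Ω : Set R3) (z : R3 × R3) : ℝ := inner ℝ z.2 (outwardNormal Ω z.1)

instance (Ω : Set R3) : SigmaFinite (phaseMeasure Ω) :=
  inferInstanceAs (SigmaFinite ((volume.restrict Ω).prod (volume : Measure R3)))

instance (Ω : Set R3) : IsFiniteMeasureOnCompacts (phaseMeasure Ω) :=
  inferInstanceAs (IsFiniteMeasureOnCompacts ((volume.restrict Ω).prod (volume : Measure R3)))

instance (Ω : Set R3) : IsLocallyFiniteMeasure (phaseMeasure Ω) :=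
  inferInstanceAs (IsLocallyFiniteMeasure ((volume.restrict Ω).prod (volume : Measure R3)))

instance (Ω : Set R3) : SigmaFinite (interiorM Ω) :=
  inferInstanceAs (SigmaFinite ((volume.restrict (Ici (0 : ℝ))).prod (phaseMeasure Ω)))

instance (Ω : Set R3) : IsFiniteMeasureOnCompacts (interiorM Ω) :=
  inferInstanceAs
    (IsFiniteMeasureOnCompacts ((volume.restrict (Ici (0 : ℝ))).prod (phaseMeasure Ω)))

lemma IsBoundedC1Domain.isFiniteMeasure_surf {Ω : Set R3} (hΩ : IsBoundedC1Domain Ω) :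
    IsFiniteMeasure (surf.restrict (frontier Ω)) :=
  ⟨by simpa using hΩ.surf_frontier_lt_top⟩

lemma IsBoundedC1Domain.sigmaFinite_boundaryMeasure {Ω : Set R3} (hΩ : IsBoundedC1Domain Ω) :
    SigmaFinite (boundaryMeasure Ω) := by
  have := hΩ.isFiniteMeasure_surf
  exact inferInstanceAs (SigmaFinite ((surf.restrict (frontier Ω)).prod (volume : Measure R3)))

lemma IsBoundedC1Domain.finiteOnCompacts_boundaryMeasure {Ω : Set R3}
    (hΩ : IsBoundedC1Domain Ω) : IsFiniteMeasureOnCompacts (boundaryMeasure Ω) := by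
  have := hΩ.isFiniteMeasure_surf
  exact inferInstanceAs
    (IsFiniteMeasureOnCompacts ((surf.restrict (frontier Ω)).prod (volume : Measure R3)))

lemma IsBoundedC1Domain.sigmaFinite_boundaryM {Ω : Set R3} (hΩ : IsBoundedC1Domain Ω) :
    SigmaFinite (boundaryM Ω) := by
  have := hΩ.sigmaFinite_boundaryMeasure
  exact inferInstanceAs (SigmaFinite ((volume.restrict (Ici (0 : ℝ))).prod (boundaryMeasure Ω)))

lemma IsBoundedC1Domain.finiteOnCompacts_boundaryM {Ω : Set R3}
    (hΩ : IsBoundedC1Domain Ω) : IsFiniteMeasureOnCompacts (boundaryM Ω) := by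
  have := hΩ.sigmaFinite_boundaryMeasure
  have := hΩ.finiteOnCompacts_boundaryMeasure
  exact inferInstanceAs
    (IsFiniteMeasureOnCompacts ((volume.restrict (Ici (0 : ℝ))).prod (boundaryMeasure Ω)))

lemma IsBoundedC1Domain.ae_boundaryMeasure {Ω : Set R3} (hΩ : IsBoundedC1Domain Ω) :
    ∀ᵐ z ∂boundaryMeasure Ω, z.1 ∈ frontier Ω := by
  have := hΩ.isFiniteMeasure_surf
  exact Measure.quasiMeasurePreserving_fst.ae (ae_restrict_mem isClosed_frontier.measurableSet)

lemma IsBoundedC1Domain.ae_boundaryM {Ω : Set R3} (hΩ : IsBoundedC1Domain Ω) :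
    ∀ᵐ z ∂boundaryM Ω, z.2.1 ∈ frontier Ω := by
  have := hΩ.sigmaFinite_boundaryMeasure
  exact Measure.quasiMeasurePreserving_snd.ae hΩ.ae_boundaryMeasure

lemma IsBoundedC1Domain.abs_flux_le {Ω : Set R3} (hΩ : IsBoundedC1Domain Ω) {z : R3 × R3}
    (hz : z.1 ∈ frontier Ω) : |flux Ω z| ≤ ‖z.2‖ := by
  refine (abs_real_inner_le_norm _ _).trans ?_
  rw [hΩ.norm_outwardNormal hz, mul_one]

lemma IsBoundedC1Domain.aesm_flux {Ω : Set R3} (hΩ : IsBoundedC1Domain Ω) :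
    AEStronglyMeasurable (flux Ω) (boundaryMeasure Ω) := by
  have := hΩ.isFiniteMeasure_surf
  have h1 : AEStronglyMeasurable (outwardNormal Ω) (surf.restrict (frontier Ω)) :=
    hΩ.continuousOn_outwardNormal.aestronglyMeasurable isClosed_frontier.measurableSet
  exact (continuous_snd.aestronglyMeasurable).inner h1.comp_fst

lemma IsBoundedC1Domain.locBdd_flux {Ω : Set R3} (hΩ : IsBoundedC1Domain Ω) :
    LocBdd (flux Ω) (boundaryMeasure Ω) := by
  refine ⟨hΩ.aesm_flux, fun K hK => ?_⟩
  obtain ⟨C, hC⟩ := (continuous_norm.comp continuous_snd : Continuous fun z : R3 × R3 => ‖z.2‖).locBdd.bound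
    (μ := boundaryMeasure Ω) K hK
  refine ⟨C, ?_⟩
  filter_upwards [hC, ae_restrict_of_ae hΩ.ae_boundaryMeasure] with z h1 h2
  exact (hΩ.abs_flux_le h2).trans ((le_abs_self _).trans h1)

lemma IsBoundedC1Domain.locBdd_flux_boundaryM {Ω : Set R3} (hΩ : IsBoundedC1Domain Ω) :
    LocBdd (fun z : Z => flux Ω z.2) (boundaryM Ω) := by
  have := hΩ.sigmaFinite_boundaryMeasure
  refine ⟨hΩ.aesm_flux.comp_snd, fun K hK => ?_⟩
  obtain ⟨C, hC⟩ := (by fun_prop : Continuous fun z : Z => ‖z.2.2‖).locBdd.bound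
    (μ := boundaryM Ω) K hK
  refine ⟨C, ?_⟩
  filter_upwards [hC, ae_restrict_of_ae hΩ.ae_boundaryM] with z h1 h2
  exact (hΩ.abs_flux_le h2).trans ((le_abs_self _).trans h1)

/-! ### Green's formula for smooth functions -/

lemma continuous_transportDeriv {φ : Z → ℝ} (hφ : ContDiff ℝ 1 φ) :
    Continuous (transportDeriv φ) := by
  have h1 := hφ.continuous_fderiv one_ne_zero
  exact h1.clm_apply (by fun_prop)

lemma hasCompactSupport_transportDeriv {φ : Z → ℝ} (hφc : HasCompactSupport φ) :
    HasCompactSupport (transportDeriv φ) := by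
  refine (hφc.fderiv ℝ).mono' fun p hp => subset_tsupport _ fun h => hp ?_
  simp [transportDeriv, h]

/-- The spatial divergence theorem at a fixed time, integrated in velocity. -/
lemma integral_phase_fderiv {Ω : Set R3} (hΩ : IsBoundedC1Domain Ω) {ω : R3 → ℝ}
    (hω : Continuous ω) {φ : Z → ℝ} (hφ : ContDiff ℝ 1 φ) (hφc : HasCompactSupport φ) (t : ℝ) :
    ∫ z, ω z.2 * fderiv ℝ φ (t, z) (0, z.2, 0) ∂phaseMeasure Ω
      = ∫ z, ω z.2 * φ (t, z) * flux Ω z ∂boundaryMeasure Ω := by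
  have := hΩ.isFiniteMeasure_surf
  have := hΩ.sigmaFinite_boundaryMeasure
  have := hΩ.finiteOnCompacts_boundaryMeasure
  have hemb : Topology.IsClosedEmbedding fun z : R3 × R3 => ((t, z) : Z) :=
    (Isometry.of_dist_eq fun x y => by simp [Prod.dist_eq] :
      Isometry fun z : R3 × R3 => ((t, z) : Z)).isClosedEmbedding
  have hemb2 : ∀ v : R3, Topology.IsClosedEmbedding fun x : R3 => ((t, x, v) : Z) := fun v =>
    hemb.comp (Isometry.of_dist_eq fun x y => by simp [Prod.dist_eq] :
      Isometry fun x : R3 => (x, v)).isClosedEmbedding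
  have hd : Continuous fun z : R3 × R3 => fderiv ℝ φ (t, z) (0, z.2, 0) :=
    ((hφ.continuous_fderiv one_ne_zero).comp hemb.continuous).clm_apply (by fun_prop)
  have hdc : HasCompactSupport fun z : R3 × R3 => fderiv ℝ φ (t, z) (0, z.2, 0) := by
    refine ((hφc.fderiv ℝ).comp_isClosedEmbedding hemb).mono' fun z hz => subset_tsupport _ ?_
    intro h
    have h' : fderiv ℝ φ (t, z) = 0 := h
    exact hz (by simp [h'])
  have hi1 : Integrable (fun z : R3 × R3 => ω z.2 * fderiv ℝ φ (t, z) (0, z.2, 0))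
      ((volume.restrict Ω).prod volume) :=
    (hω.comp continuous_snd).locBdd.integrable_mul hd hdc
  have hi2 : Integrable (fun z : R3 × R3 => ω z.2 * φ (t, z) * flux Ω z)
      ((surf.restrict (frontier Ω)).prod volume) := by
    have h1 := ((hω.comp continuous_snd).locBdd.mul hΩ.locBdd_flux).integrable_mul
      (hφ.continuous.comp hemb.continuous) (hφc.comp_isClosedEmbedding hemb)
    refine h1.congr (Eventually.of_forall fun z => ?_)
    simp only [Function.comp_apply]; ring
  rw [phaseMeasure, boundaryMeasure, integral_prod_symm _ hi1, integral_prod_symm _ hi2]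
  congr 1
  ext v
  have hψ : ContDiff ℝ 1 fun x : R3 => φ (t, x, v) := hφ.comp (by fun_prop)
  have hψc : HasCompactSupport fun x : R3 => φ (t, x, v) := hφc.comp_isClosedEmbedding (hemb2 v)
  have hder : ∀ x, fderiv ℝ φ (t, x, v) (0, v, 0) = fderiv ℝ (fun x : R3 => φ (t, x, v)) x v := by
    intro x
    have h1 : HasFDerivAt (fun x : R3 => ((t, x, v) : Z))
        ((0 : R3 →L[ℝ] ℝ).prod ((ContinuousLinearMap.id ℝ R3).prod 0)) x :=
      (hasFDerivAt_const _ _).prodMk ((hasFDerivAt_id x).prodMk (hasFDerivAt_const _ _))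
    have h2 := ((hφ.differentiable one_ne_zero (t, x, v)).hasFDerivAt.comp x h1).fderiv
    have h3 : (fun x : R3 => φ (t, x, v)) = φ ∘ fun x : R3 => ((t, x, v) : Z) := rfl
    rw [h3, h2]
    simp
  simp only [hder]
  rw [integral_const_mul, setIntegral_fderiv_eq hΩ v hψ hψc, ← integral_const_mul]
  refine integral_congr_ae (Eventually.of_forall fun x => ?_)
  simp only [flux]; ring

/-- Green's formula on `[0, ∞) × Ω × ℝ³` for `C¹` functions with compact support. -/
theorem integral_transportDeriv {Ω : Set R3} (hΩ : IsBoundedC1Domain Ω) {ω : R3 → ℝ}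
    (hω : Continuous ω) {φ : Z → ℝ} (hφ : ContDiff ℝ 1 φ) (hφc : HasCompactSupport φ) :
    ∫ z, ω z.2.2 * transportDeriv φ z ∂interiorM Ω
      = - ∫ z, ω z.2 * φ (0, z) ∂phaseMeasure Ω
        + ∫ z, ω z.2.2 * φ z * flux Ω z.2 ∂boundaryM Ω := by
  have := hΩ.sigmaFinite_boundaryMeasure
  have := hΩ.finiteOnCompacts_boundaryM
  have hωc : Continuous fun z : Z => ω z.2.2 := by fun_prop
  have hcd := hφ.continuous_fderiv one_ne_zero
  have hc1 : Continuous fun z : Z => fderiv ℝ φ z (1, 0, 0) := hcd.clm_apply continuous_const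
  have hc2 : Continuous fun z : Z => fderiv ℝ φ z (0, z.2.2, 0) := hcd.clm_apply (by fun_prop)
  have hs1 : HasCompactSupport fun z : Z => fderiv ℝ φ z (1, 0, 0) := hφc.fderiv_apply ℝ _
  have hs2 : HasCompactSupport fun z : Z => fderiv ℝ φ z (0, z.2.2, 0) := by
    refine (hφc.fderiv ℝ).mono' fun z hz => subset_tsupport _ fun h => hz ?_
    simp [h]
  have hi1 : Integrable (fun z : Z => ω z.2.2 * fderiv ℝ φ z (1, 0, 0)) (interiorM Ω) :=
    hωc.locBdd.integrable_mul hc1 hs1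
  have hi2 : Integrable (fun z : Z => ω z.2.2 * fderiv ℝ φ z (0, z.2.2, 0)) (interiorM Ω) :=
    hωc.locBdd.integrable_mul hc2 hs2
  have hi3 : Integrable (fun z : Z => ω z.2.2 * φ z * flux Ω z.2) (boundaryM Ω) := by
    refine ((hωc.locBdd.mul hΩ.locBdd_flux_boundaryM).integrable_mul hφ.continuous hφc).congr
      (Eventually.of_forall fun z => ?_)
    simp only; ring
  have hsplit : ∀ z : Z, ω z.2.2 * transportDeriv φ z
      = ω z.2.2 * fderiv ℝ φ z (1, 0, 0) + ω z.2.2 * fderiv ℝ φ z (0, z.2.2, 0) := by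
    intro z
    rw [transportDeriv, ← mul_add, ← map_add]
    simp
  simp_rw [hsplit]
  rw [integral_add hi1 hi2]
  congr 1
  · rw [interiorM, integral_prod_symm _ hi1, ← integral_neg]
    congr 1
    ext z
    have hemb : Topology.IsClosedEmbedding fun s : ℝ => ((s, z) : Z) :=
      (Isometry.of_dist_eq fun x y => by simp [Prod.dist_eq] :
        Isometry fun s : ℝ => ((s, z) : Z)).isClosedEmbedding
    have hψ : ContDiff ℝ 1 fun s : ℝ => φ (s, z) := hφ.comp (by fun_prop)
    have hψc : HasCompactSupport fun s : ℝ => φ (s, z) := hφc.comp_isClosedEmbedding hemb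
    have hder : ∀ s, fderiv ℝ φ (s, z) (1, 0, 0) = deriv (fun s : ℝ => φ (s, z)) s := by
      intro s
      have h1 : HasDerivAt (fun s : ℝ => ((s, z) : Z)) (1, 0) s :=
        (hasDerivAt_id s).prodMk (hasDerivAt_const s z)
      exact ((hφ.differentiable one_ne_zero (s, z)).hasFDerivAt.comp_hasDerivAt s h1).deriv.symm
    simp only [hder]
    rw [integral_const_mul, integral_Ici_eq_integral_Ioi,
      HasCompactSupport.integral_Ioi_deriv_eq hψ hψc]
    ring
  · rw [interiorM, integral_prod _ hi2, boundaryM, integral_prod _ hi3]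
    exact integral_congr_ae (Eventually.of_forall fun t => integral_phase_fderiv hΩ hω hφ hφc t)

/-! ### Specular reflection -/

/-- The outward normal on the boundary, extended by zero. -/
noncomputable def normal (Ω : Set R3) : R3 → R3 := indicator (frontier Ω) (outwardNormal Ω)

lemma IsBoundedC1Domain.measurable_normal {Ω : Set R3} (hΩ : IsBoundedC1Domain Ω) :
    Measurable (normal Ω) := by
  have hm := isClosed_frontier (s := Ω).measurableSet
  have h1 : Measurable fun x : frontier Ω => outwardNormal Ω x :=
    (continuousOn_iff_continuous_domRestrict.1 hΩ.continuousOn_outwardNormal).measurable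
  refine measurable_of_restrict_of_restrict_compl hm ?_ ?_
  · convert h1 using 1
    ext1 x
    simp [normal]
  · convert (measurable_const : Measurable fun _ : ((frontier Ω)ᶜ : Set R3) => (0 : R3)) using 1
    ext1 x
    exact indicator_of_notMem x.2 _

lemma IsBoundedC1Domain.normal_norm {Ω : Set R3} (hΩ : IsBoundedC1Domain Ω) (x : R3) :
    ‖normal Ω x‖ = 1 ∨ normal Ω x = 0 := by
  by_cases hx : x ∈ frontier Ω
  · left; rw [normal, indicator_of_mem hx]; exact hΩ.norm_outwardNormal hx
  · right; exact indicator_of_notMem hx _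

/-- The specular reflection of velocities on the boundary. -/
noncomputable def bounceFun (Ω : Set R3) (z : R3 × R3) : R3 × R3 :=
  (z.1, z.2 - (2 * inner ℝ z.2 (normal Ω z.1)) • normal Ω z.1)

lemma IsBoundedC1Domain.bounceFun_involutive {Ω : Set R3} (hΩ : IsBoundedC1Domain Ω)
    (z : R3 × R3) : bounceFun Ω (bounceFun Ω z) = z := by
  refine Prod.ext rfl ?_
  simp only [bounceFun]
  rcases hΩ.normal_norm z.1 with h | h
  · rw [inner_sub_left, real_inner_smul_left, real_inner_self_eq_norm_sq, h]
    module
  · simp [h]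

lemma IsBoundedC1Domain.measurable_bounceFun {Ω : Set R3} (hΩ : IsBoundedC1Domain Ω) :
    Measurable (bounceFun Ω) := by
  have h1 : Measurable fun z : R3 × R3 => normal Ω z.1 := hΩ.measurable_normal.comp measurable_fst
  have h2 : Measurable fun z : R3 × R3 => 2 * inner ℝ z.2 (normal Ω z.1) :=
    (measurable_snd.inner h1).const_mul 2
  exact measurable_fst.prodMk (measurable_snd.sub (h2.smul h1))

/-- The specular reflection as an equivalence. -/
noncomputable def bounce {Ω : Set R3} (hΩ : IsBoundedC1Domain Ω) : R3 × R3 ≃ᵐ R3 × R3 where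
  toFun := bounceFun Ω
  invFun := bounceFun Ω
  left_inv := hΩ.bounceFun_involutive
  right_inv := hΩ.bounceFun_involutive
  measurable_toFun := hΩ.measurable_bounceFun
  measurable_invFun := hΩ.measurable_bounceFun

lemma bounce_apply {Ω : Set R3} (hΩ : IsBoundedC1Domain Ω) (z : R3 × R3) :
    bounce hΩ z = bounceFun Ω z := rfl

lemma bounce_bounce {Ω : Set R3} (hΩ : IsBoundedC1Domain Ω) (z : R3 × R3) :
    bounce hΩ (bounce hΩ z) = z := hΩ.bounceFun_involutive z

/-- At each fixed `x` the map is a linear isometry of the velocities, and `x` itself does not move,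
so it is a skew product of measure-preserving maps. -/
lemma measurePreserving_bounce {Ω : Set R3} (hΩ : IsBoundedC1Domain Ω) :
    MeasurePreserving (bounce hΩ) (boundaryMeasure Ω) (boundaryMeasure Ω) := by
  have := hΩ.isFiniteMeasure_surf
  have hm : Measurable (Function.uncurry fun (x v : R3) =>
      v - (2 * inner ℝ v (normal Ω x)) • normal Ω x) :=
    hΩ.measurable_bounceFun.snd
  refine (MeasurePreserving.id (surf.restrict (frontier Ω))).skew_product hm ?_
  refine Eventually.of_forall fun x => ?_
  rcases hΩ.normal_norm x with h | h
  -- Reflection in the line `ℝ n` fixes `n` and negates its complement. The specular reflection is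
  -- its negative.
  · have h1 : (fun v : R3 => v - (2 * inner ℝ v (normal Ω x)) • normal Ω x)
        = fun v => ((ℝ ∙ normal Ω x).reflection.trans (LinearIsometryEquiv.neg ℝ)) v := by
      ext1 v
      rw [LinearIsometryEquiv.trans_apply, Submodule.reflection_singleton_apply, h,
        real_inner_comm]
      simp only [LinearIsometryEquiv.coe_neg]
      norm_num
      module
    rw [h1]
    exact (LinearIsometryEquiv.measurePreserving _).map_eq
  · simp only [h, smul_zero, sub_zero]
    exact Measure.map_id

lemma bounce_fst {Ω : Set R3} (hΩ : IsBoundedC1Domain Ω) (z : R3 × R3) :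
    (bounce hΩ z).1 = z.1 := rfl

lemma norm_bounce_snd {Ω : Set R3} (hΩ : IsBoundedC1Domain Ω) (z : R3 × R3) :
    ‖(bounce hΩ z).2‖ = ‖z.2‖ := by
  have h : ‖z.2 - (2 * inner ℝ z.2 (normal Ω z.1)) • normal Ω z.1‖ ^ 2 = ‖z.2‖ ^ 2 := by
    rcases hΩ.normal_norm z.1 with h | h
    · rw [norm_sub_sq_real, norm_smul, h, real_inner_smul_right, mul_one, Real.norm_eq_abs, sq_abs]
      ring
    · simp [h]
  exact (sq_eq_sq₀ (norm_nonneg _) (norm_nonneg _)).1 h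

lemma bounce_eq_reflection {Ω : Set R3} (hΩ : IsBoundedC1Domain Ω) {z : R3 × R3}
    (hz : z.1 ∈ frontier Ω) : bounce hΩ z = (z.1, reflection Ω z.1 z.2) := by
  rw [bounce_apply, bounceFun, normal, indicator_of_mem hz, reflection]

lemma flux_bounce {Ω : Set R3} (hΩ : IsBoundedC1Domain Ω) {z : R3 × R3}
    (hz : z.1 ∈ frontier Ω) : flux Ω (bounce hΩ z) = - flux Ω z := by
  rw [bounce_eq_reflection hΩ hz, flux, flux, reflection, inner_sub_left, real_inner_smul_left,
    real_inner_self_eq_norm_sq, hΩ.norm_outwardNormal hz]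
  ring

/-- The specular reflection acting on space-time phase space. -/
noncomputable def bounceZ {Ω : Set R3} (hΩ : IsBoundedC1Domain Ω) : Z ≃ᵐ Z :=
  (MeasurableEquiv.refl ℝ).prodCongr (bounce hΩ)

lemma bounceZ_apply {Ω : Set R3} (hΩ : IsBoundedC1Domain Ω) (z : Z) :
    bounceZ hΩ z = (z.1, bounce hΩ z.2) := rfl

lemma measurePreserving_bounceZ {Ω : Set R3} (hΩ : IsBoundedC1Domain Ω) :
    MeasurePreserving (bounceZ hΩ) (boundaryM Ω) (boundaryM Ω) := by
  have := hΩ.sigmaFinite_boundaryMeasure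
  exact (MeasurePreserving.id _).prod (measurePreserving_bounce hΩ)

/-! ### Functionals dominated by an `L¹` seminorm -/

section Duality

variable {Y : Type*} [MeasurableSpace Y]

/-- Continuous functionals on `L¹` of a finite measure are represented by bounded functions. -/
lemma exists_bounded_repr_Lp {μ : Measure Y} [IsFiniteMeasure μ] (g : Lp ℝ 1 μ →L[ℝ] ℝ) :
    ∃ F : Y → ℝ, Measurable F ∧ (∀ y, |F y| ≤ ‖g‖) ∧ ∀ u : Lp ℝ 1 μ, g u = ∫ y, F y * u y ∂μ := by
  -- On a finite measure space `L²` embeds in `L¹`, here as multiplication by `1` through Hölder.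
  -- The restriction of `g` to `L²` is then an inner product with some `k`, by the Hilbert space
  -- Riesz theorem.
  set one : Lp ℝ 2 μ := Lp.const 2 μ (1 : ℝ)
  set incl : Lp ℝ 2 μ →L[ℝ] Lp ℝ 1 μ :=
    (ContinuousLinearMap.holderL μ 2 2 1 (ContinuousLinearMap.mul ℝ ℝ)) one
  have hincl : ∀ h : Lp ℝ 2 μ, incl h =ᵐ[μ] h := by
    intro h
    have h1 := ContinuousLinearMap.coeFn_holder (r := 1) (ContinuousLinearMap.mul ℝ ℝ) one h
    filter_upwards [h1, Lp.coeFn_const (p := 2) (μ := μ) (1 : ℝ)] with y h2 h3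
    have h4 : incl h y = (ContinuousLinearMap.mul ℝ ℝ) (one y) (h y) := h2
    rw [h4, h3]; simp
  set k : Lp ℝ 2 μ := (InnerProductSpace.toDual ℝ (Lp ℝ 2 μ)).symm (g ∘L incl)
  have hk : ∀ h : Lp ℝ 2 μ, ∫ y, k y * h y ∂μ = g (incl h) := by
    intro h
    have h1 : inner ℝ k h = (g ∘L incl) h := InnerProductSpace.toDual_symm_apply
    rw [L2.inner_def] at h1
    rw [ContinuousLinearMap.comp_apply] at h1
    rw [← h1]
    refine integral_congr_ae (Eventually.of_forall fun y => ?_)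
    simp [mul_comm]
  have hki : Integrable k μ := (Lp.memLp k).integrable (by norm_num)
  have hind : ∀ A : Set Y, ∀ hA : MeasurableSet A,
      ∫ y in A, k y ∂μ = g (indicatorConstLp 1 hA (measure_ne_top μ A) (1 : ℝ)) := by
    intro A hA
    have h1 := hk (indicatorConstLp 2 hA (measure_ne_top μ A) (1 : ℝ))
    have h2 : incl (indicatorConstLp 2 hA (measure_ne_top μ A) (1 : ℝ))
        = indicatorConstLp 1 hA (measure_ne_top μ A) (1 : ℝ) := by
      refine Lp.ext ?_
      filter_upwards [hincl (indicatorConstLp 2 hA (measure_ne_top μ A) (1 : ℝ)),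
        indicatorConstLp_coeFn (p := 2) (hs := hA) (hμs := measure_ne_top μ A) (c := (1 : ℝ)),
        indicatorConstLp_coeFn (p := 1) (hs := hA) (hμs := measure_ne_top μ A) (c := (1 : ℝ))]
        with y e1 e2 e3
      rw [e1, e2, e3]
    rw [← h2, ← h1, ← integral_indicator hA]
    refine integral_congr_ae ?_
    filter_upwards [indicatorConstLp_coeFn (p := 2) (hs := hA) (hμs := measure_ne_top μ A)
      (c := (1 : ℝ))] with y e2
    rw [e2]
    by_cases hy : y ∈ A <;> simp [hy]
  -- The `L¹` bound of `g` on indicators controls all averages of `k`, hence `|k| ≤ ‖g‖` almost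
  -- everywhere. Truncation then makes the bound hold at every point.
  have hindb : ∀ A : Set Y, MeasurableSet A → |∫ y in A, k y ∂μ| ≤ ‖g‖ * μ.real A := by
    intro A hA
    rw [hind A hA]
    have := g.le_opNorm (indicatorConstLp 1 hA (measure_ne_top μ A) (1 : ℝ))
    rw [norm_indicatorConstLp (by norm_num) (by norm_num)] at this
    simpa using this
  have hle1 : k ≤ᵐ[μ] fun _ => ‖g‖ := by
    refine ae_le_of_forall_setIntegral_le hki (integrable_const _) fun A hA _ => ?_
    rw [setIntegral_const, smul_eq_mul, mul_comm]
    exact (le_abs_self _).trans (hindb A hA)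
  have hle2 : (fun _ => -‖g‖) ≤ᵐ[μ] k := by
    refine ae_le_of_forall_setIntegral_le (integrable_const _) hki fun A hA _ => ?_
    rw [setIntegral_const, smul_eq_mul, mul_comm]
    have := (abs_le.1 (hindb A hA)).1
    linarith
  set F : Y → ℝ := fun y => max (-‖g‖) (min (k y) ‖g‖)
  have hFm : Measurable F :=
    measurable_const.max ((Lp.stronglyMeasurable k).measurable.min measurable_const)
  have hFk : F =ᵐ[μ] k := by
    filter_upwards [hle1, hle2] with y h1 h2
    simp only [F]
    rw [min_eq_left h1, max_eq_right h2]
  have hFb : ∀ y, |F y| ≤ ‖g‖ := fun y =>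
    abs_le.2 ⟨le_max_left _ _, max_le (by linarith [norm_nonneg g]) (min_le_right _ _)⟩
  refine ⟨F, hFm, hFb, fun u => ?_⟩
  have hint : ∀ u : Y → ℝ, Integrable u μ → Integrable (fun y => F y * u y) μ := fun u hu =>
    hu.bdd_mul hFm.aestronglyMeasurable (Eventually.of_forall fun y => hFb y)
  refine Lp.induction (by norm_num) (motive := fun u : Lp ℝ 1 μ => g u = ∫ y, F y * u y ∂μ)
    ?_ ?_ ?_ u
  · intro c A hA hμA
    have h1 : (Lp.simpleFunc.indicatorConst 1 hA hμA.ne c : Lp ℝ 1 μ)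
        = c • indicatorConstLp 1 hA (measure_ne_top μ A) (1 : ℝ) := by
      rw [Lp.simpleFunc.coe_indicatorConst]
      refine Lp.ext ?_
      filter_upwards [indicatorConstLp_coeFn (p := 1) (hs := hA) (hμs := hμA.ne) (c := c),
        Lp.coeFn_smul c (indicatorConstLp 1 hA (measure_ne_top μ A) (1 : ℝ)),
        indicatorConstLp_coeFn (p := 1) (hs := hA) (hμs := measure_ne_top μ A) (c := (1 : ℝ))]
        with y e1 e2 e3
      rw [e1, e2, Pi.smul_apply, e3]
      by_cases hy : y ∈ A <;> simp [hy]
    rw [h1, map_smul, ← hind A hA, ← integral_indicator hA, smul_eq_mul, ← integral_const_mul]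
    refine integral_congr_ae ?_
    filter_upwards [Lp.coeFn_smul c (indicatorConstLp 1 hA (measure_ne_top μ A) (1 : ℝ)),
        indicatorConstLp_coeFn (p := 1) (hs := hA) (hμs := measure_ne_top μ A) (c := (1 : ℝ)), hFk]
        with y e2 e3 e4
    rw [e2, Pi.smul_apply, e3, e4]
    by_cases hy : y ∈ A <;> simp [hy, mul_comm]
  · intro u v hu hv _ h1 h2
    rw [map_add, h1, h2, ← integral_add (hint _ (L1.integrable_coeFn _))
      (hint _ (L1.integrable_coeFn _))]
    refine integral_congr_ae ?_
    filter_upwards [Lp.coeFn_add (hu.toLp u) (hv.toLp v)] with y e1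
    rw [e1, Pi.add_apply, mul_add]
  · refine isClosed_eq g.continuous ?_
    refine (LipschitzWith.of_dist_le_mul (K := ⟨‖g‖, norm_nonneg g⟩) fun u v => ?_).continuous
    rw [Real.dist_eq, ← integral_sub (hint _ (L1.integrable_coeFn _))
      (hint _ (L1.integrable_coeFn _))]
    have h1 : dist u v = ∫ y, |u y - v y| ∂μ := by
      rw [dist_eq_norm, L1.norm_eq_integral_norm]
      refine integral_congr_ae ?_
      filter_upwards [Lp.coeFn_sub u v] with y e
      rw [e]; rfl
    rw [h1]
    change _ ≤ ‖g‖ * _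
    rw [← integral_const_mul]
    refine (abs_integral_le_integral_abs).trans (integral_mono ?_ ?_ fun y => ?_)
    · exact ((hint _ (L1.integrable_coeFn _)).sub (hint _ (L1.integrable_coeFn _))).abs
    · exact (((L1.integrable_coeFn u).sub (L1.integrable_coeFn v)).abs).const_mul _
    · simp only
      rw [← mul_sub, abs_mul]
      gcongr
      exact hFb y

variable {X : Type*} [AddCommGroup X] [Module ℝ X]

/-- The domination makes `l` vanish wherever `J` vanishes in `L¹`, so `l` descends to the range of
`J` there. Hahn–Banach extends it with the same norm, and the extension has a bounded density. -/
lemma exists_repr_of_finite {μ : Measure Y} [IsFiniteMeasure μ] (J : X →ₗ[ℝ] (Y → ℝ))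
    (hJ : ∀ x, Integrable (J x) μ) (l : X →ₗ[ℝ] ℝ) {M : ℝ} (hM : 0 ≤ M)
    (h : ∀ x, |l x| ≤ M * ∫ y, |J x y| ∂μ) :
    ∃ F : Y → ℝ, Measurable F ∧ (∀ y, |F y| ≤ M) ∧ ∀ x, l x = ∫ y, F y * J x y ∂μ := by
  let T : X →ₗ[ℝ] Lp ℝ 1 μ :=
    { toFun := fun x => (hJ x).toL1 (J x)
      map_add' := fun a b => by
        rw [← Integrable.toL1_add]
        congr 1
        exact map_add J a b
      map_smul' := fun c a => by
        rw [RingHom.id_apply, ← Integrable.toL1_smul]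
        congr 1
        exact map_smul J c a }
  have hT : ∀ x, ‖T x‖ = ∫ y, |J x y| ∂μ := fun x => by
    change ‖(hJ x).toL1 (J x)‖ = _
    rw [L1.norm_of_fun_eq_integral_norm]
    rfl
  have hker : LinearMap.ker T ≤ LinearMap.ker l := by
    intro x hx
    rw [LinearMap.mem_ker] at hx ⊢
    have := h x
    rw [← hT, hx, norm_zero, mul_zero] at this
    exact abs_eq_zero.1 (le_antisymm this (abs_nonneg _))
  let f₀ : LinearMap.range T →ₗ[ℝ] ℝ :=
    ((LinearMap.ker T).liftQ l hker) ∘ₗ (T.quotKerEquivRange.symm : _ →ₗ[ℝ] _)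
  have hf₀ : ∀ x, f₀ ⟨T x, LinearMap.mem_range_self T x⟩ = l x := by
    intro x
    have : T.quotKerEquivRange.symm ⟨T x, LinearMap.mem_range_self T x⟩
        = (LinearMap.ker T).mkQ x := T.quotKerEquivRange_symm_apply_image x _
    simp only [f₀, LinearMap.comp_apply, LinearEquiv.coe_coe, this]
    exact (LinearMap.ker T).liftQ_apply l x
  let f : StrongDual ℝ (LinearMap.range T) := f₀.mkContinuous M (by
    rintro ⟨_, x, rfl⟩
    rw [hf₀, Real.norm_eq_abs]
    refine (h x).trans (le_of_eq ?_)
    rw [← hT]; rfl)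
  obtain ⟨g, hg, hgn⟩ := exists_extension_norm_eq (LinearMap.range T) f
  obtain ⟨F, hFm, hFb, hF⟩ := exists_bounded_repr_Lp g
  have hgM : ‖g‖ ≤ M := by
    rw [hgn]; exact LinearMap.mkContinuous_norm_le _ hM _
  refine ⟨F, hFm, fun y => (hFb y).trans hgM, fun x => ?_⟩
  have h1 : g (T x) = l x := by
    rw [← hf₀ x]
    exact hg ⟨T x, LinearMap.mem_range_self T x⟩
  rw [← h1, hF]
  refine integral_congr_ae ?_
  filter_upwards [(hJ x).coeFn_toL1] with y hy
  have : T x y = J x y := hy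
  rw [this]

/-- A linear functional dominated by the `L¹` seminorm of `J x` factors through integration of
`J x` against a bounded function (Hahn–Banach and Riesz). -/
theorem exists_repr {μ : Measure Y} [SigmaFinite μ] (J : X →ₗ[ℝ] (Y → ℝ))
    (hJ : ∀ x, Integrable (J x) μ) (l : X →ₗ[ℝ] ℝ) {M : ℝ} (hM : 0 ≤ M)
    (h : ∀ x, |l x| ≤ M * ∫ y, |J x y| ∂μ) :
    ∃ F : Y → ℝ, Measurable F ∧ (∀ y, |F y| ≤ M) ∧ ∀ x, l x = ∫ y, F y * J x y ∂μ := by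
  -- A positive integrable density `w` makes the measure finite. Dividing `J` by `w` leaves all the
  -- `L¹` norms and pairings unchanged.
  obtain ⟨w, hw0, hwm, hw1⟩ := exists_pos_lintegral_lt_of_sigmaFinite μ (one_ne_zero' ℝ≥0∞)
  set μ' := μ.withDensity fun y => (w y : ℝ≥0∞) with hμ'
  have hfin : IsFiniteMeasure μ' := isFiniteMeasure_withDensity (hw1.trans ENNReal.one_lt_top).ne
  let J' : X →ₗ[ℝ] (Y → ℝ) :=
    { toFun := fun x y => (w y : ℝ)⁻¹ * J x y
      map_add' := fun a b => by ext y; simp [mul_add]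
      map_smul' := fun c a => by ext y; simp; ring }
  have hJ'a : ∀ x y, J' x y = (w y : ℝ)⁻¹ * J x y := fun _ _ => rfl
  have hw0' : ∀ y, (w y : ℝ) ≠ 0 := fun y => by exact_mod_cast (hw0 y).ne'
  have hJ' : ∀ x, Integrable (J' x) μ' := by
    intro x
    rw [hμ', integrable_withDensity_iff_integrable_smul hwm]
    refine (hJ x).congr (Eventually.of_forall fun y => ?_)
    simp only [hJ'a, NNReal.smul_def, smul_eq_mul]
    rw [mul_inv_cancel_left₀ (hw0' y)]
  have hint : ∀ u : Y → ℝ, ∫ y, u y ∂μ' = ∫ y, w y * u y ∂μ := by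
    intro u
    rw [hμ', integral_withDensity_eq_integral_smul hwm]
    rfl
  obtain ⟨F, hFm, hFb, hF⟩ := exists_repr_of_finite J' hJ' l hM (fun x => by
    refine (h x).trans (le_of_eq ?_)
    rw [hint]
    congr 2
    ext y
    rw [hJ'a, abs_mul, abs_of_nonneg (by positivity : 0 ≤ (w y : ℝ)⁻¹),
      mul_inv_cancel_left₀ (hw0' y)])
  refine ⟨F, hFm, hFb, fun x => ?_⟩
  rw [hF, hint]
  congr 1
  ext y
  rw [hJ'a, mul_left_comm, mul_inv_cancel_left₀ (hw0' y)]

end Duality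

/-! ### The `L¹` estimate for the adjoint problem -/

/-- The test functions: `C¹` functions with compact support. -/
def testSpace : Submodule ℝ (Z → ℝ) where
  carrier := {φ | ContDiff ℝ 1 φ ∧ HasCompactSupport φ}
  add_mem' h1 h2 := ⟨h1.1.add h2.1, h1.2.add h2.2⟩
  zero_mem' := ⟨contDiff_const, HasCompactSupport.zero⟩
  smul_mem' c _ h := ⟨contDiff_const.smul h.1, h.2.smul_left (f := fun _ => c)⟩

/-- The adjoint transport operator `∂_t φ + v · ∇_x φ - ν φ`. -/
noncomputable def adjointT (ν : R3 → ℝ) (φ : Z → ℝ) (z : Z) : ℝ :=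
  transportDeriv φ z - ν z.2.2 * φ z

lemma continuous_adjointT {ν : R3 → ℝ} (hν : Continuous ν) {φ : Z → ℝ} (hφ : ContDiff ℝ 1 φ) :
    Continuous (adjointT ν φ) :=
  (continuous_transportDeriv hφ).sub
    ((hν.comp (by fun_prop : Continuous fun z : Z => z.2.2)).mul hφ.continuous)

lemma hasCompactSupport_adjointT {ν : R3 → ℝ} {φ : Z → ℝ} (hφc : HasCompactSupport φ) :
    HasCompactSupport (adjointT ν φ) :=
  (hasCompactSupport_transportDeriv hφc).sub (hφc.mul_left (f := fun z : Z => ν z.2.2))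

lemma transportDeriv_add {φ ψ : Z → ℝ} (hφ : ContDiff ℝ 1 φ) (hψ : ContDiff ℝ 1 ψ) (z : Z) :
    transportDeriv (φ + ψ) z = transportDeriv φ z + transportDeriv ψ z := by
  rw [transportDeriv, fderiv_add (hφ.differentiable one_ne_zero z)
    (hψ.differentiable one_ne_zero z)]
  rfl

lemma transportDeriv_smul {φ : Z → ℝ} (hφ : ContDiff ℝ 1 φ) (c : ℝ) (z : Z) :
    transportDeriv (c • φ) z = c * transportDeriv φ z := by
  rw [transportDeriv, fderiv_const_smul (hφ.differentiable one_ne_zero z)]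
  rfl

lemma transportDeriv_mul {φ ψ : Z → ℝ} (hφ : ContDiff ℝ 1 φ) (hψ : ContDiff ℝ 1 ψ) (z : Z) :
    transportDeriv (fun z => φ z * ψ z) z = φ z * transportDeriv ψ z + ψ z * transportDeriv φ z := by
  rw [transportDeriv, fderiv_fun_mul (hφ.differentiable one_ne_zero z)
    (hψ.differentiable one_ne_zero z)]
  rfl

lemma transportDeriv_time {χ : ℝ → ℝ} (hχ : ContDiff ℝ 1 χ) (z : Z) :
    transportDeriv (fun z => χ z.1) z = deriv χ z.1 := by
  have h1 : HasFDerivAt (fun z : Z => χ z.1) ((fderiv ℝ χ z.1) ∘L ContinuousLinearMap.fst ℝ _ _) z :=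
    (hχ.differentiable one_ne_zero z.1).hasFDerivAt.comp z hasFDerivAt_fst
  rw [transportDeriv, h1.fderiv]
  simp

/-- A smooth approximation of the absolute value. -/
noncomputable def softAbs (δ s : ℝ) : ℝ := Real.sqrt (s ^ 2 + δ ^ 2) - δ

lemma softAbs_hasDerivAt {δ : ℝ} (hδ : 0 < δ) (s : ℝ) :
    HasDerivAt (softAbs δ) (s / Real.sqrt (s ^ 2 + δ ^ 2)) s := by
  have h1 : HasDerivAt (fun s : ℝ => s ^ 2 + δ ^ 2) (2 * s) s := by
    simpa using (hasDerivAt_pow 2 s).add_const (δ ^ 2)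
  have h2 := (h1.sqrt (by positivity)).sub_const δ
  refine h2.congr_deriv ?_
  rw [mul_div_mul_left _ _ two_ne_zero]

lemma softAbs_contDiff {δ : ℝ} (hδ : 0 < δ) : ContDiff ℝ 1 (softAbs δ) :=
  (ContDiff.sqrt (by fun_prop) fun s => by positivity).sub contDiff_const

lemma softAbs_zero {δ : ℝ} (hδ : 0 < δ) : softAbs δ 0 = 0 := by
  simp [softAbs, Real.sqrt_sq hδ.le]

lemma softAbs_nonneg {δ : ℝ} (s : ℝ) : 0 ≤ softAbs δ s := by
  rw [softAbs, sub_nonneg]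
  exact Real.le_sqrt_of_sq_le (by nlinarith [sq_nonneg s])

lemma le_softAbs {δ : ℝ} (s : ℝ) : |s| - δ ≤ softAbs δ s := by
  rw [softAbs]
  have : |s| ≤ Real.sqrt (s ^ 2 + δ ^ 2) := Real.abs_le_sqrt (by nlinarith [sq_nonneg δ])
  linarith

lemma abs_softAbs_deriv_le {δ : ℝ} (s : ℝ) : |s / Real.sqrt (s ^ 2 + δ ^ 2)| ≤ 1 := by
  rw [abs_div, abs_of_nonneg (Real.sqrt_nonneg _)]
  exact div_le_one_of_le₀ (Real.abs_le_sqrt (by nlinarith [sq_nonneg δ])) (Real.sqrt_nonneg _)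

/-- This is convexity together with `softAbs δ 0 = 0`. It stands in for `|s| = sgn(s) s` and lets
the damping term be used with the right sign. -/
lemma softAbs_le {δ : ℝ} (hδ : 0 < δ) (s : ℝ) :
    softAbs δ s ≤ s / Real.sqrt (s ^ 2 + δ ^ 2) * s := by
  set r := Real.sqrt (s ^ 2 + δ ^ 2) with hr
  have hr0 : 0 < r := Real.sqrt_pos.2 (by positivity)
  have hr2 : r ^ 2 = s ^ 2 + δ ^ 2 := Real.sq_sqrt (by positivity)
  have hrδ : δ ≤ r := Real.le_sqrt_of_sq_le (by nlinarith [sq_nonneg s])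
  rw [softAbs, ← hr, div_mul_eq_mul_div, le_div_iff₀ hr0]
  nlinarith

lemma abs_softAbs_sub_le {δ : ℝ} (hδ : 0 < δ) (a b : ℝ) :
    |softAbs δ a - softAbs δ b| ≤ |a - b| := by
  have := Convex.norm_image_sub_le_of_norm_hasDerivWithin_le (f := softAbs δ) (C := 1) (s := univ)
    (x := b) (y := a) (fun s _ => (softAbs_hasDerivAt hδ s).hasDerivWithinAt)
    (fun s _ => abs_softAbs_deriv_le s) convex_univ trivial trivial
  simpa using this

/-- The outgoing normal velocity. -/
noncomputable def fluxOut (Ω : Set R3) (z : R3 × R3) : ℝ := max (flux Ω z) 0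

lemma fluxOut_nonneg (Ω : Set R3) (z : R3 × R3) : 0 ≤ fluxOut Ω z := le_max_right _ _

lemma IsBoundedC1Domain.locBdd_fluxOut_boundaryM {Ω : Set R3} (hΩ : IsBoundedC1Domain Ω) :
    LocBdd (fun z : Z => fluxOut Ω z.2) (boundaryM Ω) := by
  have h := hΩ.locBdd_flux_boundaryM
  refine ⟨h.aesm.sup aestronglyMeasurable_const, fun K hK => ?_⟩
  obtain ⟨C, hC⟩ := h.bound K hK
  refine ⟨C, ?_⟩
  filter_upwards [hC] with z hz
  rw [fluxOut, abs_of_nonneg (le_max_right _ _)]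
  exact max_le ((le_abs_self _).trans hz) ((abs_nonneg _).trans hz)

/-- Reflection keeps `t`, `x` and `|v|`, hence preserves closed balls centred at the origin. It is
only measurable off the boundary, so a composition with it is treated as locally bounded and not as
continuous. -/
lemma LocBdd.comp_bounceZ {Ω : Set R3} (hΩ : IsBoundedC1Domain Ω) {H : Z → ℝ}
    (hH : LocBdd H (boundaryM Ω)) : LocBdd (fun z => H (bounceZ hΩ z)) (boundaryM Ω) := by
  have hmp := measurePreserving_bounceZ hΩ
  refine ⟨hH.aesm.comp_measurePreserving hmp, fun K hK => ?_⟩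
  obtain ⟨R, hR⟩ := hK.isBounded.subset_closedBall 0
  obtain ⟨C, hC⟩ := hH.bound _ (isCompact_closedBall (0 : Z) R)
  refine ⟨C, ?_⟩
  rw [ae_restrict_iff' hK.measurableSet]
  rw [ae_restrict_iff' (isCompact_closedBall (0 : Z) R).measurableSet] at hC
  filter_upwards [hmp.quasiMeasurePreserving.ae hC] with z hz hzK
  refine hz ?_
  have h1 := hR hzK
  simp only [mem_closedBall_zero_iff, Prod.norm_def, bounceZ_apply, norm_bounce_snd, bounce_fst]
    at h1 ⊢
  exact h1

lemma HasCompactSupport.comp_bounceZ {Ω : Set R3} (hΩ : IsBoundedC1Domain Ω) {H : Z → ℝ}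
    (hH : HasCompactSupport H) :
    ∃ K, IsCompact K ∧ ∀ z, z ∉ K → H z = 0 ∧ H (bounceZ hΩ z) = 0 := by
  obtain ⟨R, hR⟩ := hH.isCompact.isBounded.subset_closedBall 0
  refine ⟨Metric.closedBall 0 R, isCompact_closedBall _ _, fun z hz => ⟨?_, ?_⟩⟩
  · exact image_eq_zero_of_notMem_tsupport fun h => hz (hR h)
  · refine image_eq_zero_of_notMem_tsupport fun h => hz ?_
    have h1 := hR h
    simp only [mem_closedBall_zero_iff, Prod.norm_def, bounceZ_apply, norm_bounce_snd, bounce_fst]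
      at h1 ⊢
    exact h1

/-- Boundary fluxes, folded by the specular reflection onto the outgoing set. -/
lemma integral_mul_flux {Ω : Set R3} (hΩ : IsBoundedC1Domain Ω) {H : Z → ℝ}
    (hH : Integrable (fun z => H z * flux Ω z.2) (boundaryM Ω)) :
    ∫ z, H z * flux Ω z.2 ∂boundaryM Ω
      = ∫ z, (H z - H (bounceZ hΩ z)) * fluxOut Ω z.2 ∂boundaryM Ω := by
  have hmp := measurePreserving_bounceZ hΩ
  have hfl := hΩ.locBdd_flux_boundaryM
  -- The outgoing part is obtained by multiplying the integrable flux by the bounded indicator of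
  -- positive normal velocity. The incoming part becomes an outgoing one after the change of
  -- variables by reflection.
  have hpos : Integrable (fun z => H z * fluxOut Ω z.2) (boundaryM Ω) := by
    have h1 : AEStronglyMeasurable (fun z : Z => if 0 < flux Ω z.2 then (1 : ℝ) else 0)
        (boundaryM Ω) := by
      have hm : Measurable fun x : ℝ => if 0 < x then (1 : ℝ) else 0 :=
        Measurable.ite measurableSet_Ioi measurable_const measurable_const
      exact (hm.comp_aemeasurable hfl.aesm.aemeasurable).aestronglyMeasurable
    refine (hH.bdd_mul (c := 1) h1 (Eventually.of_forall fun z => ?_)).congr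
      (Eventually.of_forall fun z => ?_)
    · split_ifs <;> simp
    · simp only [fluxOut]
      split_ifs with h
      · rw [max_eq_left h.le, one_mul]
      · rw [max_eq_right (not_lt.1 h)]; ring
  have hneg : Integrable (fun z => H z * fluxOut Ω (bounce hΩ z.2)) (boundaryM Ω) := by
    refine (hpos.sub hH).congr ?_
    filter_upwards [hΩ.ae_boundaryM] with z hz
    simp only [Pi.sub_apply, fluxOut, flux_bounce hΩ hz]
    rw [← mul_sub]
    congr 1
    rcases le_total 0 (flux Ω z.2) with h | h
    · rw [max_eq_left h, max_eq_right (by linarith)]; ring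
    · rw [max_eq_right h, max_eq_left (by linarith)]; ring
  have hpos' : Integrable (fun z => H (bounceZ hΩ z) * fluxOut Ω z.2) (boundaryM Ω) := by
    have := hmp.integrable_comp_of_integrable hneg
    refine this.congr (Eventually.of_forall fun z => ?_)
    simp only [Function.comp_apply, bounceZ_apply, bounce_bounce]
  have h1 : ∫ z, H z * fluxOut Ω (bounce hΩ z.2) ∂boundaryM Ω
      = ∫ z, H (bounceZ hΩ z) * fluxOut Ω z.2 ∂boundaryM Ω := by
    rw [← hmp.integral_comp' (fun z => H z * fluxOut Ω (bounce hΩ z.2))]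
    refine integral_congr_ae (Eventually.of_forall fun z => ?_)
    simp only [bounceZ_apply, bounce_bounce]
  have h2 : ∫ z, H z * flux Ω z.2 ∂boundaryM Ω
      = ∫ z, (H z * fluxOut Ω z.2 - H z * fluxOut Ω (bounce hΩ z.2)) ∂boundaryM Ω := by
    refine integral_congr_ae ?_
    filter_upwards [hΩ.ae_boundaryM] with z hz
    simp only [fluxOut, flux_bounce hΩ hz]
    rw [← mul_sub]
    congr 1
    rcases le_total 0 (flux Ω z.2) with h | h
    · rw [max_eq_left h, max_eq_right (by linarith)]; ring
    · rw [max_eq_right h, max_eq_left (by linarith)]; ring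
  rw [h2, integral_sub hpos hneg, h1, ← integral_sub hpos hpos']
  simp_rw [sub_mul]

/-- The decaying weight `e^{-ν₀ t} ω(v)`. -/
noncomputable def decay (ν₀ : ℝ) (ω : R3 → ℝ) (z : Z) : ℝ := Real.exp (-ν₀ * z.1) * ω z.2.2

lemma continuous_decay (ν₀ : ℝ) {ω : R3 → ℝ} (hω : Continuous ω) : Continuous (decay ν₀ ω) := by
  unfold decay; fun_prop

/-- The a priori estimate for the adjoint problem in a weighted `L¹` space. -/
theorem integral_abs_le {Ω : Set R3} (hΩ : IsBoundedC1Domain Ω) {ν : R3 → ℝ} (hν : Continuous ν)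
    {ν₀ : ℝ} (hν₀ : 0 ≤ ν₀) (hle : ∀ v, ν₀ ≤ ν v) {ω : R3 → ℝ} (hω : Continuous ω)
    (hω0 : ∀ v, 0 < ω v) (hωr : ∀ v w, ‖v‖ = ‖w‖ → ω v = ω w) {φ : Z → ℝ} (hφ : ContDiff ℝ 1 φ)
    (hφc : HasCompactSupport φ) :
    ∫ z, ω z.2 * |φ (0, z)| ∂phaseMeasure Ω
      ≤ ∫ z, decay ν₀ ω z * |adjointT ν φ z| ∂interiorM Ω
        + ∫ z, decay ν₀ ω z * |φ z - φ (bounceZ hΩ z)| * fluxOut Ω z.2 ∂boundaryM Ω := by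
  have := hΩ.finiteOnCompacts_boundaryM
  have hq := continuous_decay ν₀ hω
  have hq0 : ∀ z, 0 < decay ν₀ ω z := fun z => mul_pos (Real.exp_pos _) (hω0 _)
  have hqb : ∀ z, decay ν₀ ω (bounceZ hΩ z) = decay ν₀ ω z := fun z => by
    simp only [decay, bounceZ_apply]
    rw [hωr _ _ (norm_bounce_snd hΩ z.2)]
  have hemb : Topology.IsClosedEmbedding fun z : R3 × R3 => ((0, z) : Z) :=
    (Isometry.of_dist_eq fun x y => by simp [Prod.dist_eq] :
      Isometry fun z : R3 × R3 => ((0, z) : Z)).isClosedEmbedding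
  have hφ0 : Continuous fun z : R3 × R3 => φ (0, z) := hφ.continuous.comp hemb.continuous
  have hφ0c : HasCompactSupport fun z : R3 × R3 => φ (0, z) := hφc.comp_isClosedEmbedding hemb
  have hω2 : Continuous fun z : R3 × R3 => ω z.2 := by fun_prop
  set K := tsupport fun z : R3 × R3 => φ (0, z)
  set A := ∫ z, decay ν₀ ω z * |adjointT ν φ z| ∂interiorM Ω
  set B := ∫ z, decay ν₀ ω z * |φ z - φ (bounceZ hΩ z)| * fluxOut Ω z.2 ∂boundaryM Ω
  set D := ∫ z in K, ω z.2 ∂phaseMeasure Ω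
  have hAi : Integrable (fun z => decay ν₀ ω z * |adjointT ν φ z|) (interiorM Ω) :=
    hq.locBdd.integrable_mul (continuous_adjointT hν hφ).abs (hasCompactSupport_adjointT hφc).abs
  have hBi : Integrable (fun z => decay ν₀ ω z * |φ z - φ (bounceZ hΩ z)| * fluxOut Ω z.2)
      (boundaryM Ω) := by
    have hlb : LocBdd φ (boundaryM Ω) := hφ.continuous.locBdd
    have h1 := ((hq.locBdd (μ := boundaryM Ω)).mul (hlb.sub (hlb.comp_bounceZ hΩ))).mul
      hΩ.locBdd_fluxOut_boundaryM
    obtain ⟨K', hK', hK'0⟩ := HasCompactSupport.comp_bounceZ hΩ hφc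
    have h2 := (h1.integrable_of_support hK' fun z hz => by
      rw [(hK'0 z hz).1, (hK'0 z hz).2]; ring).abs
    refine h2.congr (Eventually.of_forall fun z => ?_)
    simp only [abs_mul, abs_of_nonneg (hq0 z).le, abs_of_nonneg (fluxOut_nonneg Ω z.2)]
  have key : ∀ δ : ℝ, 0 < δ → ∫ z, ω z.2 * |φ (0, z)| ∂phaseMeasure Ω ≤ A + B + δ * D := by
    intro δ hδ
    have hexp : ContDiff ℝ 1 fun z : Z => Real.exp (-ν₀ * z.1) := by fun_prop
    have hβφ : ContDiff ℝ 1 fun z => softAbs δ (φ z) := (softAbs_contDiff hδ).comp hφ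
    -- The weight `ω` is merely continuous and is left out of `ψ`. Transport never differentiates in
    -- `v`, so Green's formula accepts it as a separate factor.
    set ψ : Z → ℝ := fun z => Real.exp (-ν₀ * z.1) * softAbs δ (φ z)
    have hψ : ContDiff ℝ 1 ψ := hexp.mul hβφ
    have hβc : HasCompactSupport fun z => softAbs δ (φ z) := hφc.comp_left (softAbs_zero hδ)
    have hψc : HasCompactSupport ψ := hβc.mul_left
    have green := integral_transportDeriv hΩ hω hψ hψc
    have hDψ : ∀ z, ω z.2.2 * transportDeriv ψ z = decay ν₀ ω z *
        (φ z / Real.sqrt (φ z ^ 2 + δ ^ 2) * transportDeriv φ z - ν₀ * softAbs δ (φ z)) := by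
      intro z
      have e1 : transportDeriv (fun z => softAbs δ (φ z)) z
          = φ z / Real.sqrt (φ z ^ 2 + δ ^ 2) * transportDeriv φ z := by
        have h1 := (softAbs_hasDerivAt hδ (φ z)).comp_hasFDerivAt z
          (hφ.differentiable one_ne_zero z).hasFDerivAt
        rw [transportDeriv, show (fun z => softAbs δ (φ z)) = softAbs δ ∘ φ from rfl, h1.fderiv]
        rfl
      have e2 : transportDeriv (fun z : Z => Real.exp (-ν₀ * z.1)) z
          = Real.exp (-ν₀ * z.1) * -ν₀ := by
        rw [transportDeriv_time (χ := fun t => Real.exp (-ν₀ * t)) (by fun_prop)]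
        have : HasDerivAt (fun t : ℝ => Real.exp (-ν₀ * t)) (Real.exp (-ν₀ * z.1) * -ν₀) z.1 := by
          have h := ((hasDerivAt_id z.1).const_mul (-ν₀)).exp
          simpa using h
        exact this.deriv
      rw [transportDeriv_mul hexp hβφ, e1, e2, decay]
      ring
    have h0 : ∀ z : R3 × R3, ω z.2 * ψ (0, z) = ω z.2 * softAbs δ (φ (0, z)) := fun z => by
      simp [ψ]
    have hI : -∫ z, ω z.2.2 * transportDeriv ψ z ∂interiorM Ω ≤ A := by
      rw [← integral_neg]
      refine integral_mono ?_ hAi fun z => ?_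
      · exact ((hω.comp (by fun_prop : Continuous fun z : Z => z.2.2)).locBdd.integrable_mul
          (continuous_transportDeriv hψ) (hasCompactSupport_transportDeriv hψc)).neg
      · simp only [hDψ]
        rw [← mul_neg]
        refine mul_le_mul_of_nonneg_left ?_ (hq0 z).le
        set p := φ z / Real.sqrt (φ z ^ 2 + δ ^ 2)
        have h1 := softAbs_le hδ (φ z)
        have h2 := softAbs_nonneg (δ := δ) (φ z)
        have h3 : |p| ≤ 1 := abs_softAbs_deriv_le (φ z)
        have h4 : -(p * adjointT ν φ z) ≤ |adjointT ν φ z| := by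
          refine (neg_le_abs _).trans ?_
          rw [abs_mul]
          exact mul_le_of_le_one_left (abs_nonneg _) h3
        -- The term produced by differentiating `e^{-ν₀t}` is absorbed by the damping `ν`. This is
        -- where the rate `ν₀` enters.
        have h5 : ν₀ * softAbs δ (φ z) ≤ ν z.2.2 * (p * φ z) :=
          mul_le_mul (hle _) h1 h2 (hν₀.trans (hle _))
        have h6 : p * transportDeriv φ z = p * adjointT ν φ z + ν z.2.2 * (p * φ z) := by
          rw [adjointT]; ring
        rw [h6]
        linarith
    have hII : ∫ z, ω z.2.2 * ψ z * flux Ω z.2 ∂boundaryM Ω ≤ B := by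
      have hωZ : Continuous fun z : Z => ω z.2.2 := by fun_prop
      have hli : LocBdd (fun z => ω z.2.2 * ψ z) (boundaryM Ω) :=
        hωZ.locBdd.mul hψ.continuous.locBdd
      rw [integral_mul_flux hΩ]
      · obtain ⟨K', hK', hK'0⟩ := HasCompactSupport.comp_bounceZ hΩ hψc
        refine integral_mono ?_ hBi fun z => ?_
        · refine ((hli.sub (hli.comp_bounceZ hΩ)).mul
            hΩ.locBdd_fluxOut_boundaryM).integrable_of_support hK' fun z hz => ?_
          rw [(hK'0 z hz).1, (hK'0 z hz).2]; ring
        · refine mul_le_mul_of_nonneg_right ?_ (fluxOut_nonneg _ _)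
          have e1 : ω (bounceZ hΩ z).2.2 = ω z.2.2 := hωr _ _ (norm_bounce_snd hΩ z.2)
          have e2 : ω z.2.2 * ψ z - ω (bounceZ hΩ z).2.2 * ψ (bounceZ hΩ z)
              = decay ν₀ ω z * (softAbs δ (φ z) - softAbs δ (φ (bounceZ hΩ z))) := by
            rw [e1, decay]
            simp only [ψ, bounceZ_apply]
            ring
          change ω z.2.2 * ψ z - ω (bounceZ hΩ z).2.2 * ψ (bounceZ hΩ z) ≤ _
          rw [e2]
          exact mul_le_mul_of_nonneg_left
            ((le_abs_self _).trans (abs_softAbs_sub_le hδ _ _)) (hq0 z).le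
      · refine (hli.mul hΩ.locBdd_flux_boundaryM).integrable_of_support hψc.isCompact
          fun z hz => ?_
        rw [image_eq_zero_of_notMem_tsupport hz]; ring
    -- Replacing the absolute value by `softAbs δ` costs at most `δ` pointwise, and only on the
    -- compact support `K` of `φ(0)`. The error `δ D` disappears as `δ → 0`.
    have hIII : ∫ z, ω z.2 * |φ (0, z)| ∂phaseMeasure Ω
        ≤ ∫ z, ω z.2 * softAbs δ (φ (0, z)) ∂phaseMeasure Ω + δ * D := by
      have hi1 : Integrable (fun z : R3 × R3 => ω z.2 * softAbs δ (φ (0, z))) (phaseMeasure Ω) :=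
        hω2.locBdd.integrable_mul ((softAbs_contDiff hδ).continuous.comp hφ0)
          (hφ0c.comp_left (softAbs_zero hδ))
      have hi2 : Integrable (K.indicator fun z : R3 × R3 => ω z.2) (phaseMeasure Ω) :=
        (hω2.locBdd.integrableOn hφ0c.isCompact).integrable_indicator hφ0c.isCompact.measurableSet
      have hD : D = ∫ z, K.indicator (fun z : R3 × R3 => ω z.2) z ∂phaseMeasure Ω :=
        (integral_indicator hφ0c.isCompact.measurableSet).symm
      rw [hD, ← integral_const_mul, ← integral_add hi1 (hi2.const_mul δ)]
      refine integral_mono (hω2.locBdd.integrable_mul hφ0.abs hφ0c.abs)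
        (hi1.add (hi2.const_mul δ)) fun z => ?_
      by_cases hz : z ∈ K
      · simp only [indicator_of_mem hz]
        have := mul_le_mul_of_nonneg_left (le_softAbs (δ := δ) (φ (0, z))) (hω0 z.2).le
        linarith
      · have hz0 : φ (0, z) = 0 :=
          image_eq_zero_of_notMem_tsupport (f := fun z : R3 × R3 => φ (0, z)) hz
        simp [indicator_of_notMem hz, hz0, softAbs_zero hδ]
    simp_rw [h0] at green
    linarith
  have hD : 0 ≤ D := setIntegral_nonneg hφ0c.isCompact.measurableSet fun z _ => (hω0 _).le
  refine le_of_forall_pos_le_add fun ε hε => (key (ε / (D + 1)) (by positivity)).trans ?_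
  have : ε / (D + 1) * D ≤ ε := by
    rw [div_mul_eq_mul_div, div_le_iff₀ (by positivity)]
    nlinarith
  linarith

/-! ### Existence of a solution of the weak formulation in space-time -/

lemma measurableEmbedding_inl {α β : Type*} [MeasurableSpace α] [MeasurableSpace β] :
    MeasurableEmbedding (Sum.inl : α → α ⊕ β) :=
  ⟨Sum.inl_injective, measurable_inl, fun _ hs => hs.inl_image⟩

lemma measurableEmbedding_inr {α β : Type*} [MeasurableSpace α] [MeasurableSpace β] :
    MeasurableEmbedding (Sum.inr : β → α ⊕ β) :=
  ⟨Sum.inr_injective, measurable_inr, fun _ hs => hs.inr_image⟩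

lemma integrable_sumMeasure {α β : Type*} [MeasurableSpace α] [MeasurableSpace β] {μ : Measure α}
    {ν : Measure β} {F : α ⊕ β → ℝ} (h1 : Integrable (fun a => F (Sum.inl a)) μ)
    (h2 : Integrable (fun a => F (Sum.inr a)) ν) :
    Integrable F (μ.map Sum.inl + ν.map Sum.inr) :=
  (measurableEmbedding_inl.integrable_map_iff.2 h1).add_measure
    (measurableEmbedding_inr.integrable_map_iff.2 h2)

lemma integral_sumMeasure {α β : Type*} [MeasurableSpace α] [MeasurableSpace β] {μ : Measure α}
    {ν : Measure β} {F : α ⊕ β → ℝ} (h1 : Integrable (fun a => F (Sum.inl a)) μ)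
    (h2 : Integrable (fun a => F (Sum.inr a)) ν) :
    ∫ y, F y ∂(μ.map Sum.inl + ν.map Sum.inr)
      = ∫ a, F (Sum.inl a) ∂μ + ∫ b, F (Sum.inr b) ∂ν := by
  rw [integral_add_measure (measurableEmbedding_inl.integrable_map_iff.2 h1)
    (measurableEmbedding_inr.integrable_map_iff.2 h2), measurableEmbedding_inl.integral_map,
    measurableEmbedding_inr.integral_map]

lemma hasCompactSupport_slice {φ : Z → ℝ} (hφc : HasCompactSupport φ) (t : ℝ) :
    HasCompactSupport fun z : R3 × R3 => φ (t, z) :=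
  hφc.comp_isClosedEmbedding (Isometry.of_dist_eq fun x y => by simp [Prod.dist_eq] :
      Isometry fun z : R3 × R3 => ((t, z) : Z)).isClosedEmbedding

lemma continuous_slice {φ : Z → ℝ} (hφ : Continuous φ) (t : ℝ) :
    Continuous fun z : R3 × R3 => φ (t, z) := hφ.comp (by fun_prop)

lemma locBdd_of_le {X : Type*} [TopologicalSpace X] [MeasurableSpace X] {μ : Measure X}
    {f q : X → ℝ} (hf : AEStronglyMeasurable f μ) (hq : LocBdd q μ) (h : ∀ᵐ z ∂μ, |f z| ≤ q z) :
    LocBdd f μ := by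
  refine ⟨hf, fun K hK => ?_⟩
  obtain ⟨C, hC⟩ := hq.bound K hK
  refine ⟨C, ?_⟩
  filter_upwards [hC, ae_restrict_of_ae h] with z h1 h2
  exact h2.trans ((le_abs_self _).trans h1)

/-- The jump `φ - φ ∘ R` across the reflection, weighted by the outgoing flux. -/
lemma integrable_decay_jump {Ω : Set R3} (hΩ : IsBoundedC1Domain Ω) (ν₀ : ℝ) {ω : R3 → ℝ}
    (hω : Continuous ω) {φ : Z → ℝ} (hφ : Continuous φ) (hφc : HasCompactSupport φ) :
    Integrable (fun z => decay ν₀ ω z * (φ z - φ (bounceZ hΩ z)) * fluxOut Ω z.2)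
      (boundaryM Ω) := by
  have := hΩ.finiteOnCompacts_boundaryM
  have hlb : LocBdd φ (boundaryM Ω) := hφ.locBdd
  have h1 := (((continuous_decay ν₀ hω).locBdd (μ := boundaryM Ω)).mul
    (hlb.sub (hlb.comp_bounceZ hΩ))).mul hΩ.locBdd_fluxOut_boundaryM
  obtain ⟨K, hK, hK0⟩ := HasCompactSupport.comp_bounceZ hΩ hφc
  exact h1.integrable_of_support hK fun z hz => by
    rw [(hK0 z hz).1, (hK0 z hz).2]; ring

/-- The normal velocity, made measurable. -/
noncomputable def flux' (Ω : Set R3) (z : R3 × R3) : ℝ := inner ℝ z.2 (normal Ω z.1)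

lemma flux'_eq {Ω : Set R3} {z : R3 × R3} (hz : z.1 ∈ frontier Ω) : flux' Ω z = flux Ω z := by
  rw [flux', normal, indicator_of_mem hz, flux]

lemma measurable_flux' {Ω : Set R3} (hΩ : IsBoundedC1Domain Ω) : Measurable (flux' Ω) :=
  measurable_snd.inner (hΩ.measurable_normal.comp measurable_fst)

lemma flux'_bounce {Ω : Set R3} (hΩ : IsBoundedC1Domain Ω) (z : R3 × R3) :
    flux' Ω (bounce hΩ z) = - flux' Ω z := by
  by_cases hz : z.1 ∈ frontier Ω
  · rw [flux'_eq hz, flux'_eq (by rwa [bounce_fst]), flux_bounce hΩ hz]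
  · simp [flux', normal, bounce_fst, indicator_of_notMem hz]

lemma bounce_of_flux'_eq_zero {Ω : Set R3} (hΩ : IsBoundedC1Domain Ω) {z : R3 × R3}
    (hz : flux' Ω z = 0) : bounce hΩ z = z := by
  rw [bounce_apply, bounceFun]
  rw [flux'] at hz
  simp [hz]

/-- Existence for the transport equation with specular reflection, in the space-time weak form. -/
theorem exists_spacetime_solution {Ω : Set R3} (hΩ : IsBoundedC1Domain Ω) {ν : R3 → ℝ}
    (hν : Continuous ν) {ν₀ : ℝ} (hν₀ : 0 ≤ ν₀) (hle : ∀ v, ν₀ ≤ ν v) {ω : R3 → ℝ}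
    (hω : Continuous ω) (hω0 : ∀ v, 0 < ω v) (hωr : ∀ v w, ‖v‖ = ‖w‖ → ω v = ω w)
    {f₀ : R3 × R3 → ℝ} (hf₀ : AEStronglyMeasurable f₀ (phaseMeasure Ω)) {M : ℝ} (hM : 0 ≤ M)
    (hf₀M : ∀ᵐ z ∂phaseMeasure Ω, |f₀ z| ≤ M * ω z.2) :
    ∃ f g : Z → ℝ, Measurable f ∧ Measurable g ∧ (∀ z, |f z| ≤ M * decay ν₀ ω z) ∧
      (∀ z, |g z| ≤ M * decay ν₀ ω z) ∧ (∀ z, g (bounceZ hΩ z) = g z) ∧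
      ∀ φ : Z → ℝ, ContDiff ℝ 1 φ → HasCompactSupport φ →
        (∫ z, f₀ z * φ (0, z) ∂phaseMeasure Ω) + (∫ z, f z * adjointT ν φ z ∂interiorM Ω)
          - ∫ z, g z * φ z * flux Ω z.2 ∂boundaryM Ω = 0 := by
  have := hΩ.sigmaFinite_boundaryM
  have := hΩ.finiteOnCompacts_boundaryM
  have hω2 : Continuous fun z : R3 × R3 => ω z.2 := by fun_prop
  have hf₀l : LocBdd f₀ (phaseMeasure Ω) :=
    locBdd_of_le hf₀ (hω2.locBdd.const_mul M) hf₀M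
  have hq := continuous_decay ν₀ hω
  have hq0 : ∀ z, 0 < decay ν₀ ω z := fun z => mul_pos (Real.exp_pos _) (hω0 _)
  have hqb : ∀ z, decay ν₀ ω (bounceZ hΩ z) = decay ν₀ ω z := fun z => by
    simp only [decay, bounceZ_apply]
    rw [hωr _ _ (norm_bounce_snd hΩ z.2)]
  have hi0 : ∀ φ : testSpace, Integrable (fun z => f₀ z * φ.1 (0, z)) (phaseMeasure Ω) := fun φ =>
    hf₀l.integrable_mul (continuous_slice φ.2.1.continuous 0) (hasCompactSupport_slice φ.2.2 0)
  let l : testSpace →ₗ[ℝ] ℝ :=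
    { toFun := fun φ => ∫ z, f₀ z * φ.1 (0, z) ∂phaseMeasure Ω
      map_add' := fun φ ψ => by
        rw [← integral_add (hi0 φ) (hi0 ψ)]
        simp only [Submodule.coe_add, Pi.add_apply, mul_add]
      map_smul' := fun c φ => by
        simp only [Submodule.coe_smul, Pi.smul_apply, smul_eq_mul, RingHom.id_apply]
        rw [← integral_const_mul]
        congr 1; ext z; ring }
  -- The disjoint union puts the interior residual and the boundary jump in a single `L¹` space. The
  -- signs are those of the weak formulation, so the representing density gives the solution on one
  -- copy and the outgoing trace on the other.
  let J : testSpace →ₗ[ℝ] (Z ⊕ Z → ℝ) :=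
    { toFun := fun φ => Sum.elim (fun z => -(decay ν₀ ω z * adjointT ν φ.1 z))
        (fun z => decay ν₀ ω z * (φ.1 z - φ.1 (bounceZ hΩ z)) * fluxOut Ω z.2)
      map_add' := fun φ ψ => by
        ext y
        rcases y with z | z
        · simp only [Sum.elim_inl, adjointT, Submodule.coe_add, Pi.add_apply,
            transportDeriv_add φ.2.1 ψ.2.1]
          ring
        · simp only [Sum.elim_inr, Submodule.coe_add, Pi.add_apply]
          ring
      map_smul' := fun c φ => by
        ext y
        rcases y with z | z
        · simp only [Sum.elim_inl, adjointT, Submodule.coe_smul, Pi.smul_apply, smul_eq_mul,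
            transportDeriv_smul φ.2.1, RingHom.id_apply]
          ring
        · simp only [Sum.elim_inr, Submodule.coe_smul, Pi.smul_apply, smul_eq_mul,
            RingHom.id_apply]
          ring }
  have hJl : ∀ (φ : testSpace) z, J φ (Sum.inl z) = -(decay ν₀ ω z * adjointT ν φ.1 z) :=
    fun _ _ => rfl
  have hJr : ∀ (φ : testSpace) z, J φ (Sum.inr z)
      = decay ν₀ ω z * (φ.1 z - φ.1 (bounceZ hΩ z)) * fluxOut Ω z.2 := fun _ _ => rfl
  have hi1 : ∀ φ : testSpace, Integrable (fun z => J φ (Sum.inl z)) (interiorM Ω) := fun φ =>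
    (hq.locBdd.integrable_mul (continuous_adjointT hν φ.2.1)
      (hasCompactSupport_adjointT φ.2.2)).neg
  have hi2 : ∀ φ : testSpace, Integrable (fun z => J φ (Sum.inr z)) (boundaryM Ω) := fun φ =>
    integrable_decay_jump hΩ ν₀ hω φ.2.1.continuous φ.2.2
  have : SigmaFinite ((interiorM Ω).map (Sum.inl : Z → Z ⊕ Z)) :=
    measurableEmbedding_inl.sigmaFinite_map
  have : SigmaFinite ((boundaryM Ω).map (Sum.inr : Z → Z ⊕ Z)) :=
    measurableEmbedding_inr.sigmaFinite_map
  obtain ⟨F, hFm, hFM, hF⟩ := exists_repr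
    (μ := (interiorM Ω).map (Sum.inl : Z → Z ⊕ Z) + (boundaryM Ω).map Sum.inr) J
    (fun φ => integrable_sumMeasure (hi1 φ) (hi2 φ)) l hM (fun φ => by
      have h1 : |l φ| ≤ M * ∫ z, ω z.2 * |φ.1 (0, z)| ∂phaseMeasure Ω := by
        rw [← integral_const_mul]
        refine (abs_integral_le_integral_abs).trans (integral_mono_ae (hi0 φ).abs ?_ ?_)
        · exact (hω2.locBdd.integrable_mul (continuous_slice φ.2.1.continuous 0).abs
            (hasCompactSupport_slice φ.2.2 0).abs).const_mul M
        · filter_upwards [hf₀M] with z hz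
          rw [abs_mul, ← mul_assoc]
          exact mul_le_mul_of_nonneg_right hz (abs_nonneg _)
      refine h1.trans (mul_le_mul_of_nonneg_left ?_ hM)
      refine (integral_abs_le hΩ hν hν₀ hle hω hω0 hωr φ.2.1 φ.2.2).trans (le_of_eq ?_)
      rw [integral_sumMeasure (hi1 φ).abs (hi2 φ).abs]
      simp only [hJl, hJr, abs_neg, abs_mul, abs_of_pos (hq0 _), abs_of_nonneg (fluxOut_nonneg Ω _)])
  classical
  -- Only outgoing values of the density are determined, the jump being weighted by the outgoing
  -- flux. Incoming values are defined by reflection, and grazing points are fixed by it, so `G` is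
  -- exactly symmetric.
  let G : Z → ℝ := fun z =>
    if 0 < flux' Ω z.2 then F (Sum.inr z) else F (Sum.inr (bounceZ hΩ z))
  have hGm : Measurable G :=
    Measurable.ite ((measurable_flux' hΩ).comp measurable_snd measurableSet_Ioi)
      (hFm.comp measurable_inr) (hFm.comp (measurable_inr.comp (bounceZ hΩ).measurable))
  have hGs : ∀ z, G (bounceZ hΩ z) = G z := by
    intro z
    have hb : bounceZ hΩ (bounceZ hΩ z) = z := by
      simp only [bounceZ_apply, bounce_bounce]
    simp only [G, hb]
    have h1 : flux' Ω (bounceZ hΩ z).2 = - flux' Ω z.2 := flux'_bounce hΩ z.2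
    rw [h1]
    rcases lt_trichotomy (flux' Ω z.2) 0 with h | h | h
    · rw [if_pos (by linarith), if_neg (by linarith)]
    · rw [if_neg (by linarith), if_neg (by linarith), bounceZ_apply, bounce_of_flux'_eq_zero hΩ h]
    · rw [if_neg (by linarith), if_pos h]
  refine ⟨fun z => F (Sum.inl z) * decay ν₀ ω z, fun z => G z * decay ν₀ ω z,
    (hFm.comp measurable_inl).mul hq.measurable, hGm.mul hq.measurable, fun z => ?_, fun z => ?_,
    fun z => by simp only [hGs, hqb], fun φ hφ hφc => ?_⟩
  · rw [abs_mul, abs_of_pos (hq0 z)]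
    exact mul_le_mul_of_nonneg_right (hFM _) (hq0 z).le
  · rw [abs_mul, abs_of_pos (hq0 z)]
    refine mul_le_mul_of_nonneg_right ?_ (hq0 z).le
    simp only [G]
    split_ifs <;> exact hFM _
  · have hl := hF ⟨φ, hφ, hφc⟩
    have hbd : ∀ (u : Z → ℝ), Integrable u (interiorM Ω) →
        Integrable (fun z => F (Sum.inl z) * u z) (interiorM Ω) := fun u hu =>
      hu.bdd_mul (c := M) (hFm.comp measurable_inl).aestronglyMeasurable
        (Eventually.of_forall fun z => hFM _)
    have hbd2 : ∀ (u : Z → ℝ), Integrable u (boundaryM Ω) →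
        Integrable (fun z => F (Sum.inr z) * u z) (boundaryM Ω) := fun u hu =>
      hu.bdd_mul (c := M) (hFm.comp measurable_inr).aestronglyMeasurable
        (Eventually.of_forall fun z => hFM _)
    rw [integral_sumMeasure (hbd _ (hi1 _)) (hbd2 _ (hi2 _))] at hl
    simp only [hJl, hJr] at hl
    have hgi : Integrable (fun z => G z * decay ν₀ ω z * φ z * flux Ω z.2) (boundaryM Ω) := by
      have h1 : LocBdd G (boundaryM Ω) := locBdd_of_bound (C := M) hGm.aestronglyMeasurable
        (Eventually.of_forall fun z => by simp only [G]; split_ifs <;> exact hFM _)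
      refine (((h1.mul hq.locBdd).mul hφ.continuous.locBdd).mul
        hΩ.locBdd_flux_boundaryM).integrable_of_support hφc.isCompact fun z hz => ?_
      rw [image_eq_zero_of_notMem_tsupport hz]; ring
    rw [integral_mul_flux hΩ hgi]
    have e1 : ∫ z, (G z * decay ν₀ ω z * φ z
          - G (bounceZ hΩ z) * decay ν₀ ω (bounceZ hΩ z) * φ (bounceZ hΩ z)) * fluxOut Ω z.2
          ∂boundaryM Ω
        = ∫ z, F (Sum.inr z) * (decay ν₀ ω z * (φ z - φ (bounceZ hΩ z)) * fluxOut Ω z.2)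
          ∂boundaryM Ω := by
      refine integral_congr_ae ?_
      filter_upwards [hΩ.ae_boundaryM] with z hz
      rw [hGs, hqb]
      by_cases h : 0 < flux' Ω z.2
      · simp only [G, if_pos h]; ring
      · have : fluxOut Ω z.2 = 0 := by
          rw [fluxOut, max_eq_right]
          rw [← flux'_eq hz]; exact not_lt.1 h
        rw [this]; ring
    have e2 : ∫ z, F (Sum.inl z) * decay ν₀ ω z * adjointT ν φ z ∂interiorM Ω
        = - ∫ z, F (Sum.inl z) * -(decay ν₀ ω z * adjointT ν φ z) ∂interiorM Ω := by
      rw [← integral_neg]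
      congr 1; ext z; ring
    have e3 : l ⟨φ, hφ, hφc⟩ = ∫ z, f₀ z * φ (0, z) ∂phaseMeasure Ω := rfl
    rw [e1, e2, ← e3, hl]
    ring

/-! ### Time slices -/

/-- A function whose weak derivative on `[0, ∞)` is `I`, with initial value `c`, is a primitive. -/
lemma ae_eq_primitive {a I : ℝ → ℝ} {c : ℝ} (ha : IntegrableOn a (Ici 0))
    (hI : IntegrableOn I (Ici 0))
    (h : ∀ χ : ℝ → ℝ, ContDiff ℝ 1 χ →
      χ 0 * c + (∫ s in Ici 0, χ s * I s) + ∫ s in Ici 0, deriv χ s * a s = 0) :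
    ∀ᵐ s ∂volume.restrict (Ici (0 : ℝ)), a s = c + ∫ r in (0 : ℝ)..s, I r := by
  set J : ℝ → ℝ := (Ici 0).indicator I with hJ
  have hJi : Integrable J := hI.integrable_indicator measurableSet_Ici
  set P : ℝ → ℝ := fun s => ∫ r in (0 : ℝ)..s, J r with hP
  have hPc : Continuous P :=
    intervalIntegral.continuous_primitive (fun _ _ => hJi.intervalIntegrable) 0
  have hPI : ∀ s, 0 ≤ s → P s = ∫ r in (0 : ℝ)..s, I r := fun s hs => by
    refine intervalIntegral.integral_congr fun r hr => ?_
    rw [uIcc_of_le hs] at hr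
    exact indicator_of_mem (show r ∈ Ici (0 : ℝ) from hr.1) _
  have key : ∀ᵐ s, s ∈ Ioi (0 : ℝ) → a s - (c + P s) = 0 := by
    refine isOpen_Ioi.ae_eq_zero_of_integral_contDiff_smul_eq_zero ?_ fun ψ hψ hψc hψs => ?_
    · exact ((ha.mono_set Ioi_subset_Ici_self).locallyIntegrableOn).sub
        ((continuous_const.add hPc).locallyIntegrable.locallyIntegrableOn _)
    · obtain ⟨R, hR⟩ := hψc.isCompact.isBounded.subset_closedBall 0
      set L : ℝ := max R 0 + 1
      have hL0 : 0 < L := by positivity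
      have hψL : ∀ s, L ≤ s → ψ s = 0 := fun s hs => by
        refine image_eq_zero_of_notMem_tsupport fun hm => ?_
        have h1 := hR hm
        rw [mem_closedBall_zero_iff, Real.norm_eq_abs] at h1
        have := le_abs_self s
        have := le_max_left R 0
        linarith
      have hψ0 : ∀ s, s ≤ 0 → ψ s = 0 := fun s hs =>
        image_eq_zero_of_notMem_tsupport fun hm => not_lt.2 hs (hψs hm)
      -- An antiderivative of `ψ` based at `L`, beyond its support: it vanishes for large times, and
      -- its value at `0` is `-∫ψ`. This value brings the constant `c` into the identity.
      set χ : ℝ → ℝ := fun s => ∫ r in L..s, ψ r with hχ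
      have hχd : ∀ s, HasDerivAt χ (ψ s) s := fun s =>
        intervalIntegral.integral_hasDerivAt_right (hψ.continuous.intervalIntegrable _ _)
          (hψ.continuous.stronglyMeasurableAtFilter _ _) hψ.continuous.continuousAt
      have hχ' : deriv χ = ψ := funext fun s => (hχd s).deriv
      have hχ1 : ContDiff ℝ 1 χ := contDiff_one_iff_deriv.2
        ⟨fun s => (hχd s).differentiableAt, by rw [hχ']; exact hψ.continuous⟩
      have hχL : ∀ s, L ≤ s → χ s = 0 := fun s hs => by
        rw [hχ]
        refine (intervalIntegral.integral_congr (g := fun _ => (0 : ℝ)) fun r hr => ?_).trans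
          intervalIntegral.integral_zero
        rw [uIcc_of_le hs] at hr
        exact hψL r hr.1
      have hχ0 : ∫ s, ψ s = -χ 0 := by
        change _ = -∫ r in L..(0 : ℝ), ψ r
        rw [intervalIntegral.integral_symm, neg_neg, intervalIntegral.integral_of_le hL0.le,
          ← integral_indicator measurableSet_Ioc]
        congr 1
        ext s
        by_cases hs : s ∈ Ioc 0 L
        · rw [indicator_of_mem hs]
        · rw [indicator_of_notMem hs]
          rcases not_and_or.1 hs with hs | hs
          · exact hψ0 s (not_lt.1 hs)
          · exact hψL s (not_le.1 hs).le
      have ibp : ∫ s, ψ s * P s = -∫ s in Ici 0, χ s * I s := by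
        have hac : AbsolutelyContinuousOnInterval P 0 L :=
          (hJi.intervalIntegrable).absolutelyContinuousOnInterval_intervalIntegral
            (by simp [hL0.le])
        have hacχ : AbsolutelyContinuousOnInterval χ 0 L :=
          hχ1.contDiffOn.absolutelyContinuousOnInterval
        have h1 := hacχ.integral_mul_deriv_eq_deriv_mul hac
        have hP0 : P 0 = 0 := by simp [hP]
        rw [hχL L le_rfl, hP0, hχ'] at h1
        have h2 : ∫ s in (0 : ℝ)..L, χ s * deriv P s = ∫ s in Ici 0, χ s * I s := by
          have h3 : ∫ s in (0 : ℝ)..L, χ s * deriv P s = ∫ s in (0 : ℝ)..L, χ s * J s := by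
            refine intervalIntegral.integral_congr_ae ?_
            -- Lebesgue differentiation: `P` is only absolutely continuous, with derivative `J`
            -- almost everywhere.
            filter_upwards [LocallyIntegrable.ae_hasDerivAt_integral hJi.locallyIntegrable] with s hs _
            rw [(hs 0).deriv]
          rw [h3, intervalIntegral.integral_of_le hL0.le, ← integral_indicator measurableSet_Ioc,
            ← integral_indicator measurableSet_Ici]
          refine integral_congr_ae ?_
          have hne : ∀ᵐ s : ℝ, s ≠ 0 := by simp [ae_iff]
          filter_upwards [hne] with s hs
          by_cases hs1 : s ∈ Ioc 0 L
          · rw [indicator_of_mem hs1, indicator_of_mem (show s ∈ Ici (0 : ℝ) from hs1.1.le), hJ,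
              indicator_of_mem (show s ∈ Ici (0 : ℝ) from hs1.1.le)]
          · rw [indicator_of_notMem hs1]
            by_cases hs2 : s ∈ Ici (0 : ℝ)
            · rw [indicator_of_mem hs2, hχL s, zero_mul]
              by_contra hlt
              exact hs1 ⟨lt_of_le_of_ne hs2 hs.symm, (not_le.1 hlt).le⟩
            · rw [indicator_of_notMem hs2]
        have h4 : ∫ s in (0 : ℝ)..L, ψ s * P s = ∫ s, ψ s * P s := by
          rw [intervalIntegral.integral_of_le hL0.le, ← integral_indicator measurableSet_Ioc]
          congr 1
          ext s
          by_cases hs : s ∈ Ioc 0 L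
          · rw [indicator_of_mem hs]
          · rw [indicator_of_notMem hs]
            rcases not_and_or.1 hs with hs | hs
            · rw [hψ0 s (not_lt.1 hs), zero_mul]
            · rw [hψL s (not_le.1 hs).le, zero_mul]
        rw [h2, h4] at h1
        linarith
      have hψa : ∫ s, ψ s * a s = ∫ s in Ici 0, deriv χ s * a s := by
        rw [hχ', setIntegral_eq_integral_of_forall_compl_eq_zero]
        intro s hs
        rw [hψ0 s (not_le.1 hs).le, zero_mul]
      have hia : Integrable fun s => ψ s * a s := by
        have h1 : IntegrableOn (fun s => ψ s * a s) (Ici 0) := by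
          obtain ⟨C, hC⟩ := hψ.continuous.bounded_above_of_compact_support hψc
          exact ha.bdd_mul hψ.continuous.aestronglyMeasurable (Eventually.of_forall hC)
        refine (integrableOn_iff_integrable_of_support_subset fun s hs => ?_).1 h1
        by_contra hs0
        exact hs (by simp only [hψ0 s (not_le.1 hs0).le, zero_mul])
      have hiP : Integrable fun s => ψ s * (c + P s) :=
        (hψ.continuous.mul (continuous_const.add hPc)).integrable_of_hasCompactSupport
          hψc.mul_right
      have hic : Integrable fun s => ψ s * c :=
        (hψ.continuous.mul continuous_const).integrable_of_hasCompactSupport hψc.mul_right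
      have hiP' : Integrable fun s => ψ s * P s :=
        (hψ.continuous.mul hPc).integrable_of_hasCompactSupport hψc.mul_right
      have h5 := h χ hχ1
      simp only [smul_eq_mul, mul_sub]
      rw [integral_sub hia hiP]
      simp only [mul_add]
      rw [integral_add hic hiP', ibp, integral_mul_const, hχ0, hψa]
      linarith
  rw [ae_restrict_iff' measurableSet_Ici]
  have hne : ∀ᵐ s : ℝ, s ≠ 0 := by simp [ae_iff]
  filter_upwards [key, hne] with s hs hs0 hs1
  rw [← hPI s hs1]
  have := hs (lt_of_le_of_ne hs1 hs0.symm)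
  linarith

/-- The weak formulation, integrated over all times. -/
def IsSpacetimeSolution (Ω : Set R3) (ν : R3 → ℝ) (f₀ : R3 × R3 → ℝ) (f g : Z → ℝ) : Prop :=
  ∀ φ : Z → ℝ, ContDiff ℝ 1 φ → HasCompactSupport φ →
    (∫ z, f₀ z * φ (0, z) ∂phaseMeasure Ω) + (∫ z, f z * adjointT ν φ z ∂interiorM Ω)
      - ∫ z, g z * φ z * flux Ω z.2 ∂boundaryM Ω = 0

/-- The rate of change of the pairing of a solution with a test function. -/
noncomputable def pairingRate (Ω : Set R3) (ν : R3 → ℝ) (f g φ : Z → ℝ) (s : ℝ) : ℝ :=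
  (∫ z, f (s, z) * adjointT ν φ (s, z) ∂phaseMeasure Ω)
    - ∫ z, g (s, z) * φ (s, z) * flux Ω z ∂boundaryMeasure Ω

/-- The pairing of a solution with a test function, as a primitive of its rate of change. -/
noncomputable def pairing (Ω : Set R3) (ν : R3 → ℝ) (f₀ : R3 × R3 → ℝ) (f g φ : Z → ℝ)
    (t : ℝ) : ℝ :=
  (∫ z, f₀ z * φ (0, z) ∂phaseMeasure Ω) + ∫ s in (0 : ℝ)..t, pairingRate Ω ν f g φ s

lemma integral_interiorM {Ω : Set R3} {u : Z → ℝ} (hu : Integrable u (interiorM Ω)) :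
    ∫ z, u z ∂interiorM Ω = ∫ s in Ici (0 : ℝ), ∫ z, u (s, z) ∂phaseMeasure Ω :=
  integral_prod _ hu

lemma integral_boundaryM {Ω : Set R3} (hΩ : IsBoundedC1Domain Ω) {u : Z → ℝ}
    (hu : Integrable u (boundaryM Ω)) :
    ∫ z, u z ∂boundaryM Ω = ∫ s in Ici (0 : ℝ), ∫ z, u (s, z) ∂boundaryMeasure Ω := by
  have := hΩ.sigmaFinite_boundaryMeasure
  exact integral_prod _ hu

lemma integrable_mul_mul_flux {Ω : Set R3} (hΩ : IsBoundedC1Domain Ω) {g φ : Z → ℝ}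
    (hg : LocBdd g (boundaryM Ω)) (hφ : Continuous φ) (hφc : HasCompactSupport φ) :
    Integrable (fun z => g z * φ z * flux Ω z.2) (boundaryM Ω) := by
  have := hΩ.finiteOnCompacts_boundaryM
  refine ((hg.mul hφ.locBdd).mul hΩ.locBdd_flux_boundaryM).integrable_of_support hφc.isCompact
    fun z hz => ?_
  rw [image_eq_zero_of_notMem_tsupport hz]; ring

lemma integrableOn_pairingRate {Ω : Set R3} (hΩ : IsBoundedC1Domain Ω) {ν : R3 → ℝ}
    (hν : Continuous ν) {f g φ : Z → ℝ} (hf : LocBdd f (interiorM Ω))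
    (hg : LocBdd g (boundaryM Ω)) (hφ : ContDiff ℝ 1 φ) (hφc : HasCompactSupport φ) :
    IntegrableOn (pairingRate Ω ν f g φ) (Ici 0) := by
  have := hΩ.sigmaFinite_boundaryMeasure
  exact (hf.integrable_mul (continuous_adjointT hν hφ)
    (hasCompactSupport_adjointT hφc)).integral_prod_left.sub
    (integrable_mul_mul_flux hΩ hg hφ.continuous hφc).integral_prod_left

/-- Testing with `χ(t) φ` for arbitrary `χ` says that the pairing with `φ` has a weak derivative in
time, which is `pairingRate`. The exceptional times depend on `φ`. -/
lemma ae_eq_pairing {Ω : Set R3} (hΩ : IsBoundedC1Domain Ω) {ν : R3 → ℝ}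
    (hν : Continuous ν) {f₀ : R3 × R3 → ℝ} {f g φ : Z → ℝ} (hf : LocBdd f (interiorM Ω))
    (hg : LocBdd g (boundaryM Ω)) (h : IsSpacetimeSolution Ω ν f₀ f g) (hφ : ContDiff ℝ 1 φ)
    (hφc : HasCompactSupport φ) :
    ∀ᵐ s ∂volume.restrict (Ici (0 : ℝ)),
      ∫ z, f (s, z) * φ (s, z) ∂phaseMeasure Ω = pairing Ω ν f₀ f g φ s := by
  have := hΩ.sigmaFinite_boundaryMeasure
  refine ae_eq_primitive (hf.integrable_mul hφ.continuous hφc).integral_prod_left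
    (integrableOn_pairingRate hΩ hν hf hg hφ hφc) fun χ hχ => ?_
  have hχ1 : ContDiff ℝ 1 fun z : Z => χ z.1 := hχ.comp contDiff_fst
  have hχd : Continuous fun z : Z => deriv χ z.1 :=
    (hχ.continuous_deriv le_rfl).comp continuous_fst
  have hψc : HasCompactSupport fun z : Z => χ z.1 * φ z := hφc.mul_left
  have h1 := h _ (hχ1.mul hφ) hψc
  have hT : ∀ z, adjointT ν (fun z : Z => χ z.1 * φ z) z
      = χ z.1 * adjointT ν φ z + deriv χ z.1 * φ z := fun z => by
    rw [adjointT, transportDeriv_mul hχ1 hφ, transportDeriv_time hχ, adjointT]; ring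
  have hTi1 : Integrable (fun z => f z * (χ z.1 * adjointT ν φ z)) (interiorM Ω) :=
    hf.integrable_mul (hχ1.continuous.mul (continuous_adjointT hν hφ))
      (hasCompactSupport_adjointT hφc).mul_left
  have hTi2 : Integrable (fun z => f z * (deriv χ z.1 * φ z)) (interiorM Ω) :=
    hf.integrable_mul (hχd.mul hφ.continuous) hφc.mul_left
  have hbi : Integrable (fun z => g z * (χ z.1 * φ z) * flux Ω z.2) (boundaryM Ω) :=
    integrable_mul_mul_flux hΩ hg (hχ1.continuous.mul hφ.continuous) hψc
  simp only [hT, mul_add] at h1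
  rw [integral_add hTi1 hTi2, integral_interiorM hTi1, integral_interiorM hTi2,
    integral_boundaryM hΩ hbi] at h1
  have e0 : ∫ z, f₀ z * (χ 0 * φ (0, z)) ∂phaseMeasure Ω
      = χ 0 * ∫ z, f₀ z * φ (0, z) ∂phaseMeasure Ω := by
    rw [← integral_const_mul]; congr 1; ext z; ring
  have e1 : ∀ s, ∫ z, f (s, z) * (χ s * adjointT ν φ (s, z)) ∂phaseMeasure Ω
      = χ s * ∫ z, f (s, z) * adjointT ν φ (s, z) ∂phaseMeasure Ω := fun s => by
    rw [← integral_const_mul]; congr 1; ext z; ring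
  have e2 : ∀ s, ∫ z, f (s, z) * (deriv χ s * φ (s, z)) ∂phaseMeasure Ω
      = deriv χ s * ∫ z, f (s, z) * φ (s, z) ∂phaseMeasure Ω := fun s => by
    rw [← integral_const_mul]; congr 1; ext z; ring
  have e3 : ∀ s, ∫ z, g (s, z) * (χ s * φ (s, z)) * flux Ω z ∂boundaryMeasure Ω
      = χ s * ∫ z, g (s, z) * φ (s, z) * flux Ω z ∂boundaryMeasure Ω := fun s => by
    rw [← integral_const_mul]; congr 1; ext z; ring
  have i1 := hTi1.integral_prod_left
  have i3 := hbi.integral_prod_left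
  simp only [e0, e1, e2, e3] at h1 i1 i3
  simp only [pairingRate, mul_sub]
  rw [integral_sub i1 i3]
  linarith

lemma continuous_integral_slice {Ω : Set R3} {ω : R3 → ℝ} (hω : Continuous ω) {φ : Z → ℝ}
    (hφ : Continuous φ) (hφc : HasCompactSupport φ) :
    Continuous fun t => ∫ z, ω z.2 * |φ (t, z)| ∂phaseMeasure Ω := by
  have hK : IsCompact (Prod.snd '' tsupport φ) := hφc.isCompact.image continuous_snd
  have h1 := continuous_parametric_integral_of_continuous (μ := phaseMeasure Ω)
    (f := fun (t : ℝ) (z : R3 × R3) => ω z.2 * |φ (t, z)|) (by fun_prop) hK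
  refine h1.congr fun t => setIntegral_eq_integral_of_forall_compl_eq_zero fun z hz => ?_
  rw [image_eq_zero_of_notMem_tsupport fun hm => hz ⟨_, hm, rfl⟩, abs_zero, mul_zero]

/-- The pairing at time `t` is bounded by the weighted `L¹` norm of the test function. -/
lemma abs_pairing_le {Ω : Set R3} (hΩ : IsBoundedC1Domain Ω) {ν : R3 → ℝ}
    (hν : Continuous ν) {ω : R3 → ℝ} (hω : Continuous ω) {ν₀ M : ℝ}
    {f₀ : R3 × R3 → ℝ} {f g φ : Z → ℝ} (hf : LocBdd f (interiorM Ω))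
    (hfM : ∀ z, |f z| ≤ M * decay ν₀ ω z)
    (hg : LocBdd g (boundaryM Ω)) (h : IsSpacetimeSolution Ω ν f₀ f g) (hφ : ContDiff ℝ 1 φ)
    (hφc : HasCompactSupport φ) {t : ℝ} (ht : 0 ≤ t) :
    |pairing Ω ν f₀ f g φ t|
      ≤ M * Real.exp (-ν₀ * t) * ∫ z, ω z.2 * |φ (t, z)| ∂phaseMeasure Ω := by
  have hω2 : Continuous fun z : R3 × R3 => ω z.2 := by fun_prop
  set B : ℝ → ℝ := fun t => M * Real.exp (-ν₀ * t) * ∫ z, ω z.2 * |φ (t, z)| ∂phaseMeasure Ω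
  have hB : Continuous B := (by fun_prop : Continuous fun t : ℝ => M * Real.exp (-ν₀ * t)).mul
    (continuous_integral_slice hω hφ.continuous hφc)
  have hP : ContinuousOn (pairing Ω ν f₀ f g φ) (Ici 0) := by
    have hi := (integrableOn_pairingRate hΩ hν hf hg hφ hφc).integrable_indicator measurableSet_Ici
    have h1 : Continuous fun t => ∫ s in (0 : ℝ)..t,
        (Ici (0 : ℝ)).indicator (pairingRate Ω ν f g φ) s :=
      intervalIntegral.continuous_primitive (fun _ _ => hi.intervalIntegrable) 0
    refine ((continuous_const (y := ∫ z, f₀ z * φ (0, z) ∂phaseMeasure Ω)).add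
      h1).continuousOn.congr fun s hs => ?_
    simp only [pairing, Pi.add_apply]
    congr 1
    refine intervalIntegral.integral_congr fun r hr => ?_
    rw [uIcc_of_le hs] at hr
    exact (indicator_of_mem (show r ∈ Ici (0 : ℝ) from hr.1) _).symm
  -- The inequality is known for almost every time. Written as an equality of two continuous
  -- functions on `[0, ∞)`, it extends to all times.
  have hae : (fun s => max |pairing Ω ν f₀ f g φ s| (B s)) =ᵐ[volume.restrict (Ici 0)] B := by
    filter_upwards [ae_eq_pairing hΩ hν hf hg h hφ hφc] with s hs
    refine max_eq_right ?_
    rw [← hs]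
    simp only [B]
    rw [← integral_const_mul]
    refine abs_integral_le_integral_abs.trans (integral_mono_of_nonneg
      (Eventually.of_forall fun _ => abs_nonneg _)
      ((hω2.locBdd.integrable_mul (continuous_slice hφ.continuous s).abs
        (hasCompactSupport_slice hφc s).abs).const_mul _) (Eventually.of_forall fun z => ?_))
    simp only [abs_mul]
    have := mul_le_mul_of_nonneg_right (hfM (s, z)) (abs_nonneg (φ (s, z)))
    refine this.trans (le_of_eq ?_)
    simp only [decay]; ring
  have heq := Measure.eqOn_of_ae_eq hae (ContinuousOn.sup hP.abs hB.continuousOn) hB.continuousOn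
    (by rw [interior_Ici, closure_Ioi])
  exact (le_max_left _ _).trans (heq ht).le

/-- The slice of a space-time solution at every time. -/
lemma exists_slice {Ω : Set R3} (hΩ : IsBoundedC1Domain Ω) {ν : R3 → ℝ}
    (hν : Continuous ν) {ω : R3 → ℝ} (hω : Continuous ω) (hω0 : ∀ v, 0 < ω v) {ν₀ M : ℝ}
    (hM : 0 ≤ M) {f₀ : R3 × R3 → ℝ} (hf₀ : LocBdd f₀ (phaseMeasure Ω)) {f g : Z → ℝ}
    (hf : LocBdd f (interiorM Ω)) (hfM : ∀ z, |f z| ≤ M * decay ν₀ ω z)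
    (hg : LocBdd g (boundaryM Ω)) (h : IsSpacetimeSolution Ω ν f₀ f g) {t : ℝ} (ht : 0 ≤ t) :
    ∃ u : R3 × R3 → ℝ, Measurable u ∧ (∀ z, |u z| ≤ M * Real.exp (-ν₀ * t) * ω z.2) ∧
      ∀ φ : Z → ℝ, ContDiff ℝ 1 φ → HasCompactSupport φ →
        ∫ z, u z * φ (t, z) ∂phaseMeasure Ω = pairing Ω ν f₀ f g φ t := by
  have := hΩ.sigmaFinite_boundaryMeasure
  have hω2 : Continuous fun z : R3 × R3 => ω z.2 := by fun_prop
  have hi0 : ∀ φ : testSpace, Integrable (fun z => f₀ z * φ.1 (0, z)) (phaseMeasure Ω) := fun φ =>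
    hf₀.integrable_mul (continuous_slice φ.2.1.continuous 0) (hasCompactSupport_slice φ.2.2 0)
  have hadd : ∀ φ ψ : testSpace, pairing Ω ν f₀ f g (φ + ψ).1 t
      = pairing Ω ν f₀ f g φ.1 t + pairing Ω ν f₀ f g ψ.1 t := by
    intro φ ψ
    -- Additivity of the rate needs integrable slices, which Fubini provides only for almost every
    -- time. This suffices, since the rate appears under a time integral.
    have hr : ∀ᵐ s ∂volume.restrict (Ici (0 : ℝ)), pairingRate Ω ν f g (φ + ψ).1 s
        = pairingRate Ω ν f g φ.1 s + pairingRate Ω ν f g ψ.1 s := by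
      filter_upwards [(hf.integrable_mul (continuous_adjointT hν φ.2.1)
          (hasCompactSupport_adjointT φ.2.2)).prod_right_ae,
        (hf.integrable_mul (continuous_adjointT hν ψ.2.1)
          (hasCompactSupport_adjointT ψ.2.2)).prod_right_ae,
        (integrable_mul_mul_flux hΩ hg φ.2.1.continuous φ.2.2).prod_right_ae,
        (integrable_mul_mul_flux hΩ hg ψ.2.1.continuous ψ.2.2).prod_right_ae] with s h1 h2 h3 h4
      simp only [pairingRate]
      have e1 : ∀ z, f (s, z) * adjointT ν (φ + ψ).1 (s, z)
          = f (s, z) * adjointT ν φ.1 (s, z) + f (s, z) * adjointT ν ψ.1 (s, z) := fun z => by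
        simp only [adjointT, Submodule.coe_add, transportDeriv_add φ.2.1 ψ.2.1, Pi.add_apply]
        ring
      have e2 : ∀ z, g (s, z) * (φ + ψ).1 (s, z) * flux Ω z
          = g (s, z) * φ.1 (s, z) * flux Ω z + g (s, z) * ψ.1 (s, z) * flux Ω z := fun z => by
        simp only [Submodule.coe_add, Pi.add_apply]
        ring
      simp only [e1, e2]
      rw [integral_add h1 h2, integral_add h3 h4]
      ring
    have hi := fun φ : testSpace => integrableOn_pairingRate hΩ hν hf hg φ.2.1 φ.2.2
    have hii : ∀ φ : testSpace, IntervalIntegrable (pairingRate Ω ν f g φ.1) volume 0 t :=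
      fun φ => (intervalIntegrable_iff_integrableOn_Ioc_of_le ht).2
        ((hi φ).mono_set (Ioc_subset_Icc_self.trans Icc_subset_Ici_self))
    have e3 : ∫ s in (0 : ℝ)..t, pairingRate Ω ν f g (φ + ψ).1 s
        = ∫ s in (0 : ℝ)..t, (pairingRate Ω ν f g φ.1 s + pairingRate Ω ν f g ψ.1 s) := by
      refine intervalIntegral.integral_congr_ae ?_
      rw [ae_restrict_iff' measurableSet_Ici] at hr
      filter_upwards [hr] with s hs hs1
      rw [uIoc_of_le ht] at hs1
      exact hs hs1.1.le
    simp only [pairing]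
    rw [e3, intervalIntegral.integral_add (hii φ) (hii ψ)]
    have e4 : ∫ z, f₀ z * (φ + ψ).1 (0, z) ∂phaseMeasure Ω
        = ∫ z, f₀ z * φ.1 (0, z) ∂phaseMeasure Ω + ∫ z, f₀ z * ψ.1 (0, z) ∂phaseMeasure Ω := by
      rw [← integral_add (hi0 φ) (hi0 ψ)]
      simp only [Submodule.coe_add, Pi.add_apply, mul_add]
    rw [e4]; ring
  have hsmul : ∀ (c : ℝ) (φ : testSpace), pairing Ω ν f₀ f g (c • φ).1 t
      = c * pairing Ω ν f₀ f g φ.1 t := by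
    intro c φ
    have hr : ∀ s, pairingRate Ω ν f g (c • φ).1 s = c * pairingRate Ω ν f g φ.1 s := by
      intro s
      simp only [pairingRate, mul_sub]
      rw [← integral_const_mul, ← integral_const_mul]
      congr 1
      · congr 1; ext z
        simp only [adjointT, Submodule.coe_smul, transportDeriv_smul φ.2.1, Pi.smul_apply,
          smul_eq_mul]
        ring
      · congr 1; ext z
        simp only [Submodule.coe_smul, Pi.smul_apply, smul_eq_mul]
        ring
    simp only [pairing, hr]
    rw [intervalIntegral.integral_const_mul, mul_add, ← integral_const_mul]
    congr 2; ext z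
    simp only [Submodule.coe_smul, Pi.smul_apply, smul_eq_mul]
    ring
  let l : testSpace →ₗ[ℝ] ℝ :=
    { toFun := fun φ => pairing Ω ν f₀ f g φ.1 t
      map_add' := hadd
      map_smul' := hsmul }
  let J : testSpace →ₗ[ℝ] (R3 × R3 → ℝ) :=
    { toFun := fun φ z => ω z.2 * φ.1 (t, z)
      map_add' := fun φ ψ => by
        ext z; simp only [Submodule.coe_add, Pi.add_apply, mul_add]
      map_smul' := fun c φ => by
        ext z; simp only [Submodule.coe_smul, Pi.smul_apply, smul_eq_mul, RingHom.id_apply]; ring }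
  -- The pairing at time `t` is a functional dominated by the weighted `L¹` norm of `φ(t)`. The
  -- representation theorem thus gives a slice at this very time, with the decaying bound built in.
  obtain ⟨F, hFm, hFM, hF⟩ := exists_repr (μ := phaseMeasure Ω) J
    (fun φ => hω2.locBdd.integrable_mul (continuous_slice φ.2.1.continuous t)
      (hasCompactSupport_slice φ.2.2 t)) l (mul_nonneg hM (Real.exp_pos (-ν₀ * t)).le)
    (fun φ => by
      refine (abs_pairing_le hΩ hν hω hf hfM hg h φ.2.1 φ.2.2 ht).trans (le_of_eq ?_)
      congr 2; ext z
      change ω z.2 * |φ.1 (t, z)| = |ω z.2 * φ.1 (t, z)|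
      rw [abs_mul, abs_of_pos (hω0 _)])
  refine ⟨fun z => F z * ω z.2, hFm.mul hω2.measurable, fun z => ?_, fun φ hφ hφc => ?_⟩
  · rw [abs_mul, abs_of_pos (hω0 _)]
    exact mul_le_mul_of_nonneg_right (hFM z) (hω0 _).le
  · have h1 : pairing Ω ν f₀ f g φ t = ∫ z, F z * (ω z.2 * φ (t, z)) ∂phaseMeasure Ω :=
      hF ⟨φ, hφ, hφc⟩
    rw [h1]
    congr 1; ext z; ring

/-- There is a countable family of test functions whose time slices determine all functions
dominated by a given weight. -/
lemma exists_countable_determining (Ω : Set R3) {ω : R3 → ℝ} (hω : Continuous ω)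
    (hω0 : ∀ v, 0 < ω v) :
    ∃ S : Set (Z → ℝ), S.Countable ∧ (∀ φ ∈ S, ContDiff ℝ 1 φ ∧ HasCompactSupport φ) ∧
      ∀ (s C : ℝ) (u : R3 × R3 → ℝ), AEStronglyMeasurable u (phaseMeasure Ω) →
        (∀ z, |u z| ≤ C * ω z.2) → (∀ φ ∈ S, ∫ z, u z * φ (s, z) ∂phaseMeasure Ω = 0) →
        u =ᵐ[phaseMeasure Ω] 0 := by
  have hω2 : Continuous fun z : R3 × R3 => ω z.2 := by fun_prop
  let T : Type := {θ : R3 × R3 → ℝ // ContDiff ℝ 1 θ ∧ HasCompactSupport θ}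
  have hi : ∀ θ : T, Integrable (fun z => ω z.2 * θ.1 z) (phaseMeasure Ω) := fun θ =>
    hω2.locBdd.integrable_mul θ.2.1.continuous θ.2.2
  let E : T → Lp ℝ 1 (phaseMeasure Ω) := fun θ => (hi θ).toL1
  have : SecondCountableTopology (Lp ℝ 1 (phaseMeasure Ω)) := by
    have : Fact ((1 : ℝ≥0∞) ≠ ∞) := ⟨ENNReal.one_ne_top⟩
    infer_instance
  -- Separability of `L¹` gives countably many spatial test functions that are dense in the
  -- `ω`-weighted norm, the norm for which pairing with functions dominated by `ω` is continuous.
  obtain ⟨D, hDc, hDd⟩ := TopologicalSpace.exists_countable_dense (range E)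
  have hD : ∀ d : range E, ∃ θ : T, E θ = d := fun d => d.2
  choose pick hpick using hD
  -- The time cutoff equals `1` on `[-(n+1), n+1]`, so for every time `s` some member of the family
  -- restricts to the given spatial function.
  let cut : ℕ → ContDiffBump (0 : ℝ) := fun n => ⟨n + 1, n + 2, by positivity, by linarith⟩
  refine ⟨⋃ n : ℕ, (fun d => fun z : Z => cut n z.1 * (pick d).1 z.2) '' D,
    countable_iUnion fun n => hDc.image _, ?_, ?_⟩
  · rintro φ hφ
    obtain ⟨n, d, hd, rfl⟩ := mem_iUnion.1 hφ
    refine ⟨((cut n).contDiff.comp contDiff_fst).mul ((pick d).2.1.comp contDiff_snd), ?_⟩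
    refine HasCompactSupport.intro ((cut n).hasCompactSupport.isCompact.prod
      (pick d).2.2.isCompact) fun z hz => ?_
    rcases not_and_or.1 hz with h | h
    · simp only [image_eq_zero_of_notMem_tsupport h, zero_mul]
    · simp only [image_eq_zero_of_notMem_tsupport h, mul_zero]
  · intro s C u hu hC h0
    have hul : LocBdd u (phaseMeasure Ω) :=
      locBdd_of_le hu (hω2.locBdd.const_mul C) (Eventually.of_forall hC)
    have hC0 : 0 ≤ C := by
      have := (abs_nonneg _).trans (hC 0)
      exact nonneg_of_mul_nonneg_left this (hω0 _)
    have hzero : ∀ d ∈ D, ∫ z, u z * (pick d).1 z ∂phaseMeasure Ω = 0 := by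
      intro d hd
      obtain ⟨n, hn⟩ := exists_nat_ge |s|
      have h1 := h0 _ (mem_iUnion.2 ⟨n, d, hd, rfl⟩)
      have h2 : cut n s = 1 := (cut n).one_of_mem_closedBall (by
        rw [mem_closedBall_zero_iff, Real.norm_eq_abs]
        change |s| ≤ n + 1
        linarith)
      simpa only [h2, one_mul] using h1
    have hui : ∀ θ : T, Integrable (fun z => u z * θ.1 z) (phaseMeasure Ω) := fun θ =>
      hul.integrable_mul θ.2.1.continuous θ.2.2
    have hall : ∀ θ : T, ∫ z, u z * θ.1 z ∂phaseMeasure Ω = 0 := by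
      intro θ
      rw [← abs_eq_zero]
      refine le_antisymm (le_of_forall_pos_le_add fun ε hε => ?_) (abs_nonneg _)
      obtain ⟨d, hd, hdD⟩ := (hDd.exists_dist_lt (⟨E θ, θ, rfl⟩ : range E)
        (show 0 < ε / (C + 1) by positivity))
      have h1 : ∫ z, |ω z.2 * θ.1 z - ω z.2 * (pick d).1 z| ∂phaseMeasure Ω < ε / (C + 1) := by
        have h2 : dist (E θ) (E (pick d)) < ε / (C + 1) := by
          rw [hpick d]; exact hdD
        rw [dist_eq_norm, ← Integrable.toL1_sub _ _ (hi θ) (hi (pick d)),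
          L1.norm_of_fun_eq_integral_norm] at h2
        exact h2
      have h3 : ∫ z, u z * θ.1 z ∂phaseMeasure Ω
          = ∫ z, (u z * θ.1 z - u z * (pick d).1 z) ∂phaseMeasure Ω := by
        rw [integral_sub (hui θ) (hui _), hzero d hd, sub_zero]
      rw [h3]
      refine abs_integral_le_integral_abs.trans ?_
      have h4 : ∫ z, |u z * θ.1 z - u z * (pick d).1 z| ∂phaseMeasure Ω
          ≤ C * ∫ z, |ω z.2 * θ.1 z - ω z.2 * (pick d).1 z| ∂phaseMeasure Ω := by
        rw [← integral_const_mul]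
        refine integral_mono_of_nonneg (Eventually.of_forall fun _ => abs_nonneg _)
          (((hi θ).sub (hi _)).abs.const_mul C) (Eventually.of_forall fun z => ?_)
        simp only [← mul_sub, abs_mul, abs_of_pos (hω0 _)]
        rw [← mul_assoc]
        exact mul_le_mul_of_nonneg_right (hC z) (abs_nonneg _)
      have h5 : C * (ε / (C + 1)) ≤ ε := by
        rw [mul_div_assoc', div_le_iff₀ (by positivity)]
        nlinarith
      have h6 := mul_le_mul_of_nonneg_left h1.le hC0
      linarith
    refine ae_eq_zero_of_integral_contDiff_smul_eq_zero hul.locallyIntegrable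
      fun θ hθ hθc => ?_
    rw [← hall ⟨θ, hθ.of_le (by exact_mod_cast le_top), hθc⟩]
    congr 1; ext z; simp only [smul_eq_mul]; ring

/-- Existence of a weak solution with trace, symmetric under reflection and decaying in time. -/
theorem exists_weakSolution {Ω : Set R3} (hΩ : IsBoundedC1Domain Ω) {ν : R3 → ℝ}
    (hν : Continuous ν) {ν₀ : ℝ} (hν₀ : 0 ≤ ν₀) (hle : ∀ v, ν₀ ≤ ν v) {ω : R3 → ℝ}
    (hω : Continuous ω) (hω0 : ∀ v, 0 < ω v) (hωr : ∀ v w, ‖v‖ = ‖w‖ → ω v = ω w)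
    {f₀ : R3 × R3 → ℝ} (hf₀ : AEStronglyMeasurable f₀ (phaseMeasure Ω)) {M : ℝ} (hM : 0 ≤ M)
    (hf₀M : ∀ᵐ z ∂phaseMeasure Ω, |f₀ z| ≤ M * ω z.2) :
    ∃ f g : ℝ → R3 × R3 → ℝ, AEStronglyMeasurable (Function.uncurry f) (interiorM Ω) ∧
      (∀ t, 0 ≤ t → Measurable (f t)) ∧
      (∀ t, 0 ≤ t → ∀ z, |f t z| ≤ M * Real.exp (-ν₀ * t) * ω z.2) ∧
      Measurable (Function.uncurry g) ∧
      (∀ t z, |g t z| ≤ M * Real.exp (-ν₀ * t) * ω z.2) ∧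
      (∀ t z, g t (bounce hΩ z) = g t z) ∧ IsWeakSolutionWithTrace Ω ν f₀ f g := by
  have := hΩ.sigmaFinite_boundaryMeasure
  have hω2 : Continuous fun z : R3 × R3 => ω z.2 := by fun_prop
  have hq := continuous_decay ν₀ hω
  obtain ⟨f, g, hfm, hgm, hfM, hgM, hgs, hsol⟩ :=
    exists_spacetime_solution hΩ hν hν₀ hle hω hω0 hωr hf₀ hM hf₀M
  have hsol : IsSpacetimeSolution Ω ν f₀ f g := hsol
  have hf₀l : LocBdd f₀ (phaseMeasure Ω) := locBdd_of_le hf₀ (hω2.locBdd.const_mul M) hf₀M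
  have hf : LocBdd f (interiorM Ω) := locBdd_of_le hfm.aestronglyMeasurable
    (hq.locBdd.const_mul M) (Eventually.of_forall hfM)
  have hg : LocBdd g (boundaryM Ω) := locBdd_of_le hgm.aestronglyMeasurable
    (hq.locBdd.const_mul M) (Eventually.of_forall hgM)
  have hfs : ∀ t z, |f (t, z)| ≤ M * Real.exp (-ν₀ * t) * ω z.2 := fun t z => by
    have := hfM (t, z); rwa [decay, ← mul_assoc] at this
  have hslice := fun (t : ℝ) (ht : 0 ≤ t) => exists_slice hΩ hν hω hω0 hM hf₀l hf hfM hg hsol ht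
  choose! u hum huM hu using hslice
  -- A countable family leaves a single null set of exceptional times, off which `f (t, ·)` agrees
  -- with the slice `u t`.
  obtain ⟨S, hSc, hS, hdet⟩ := exists_countable_determining Ω hω hω0
  have hgood : ∀ᵐ t ∂volume.restrict (Ici (0 : ℝ)),
      (fun z => f (t, z)) =ᵐ[phaseMeasure Ω] u t := by
    have h1 : ∀ᵐ t ∂volume.restrict (Ici (0 : ℝ)), ∀ φ ∈ S,
        ∫ z, f (t, z) * φ (t, z) ∂phaseMeasure Ω = pairing Ω ν f₀ f g φ t :=
      (ae_ball_iff hSc).2 fun φ hφ => ae_eq_pairing hΩ hν hf hg hsol (hS φ hφ).1 (hS φ hφ).2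
    filter_upwards [h1, ae_restrict_mem measurableSet_Ici] with t ht ht0
    have hfsm : Measurable fun z => f (t, z) := hfm.comp measurable_prodMk_left
    have hl1 : LocBdd (fun z => f (t, z)) (phaseMeasure Ω) :=
      locBdd_of_le hfsm.aestronglyMeasurable (hω2.locBdd.const_mul _)
        (Eventually.of_forall (hfs t))
    have hl2 : LocBdd (u t) (phaseMeasure Ω) :=
      locBdd_of_le (hum t ht0).aestronglyMeasurable (hω2.locBdd.const_mul _)
        (Eventually.of_forall (huM t ht0))
    have h2 := hdet t (2 * (M * Real.exp (-ν₀ * t))) (fun z => f (t, z) - u t z)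
      (hl1.aesm.sub hl2.aesm) (fun z => by
        have := hfs t z; have := huM t ht0 z; have := abs_sub (f (t, z)) (u t z)
        linarith) (fun φ hφ => by
        have c1 := continuous_slice (hS φ hφ).1.continuous t
        have c2 := hasCompactSupport_slice (hS φ hφ).2 t
        simp only [sub_mul]
        rw [integral_sub (hl1.integrable_mul c1 c2) (hl2.integrable_mul c1 c2), ht φ hφ,
          hu t ht0 φ (hS φ hφ).1 (hS φ hφ).2, sub_self])
    filter_upwards [h2] with z hz
    have : f (t, z) - u t z = 0 := hz
    linarith
  classical
  -- Keeping `f` at good times preserves joint measurability, which a family of slices chosen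
  -- separately would not have. Using `u t` at the others gives the weak identity at every time.
  set F : ℝ → R3 × R3 → ℝ := fun t z =>
    if (fun z => f (t, z)) =ᵐ[phaseMeasure Ω] u t then f (t, z) else u t z with hF
  have hFf : ∀ᵐ t ∂volume.restrict (Ici (0 : ℝ)), ∀ z, F t z = f (t, z) := by
    filter_upwards [hgood] with t ht z
    rw [hF]; exact if_pos ht
  have hFu : ∀ t, F t =ᵐ[phaseMeasure Ω] u t := by
    intro t
    by_cases h : (fun z => f (t, z)) =ᵐ[phaseMeasure Ω] u t
    · filter_upwards [h] with z hz
      simp only [hF, if_pos h]; exact hz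
    · exact Eventually.of_forall fun z => by simp only [hF, if_neg h]
  refine ⟨F, fun t z => g (t, z), ?_, fun t ht => ?_, fun t ht z => ?_, hgm, fun t z => ?_,
    fun t z => hgs (t, z), ?_⟩
  · refine hfm.aestronglyMeasurable.congr ?_
    have h1 : ∀ᵐ p ∂interiorM Ω, ∀ z, F p.1 z = f (p.1, z) :=
      Measure.quasiMeasurePreserving_fst.ae hFf
    filter_upwards [h1] with p hp
    exact (hp p.2).symm
  · by_cases h : (fun z => f (t, z)) =ᵐ[phaseMeasure Ω] u t
    · simp only [hF, if_pos h]; exact hfm.comp measurable_prodMk_left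
    · simp only [hF, if_neg h]; exact hum t ht
  · simp only [hF]
    split_ifs
    · exact hfs t z
    · exact huM t ht z
  · have := hgM (t, z); rwa [decay, ← mul_assoc] at this
  · intro φ hφ hφc t ht
    have h1 : ∫ z, F t z * φ (t, z) ∂phaseMeasure Ω = pairing Ω ν f₀ f g φ t := by
      rw [← hu t ht φ hφ hφc]
      refine integral_congr_ae ?_
      filter_upwards [hFu t] with z hz
      rw [hz]
    have hii : ∀ w : ℝ → ℝ, IntegrableOn w (Ici 0) → IntervalIntegrable w volume 0 t :=
      fun w hw => (intervalIntegrable_iff_integrableOn_Ioc_of_le ht).2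
        (hw.mono_set (Ioc_subset_Icc_self.trans Icc_subset_Ici_self))
    have h2 : ∫ s in (0 : ℝ)..t, ∫ z, F s z * (transportDeriv φ (s, z) - ν z.2 * φ (s, z))
          ∂phaseMeasure Ω
        = ∫ s in (0 : ℝ)..t, ∫ z, f (s, z) * adjointT ν φ (s, z) ∂phaseMeasure Ω := by
      refine intervalIntegral.integral_congr_ae ?_
      rw [ae_restrict_iff' measurableSet_Ici] at hFf
      filter_upwards [hFf] with s hs hs1
      rw [uIoc_of_le ht] at hs1
      simp only [hs hs1.1.le]
      rfl
    rw [h1, h2, pairing, add_sub_cancel_left]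
    simp only [pairingRate]
    rw [intervalIntegral.integral_sub]
    · rfl
    · exact hii _ (hf.integrable_mul (continuous_adjointT hν hφ)
        (hasCompactSupport_adjointT hφc)).integral_prod_left
    · exact hii _ (integrable_mul_mul_flux hΩ hg hφ.continuous hφc).integral_prod_left

/-! ### Mollification -/

lemma fderiv_space {k : Z → ℝ} (hk : ContDiff ℝ 1 k) (u : Z) (ξ : R3) :
    fderiv ℝ k u (0, ξ, 0) = fderiv ℝ (fun x : R3 => k (u.1, x, u.2.2)) u.2.1 ξ := by
  have h1 : HasFDerivAt (fun x : R3 => ((u.1, x, u.2.2) : Z))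
      ((0 : R3 →L[ℝ] ℝ).prod ((ContinuousLinearMap.id ℝ R3).prod 0)) u.2.1 :=
    (hasFDerivAt_const _ _).prodMk ((hasFDerivAt_id u.2.1).prodMk (hasFDerivAt_const _ _))
  have h2 := ((hk.differentiable one_ne_zero (u.1, u.2.1, u.2.2)).hasFDerivAt.comp u.2.1 h1).fderiv
  have h3 : (fun x : R3 => k (u.1, x, u.2.2)) = k ∘ fun x : R3 => ((u.1, x, u.2.2) : Z) := rfl
  rw [h3, h2]
  simp

/-- Mollifying kernels that look backwards in time, in the direction `a` in space, and that are
much more concentrated in velocity than in space. -/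
lemma exists_kernel (a : R3) {δ : ℝ} (hδ : 0 < δ) :
    ∃ ε ∈ Ioo 0 δ, ∃ k : Z → ℝ, ContDiff ℝ 1 k ∧ HasCompactSupport k ∧ (∀ u, 0 ≤ k u) ∧
      ∫ u, k u = 1 ∧ (∀ u, k u ≠ 0 → 0 < u.1 ∧ u.2.1 ∈ Metric.ball (ε • a) ε ∧ ‖u‖ ≤ δ) ∧
      ∫ u, |fderiv ℝ k u (0, u.2.2, 0)| ≤ δ := by
  -- The kernel is supported in times `(ε, 3ε)` and positions of norm below `ε(‖a‖ + 1)`, with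
  -- velocities below `η ≤ ε`. All of these are at most `δ`.
  set ε := δ / (‖a‖ + 4) with hε
  have ha : 0 < ‖a‖ + 4 := by positivity
  have hε0 : 0 < ε := by positivity
  have hεa : ε * (‖a‖ + 4) = δ := by rw [hε]; field_simp
  have hεn : 0 ≤ ε * ‖a‖ := by positivity
  let A : ContDiffBump (2 * ε : ℝ) := ⟨ε / 2, ε, by positivity, by linarith⟩
  let B : ContDiffBump (ε • a : R3) := ⟨ε / 2, ε, by positivity, by linarith⟩
  set α := A.normed volume with hα
  set β := B.normed volume with hβ
  have hα1 : ContDiff ℝ 1 α := A.contDiff_normed (n := 1)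
  have hβ1 : ContDiff ℝ 1 β := B.contDiff_normed (n := 1)
  have hβc : HasCompactSupport β := B.hasCompactSupport_normed
  set I := ∫ x, ‖fderiv ℝ β x‖ with hI
  have hI0 : 0 ≤ I := integral_nonneg fun _ => norm_nonneg _
  set η := ε / (I + 1) with hη
  have hη0 : 0 < η := by positivity
  have hηε : η ≤ ε := div_le_self hε0.le (by linarith)
  have hηI : η * I ≤ ε := by
    rw [hη, div_mul_eq_mul_div, div_le_iff₀ (by positivity)]
    nlinarith
  let G : ContDiffBump (0 : R3) := ⟨η / 2, η, by positivity, by linarith⟩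
  set γ := G.normed volume with hγ
  have hγ1 : ContDiff ℝ 1 γ := G.contDiff_normed (n := 1)
  have hγs : ∀ v, γ v ≠ 0 → ‖v‖ < η := fun v hv => by
    have : v ∈ Function.support γ := hv
    rw [hγ, G.support_normed_eq] at this
    simpa using this
  have hβs : ∀ x, β x ≠ 0 → x ∈ Metric.ball (ε • a) ε := fun v hv => by
    have : v ∈ Function.support β := hv
    rwa [hβ, B.support_normed_eq] at this
  have hαs : ∀ t, α t ≠ 0 → |t - 2 * ε| < ε := fun t ht => by
    have : t ∈ Function.support α := ht
    rw [hα, A.support_normed_eq] at this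
    exact this
  set k : Z → ℝ := fun u => α u.1 * (β u.2.1 * γ u.2.2) with hk
  have hk1 : ContDiff ℝ 1 k := by
    have e1 : ContDiff ℝ 1 fun u : Z => α u.1 := hα1.comp contDiff_fst
    have e2 : ContDiff ℝ 1 fun u : Z => β u.2.1 := hβ1.comp (contDiff_fst.comp contDiff_snd)
    have e3 : ContDiff ℝ 1 fun u : Z => γ u.2.2 := hγ1.comp (contDiff_snd.comp contDiff_snd)
    exact e1.mul (e2.mul e3)
  have hks : ∀ u, k u ≠ 0 → 0 < u.1 ∧ u.2.1 ∈ Metric.ball (ε • a) ε ∧ ‖u‖ ≤ δ := by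
    intro u hu
    have h1 := left_ne_zero_of_mul hu
    have h2 := left_ne_zero_of_mul (right_ne_zero_of_mul hu)
    have h3 := right_ne_zero_of_mul (right_ne_zero_of_mul hu)
    have h4 := abs_lt.1 (hαs _ h1)
    have h5 := hβs _ h2
    have h6 := hγs _ h3
    refine ⟨by linarith, h5, ?_⟩
    have h7 : ‖u.2.1‖ ≤ ε * (‖a‖ + 1) := by
      have := mem_ball_iff_norm.1 h5
      have h8 := norm_le_norm_add_norm_sub' u.2.1 (ε • a)
      rw [norm_smul, Real.norm_of_nonneg hε0.le] at h8
      linarith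
    simp only [Prod.norm_def]
    refine max_le ?_ (max_le ?_ ?_)
    · rw [Real.norm_eq_abs, abs_le]; constructor <;> linarith
    · linarith
    · linarith
  have hkc : HasCompactSupport k := by
    refine HasCompactSupport.intro (isCompact_closedBall (0 : Z) δ) fun u hu => ?_
    by_contra h
    exact hu (mem_closedBall_zero_iff.2 (hks u h).2.2)
  have hα0 : ∀ t, 0 ≤ α t := fun t => A.nonneg_normed t
  have hβ0 : ∀ t, 0 ≤ β t := fun t => B.nonneg_normed t
  have hγ0 : ∀ t, 0 ≤ γ t := fun t => G.nonneg_normed t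
  have hint : ∀ (p : R3 → ℝ), ∫ u : Z, α u.1 * (p u.2.1 * γ u.2.2) = ∫ x, p x := by
    intro p
    have h1 := integral_prod_mul (μ := (volume : Measure ℝ)) (ν := (volume : Measure (R3 × R3)))
      α (fun w => p w.1 * γ w.2)
    have h2 := integral_prod_mul (μ := (volume : Measure R3)) (ν := (volume : Measure R3)) p γ
    rw [hα, A.integral_normed] at h1
    rw [hγ, G.integral_normed] at h2
    rw [one_mul] at h1
    rw [mul_one] at h2
    exact h1.trans h2
  refine ⟨ε, ⟨hε0, by nlinarith⟩, k, hk1, hkc,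
    fun u => mul_nonneg (hα0 _) (mul_nonneg (hβ0 _) (hγ0 _)), ?_, hks, ?_⟩
  · rw [hint β]; exact B.integral_normed
  · have hd : ∀ u : Z, fderiv ℝ k u (0, u.2.2, 0)
        = α u.1 * (fderiv ℝ β u.2.1 u.2.2 * γ u.2.2) := by
      intro u
      rw [fderiv_space hk1]
      have h1 : (fun x : R3 => k (u.1, x, u.2.2)) = fun x => (α u.1 * γ u.2.2) * β x := by
        ext x; simp only [hk]; ring
      rw [h1, fderiv_const_mul (hβ1.differentiable one_ne_zero _)]
      simp only [_root_.smul_apply, smul_eq_mul]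
      ring
    have h2 : ∫ u : Z, |fderiv ℝ k u (0, u.2.2, 0)|
        ≤ ∫ u : Z, η * (α u.1 * (‖fderiv ℝ β u.2.1‖ * γ u.2.2)) := by
      refine integral_mono_of_nonneg (Eventually.of_forall fun _ => abs_nonneg _) ?_
        (Eventually.of_forall fun u => ?_)
      · have hc : Continuous fun u : Z => α u.1 * (‖fderiv ℝ β u.2.1‖ * γ u.2.2) := by
          have e1 : Continuous fun u : Z => α u.1 := hα1.continuous.comp continuous_fst
          have e2 : Continuous fun u : Z => ‖fderiv ℝ β u.2.1‖ :=
            ((hβ1.continuous_fderiv one_ne_zero).comp (continuous_fst.comp continuous_snd)).norm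
          have e3 : Continuous fun u : Z => γ u.2.2 :=
            hγ1.continuous.comp (continuous_snd.comp continuous_snd)
          exact e1.mul (e2.mul e3)
        refine (hc.integrable_of_hasCompactSupport ?_).const_mul η
        refine HasCompactSupport.intro (A.hasCompactSupport_normed (μ := volume)|>.isCompact.prod
          ((hβc.fderiv ℝ).isCompact.prod (G.hasCompactSupport_normed (μ := volume)).isCompact))
          fun u hu => ?_
        by_contra hne
        have h1 := left_ne_zero_of_mul hne
        have h2 := left_ne_zero_of_mul (right_ne_zero_of_mul hne)
        have h3 := right_ne_zero_of_mul (right_ne_zero_of_mul hne)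
        exact hu ⟨subset_tsupport _ h1, subset_tsupport _ (norm_ne_zero_iff.1 h2),
          subset_tsupport _ h3⟩
      · simp only [hd, abs_mul, abs_of_nonneg (hα0 _), abs_of_nonneg (hγ0 _)]
        by_cases hv : γ u.2.2 = 0
        · rw [hv]; simp
        · have h3 : |fderiv ℝ β u.2.1 u.2.2| ≤ ‖fderiv ℝ β u.2.1‖ * η :=
            ((fderiv ℝ β u.2.1).le_opNorm _).trans
              (mul_le_mul_of_nonneg_left (hγs _ hv).le (norm_nonneg _))
          have h4 := mul_le_mul_of_nonneg_left
            (mul_le_mul_of_nonneg_right h3 (hγ0 u.2.2)) (hα0 u.1)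
          refine h4.trans (le_of_eq ?_)
          ring
    rw [integral_const_mul, hint fun x => ‖fderiv ℝ β x‖] at h2
    refine h2.trans (hηI.trans ?_)
    nlinarith

instance : (volume : Measure (R3 × R3)).IsAddHaarMeasure :=
  Measure.prod.instIsAddHaarMeasure (volume : Measure R3) (volume : Measure R3)

instance : (volume : Measure Z).IsAddHaarMeasure :=
  Measure.prod.instIsAddHaarMeasure (volume : Measure ℝ) (volume : Measure (R3 × R3))

instance : (volume : Measure Z).IsNegInvariant :=
  Measure.IsAddHaarMeasure.isNegInvariant_of_regular _

/-- The convolution of `F` with the kernel `k`. -/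
noncomputable def moll (k F : Z → ℝ) (z : Z) : ℝ := ∫ y, F y * k (z - y)

lemma moll_eq_convolution (k F : Z → ℝ) :
    moll k F = convolution F k (ContinuousLinearMap.mul ℝ ℝ) volume := rfl

lemma contDiff_moll {k F : Z → ℝ} (hk : ContDiff ℝ 1 k) (hkc : HasCompactSupport k)
    (hF : LocallyIntegrable F) : ContDiff ℝ 1 (moll k F) := by
  rw [moll_eq_convolution]
  exact hkc.contDiff_convolution_right (n := 1) _ hF hk

lemma transportDeriv_moll {k F : Z → ℝ} (hk : ContDiff ℝ 1 k) (hkc : HasCompactSupport k)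
    (hF : LocallyIntegrable F) (z : Z) :
    transportDeriv (moll k F) z = ∫ y, F y * fderiv ℝ k (z - y) (1, z.2.2, 0) := by
  rw [transportDeriv, moll_eq_convolution,
    (hkc.hasFDerivAt_convolution_right (ContinuousLinearMap.mul ℝ ℝ) hF hk z).fderiv,
    convolution_precompR_apply _ hF (hkc.fderiv ℝ) (hk.continuous_fderiv one_ne_zero)]
  rfl

lemma integrable_mul_sub {k F : Z → ℝ} (hk : Continuous k) (hkc : HasCompactSupport k)
    (hF : LocallyIntegrable F) (z : Z) : Integrable fun y => F y * k (z - y) :=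
  hkc.convolutionExists_right (ContinuousLinearMap.mul ℝ ℝ) hF hk z

lemma abs_integral_mul_sub_le {k F : Z → ℝ} (hk : Continuous k) (hkc : HasCompactSupport k)
    {C : ℝ} (hC : ∀ᵐ y, |F y| ≤ C) (z : Z) : |∫ y, F y * k (z - y)| ≤ C * ∫ u, |k u| := by
  have hi : Integrable fun u => |k u| := (hk.integrable_of_hasCompactSupport hkc).abs
  rw [← integral_sub_left_eq_self (fun u => |k u|) volume z, ← integral_const_mul]
  refine abs_integral_le_integral_abs.trans (integral_mono_of_nonneg
    (Eventually.of_forall fun _ => abs_nonneg _) ((hi.comp_sub_left z).const_mul C) ?_)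
  filter_upwards [hC] with y hy
  rw [abs_mul]
  exact mul_le_mul_of_nonneg_right hy (abs_nonneg _)

lemma abs_moll_le {k F : Z → ℝ} (hk : Continuous k) (hkc : HasCompactSupport k)
    (hk0 : ∀ u, 0 ≤ k u) (hk1 : ∫ u, k u = 1) {C : ℝ} (hC : ∀ᵐ y, |F y| ≤ C) (z : Z) :
    |moll k F z| ≤ C := by
  have h := abs_integral_mul_sub_le hk hkc hC z
  simp only [abs_of_nonneg (hk0 _), hk1, mul_one] at h
  exact h

/-- Mollifications converge weakly. -/
lemma tendsto_integral_moll {k : ℕ → Z → ℝ} (hk : ∀ n, Continuous (k n))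
    (hkc : ∀ n, HasCompactSupport (k n)) (hk0 : ∀ n u, 0 ≤ k n u) (hk1 : ∀ n, ∫ u, k n u = 1)
    {δ : ℕ → ℝ} (hδ : Tendsto δ atTop (𝓝 0)) (hks : ∀ n u, k n u ≠ 0 → ‖u‖ ≤ δ n)
    {F : Z → ℝ} (hF : Integrable F) {p : Z → ℝ} (hp : Continuous p) (hpc : HasCompactSupport p) :
    Tendsto (fun n => ∫ z, moll (k n) F z * p z) atTop (𝓝 (∫ z, F z * p z)) := by
  -- By Fubini the mollified pairing is `∫ k_n G` with `G` continuous. The kernels have mass one and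
  -- shrinking support, so the limit is `G 0`.
  set G : Z → ℝ := fun u => ∫ y, F y * p (y + u) with hG
  obtain ⟨Cp, hCp⟩ := hp.bounded_above_of_compact_support hpc
  have hGc : Continuous G := by
    refine continuous_of_dominated (bound := fun y => |F y| * Cp) (fun u => ?_) (fun u => ?_) ?_ ?_
    · exact hF.aestronglyMeasurable.mul (by fun_prop : Continuous fun y => p (y + u)).aestronglyMeasurable
    · refine Eventually.of_forall fun y => ?_
      rw [norm_mul, Real.norm_eq_abs]
      exact mul_le_mul_of_nonneg_left (hCp _) (abs_nonneg _)
    · exact hF.abs.mul_const Cp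
    · exact Eventually.of_forall fun y => by fun_prop
  have hswap : ∀ n, ∫ z, moll (k n) F z * p z = ∫ u, k n u * G u := by
    intro n
    have hki := (hk n).integrable_of_hasCompactSupport (hkc n) (μ := (volume : Measure Z))
    have h1 : ∀ z, moll (k n) F z = ∫ u, F (z - u) * k n u := fun z => by
      rw [moll, ← integral_sub_left_eq_self (fun y => F y * k n (z - y)) volume z]
      simp only [sub_sub_cancel]
    have hi : Integrable (fun q : Z × Z => k n q.2 * F (q.1 - q.2)) (volume.prod volume) :=
      hki.convolution_integrand (ContinuousLinearMap.mul ℝ ℝ) hF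
    have hi2 : Integrable (fun q : Z × Z => F (q.1 - q.2) * k n q.2 * p q.1)
        (volume.prod volume) := by
      have h2 := hi.bdd_mul (c := Cp) (f := fun q : Z × Z => p q.1)
        (by fun_prop : Continuous fun q : Z × Z => p q.1).aestronglyMeasurable
        (Eventually.of_forall fun q => hCp _)
      refine h2.congr (Eventually.of_forall fun q => ?_)
      simp only; ring
    simp only [h1, ← integral_mul_const]
    rw [integral_integral_swap hi2]
    congr 1
    ext u
    rw [hG, ← integral_const_mul, ← integral_sub_right_eq_self
      (fun z => k n u * (F z * p (z + u))) u]
    congr 1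
    ext z
    rw [sub_add_cancel]; ring
  have hG0 : G 0 = ∫ z, F z * p z := by simp [hG]
  rw [← hG0]
  simp only [hswap]
  rw [Metric.tendsto_atTop]
  intro ε hε
  obtain ⟨d, hd, hdG⟩ := Metric.continuous_iff.1 hGc 0 (ε / 2) (by positivity)
  obtain ⟨N, hN⟩ := (Metric.tendsto_atTop.1 hδ) d hd
  refine ⟨N, fun n hn => ?_⟩
  have hki := (hk n).integrable_of_hasCompactSupport (hkc n) (μ := (volume : Measure Z))
  have hkG : Integrable fun u => k n u * G u :=
    ((hk n).mul hGc).integrable_of_hasCompactSupport (hkc n).mul_right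
  have h1 : (∫ u, k n u * G u) - G 0 = ∫ u, k n u * (G u - G 0) := by
    simp only [mul_sub]
    rw [integral_sub hkG (hki.mul_const _), integral_mul_const, hk1, one_mul]
  rw [Real.dist_eq, h1]
  have h2 : ∫ u, k n u * (ε / 2) = ε / 2 := by rw [integral_mul_const, hk1, one_mul]
  refine lt_of_le_of_lt (abs_integral_le_integral_abs.trans (integral_mono_of_nonneg
    (g := fun u => k n u * (ε / 2))
    (Eventually.of_forall fun _ => abs_nonneg _) (hki.mul_const _)
    (Eventually.of_forall fun u => ?_))) (h2.trans_lt (by linarith))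
  simp only [abs_mul, abs_of_nonneg (hk0 n u)]
  by_cases hu : k n u = 0
  · rw [hu]; simp
  · refine mul_le_mul_of_nonneg_left ?_ (hk0 n u)
    have h3 := hN n hn
    have h4 := hks n u hu
    rw [Real.dist_eq, sub_zero] at h3
    have h5 := hdG u (by
      rw [dist_zero_right]
      exact lt_of_le_of_lt (h4.trans (le_abs_self _)) h3)
    rw [Real.dist_eq] at h5
    exact h5.le

/-- Bounded sequences that converge weakly against smooth functions times `w` also converge
against bounded functions times `w`. -/
lemma tendsto_integral_of_smooth {μ : Measure Z} {w : Z → ℝ} (hw : Integrable w μ)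
    {h : ℕ → Z → ℝ} {h' q : Z → ℝ} {C : ℝ} (hm : ∀ n, AEStronglyMeasurable (h n) μ)
    (hm' : AEStronglyMeasurable h' μ) (hC : ∀ n, ∀ᵐ z ∂μ, w z ≠ 0 → |h n z| ≤ C)
    (hC' : ∀ᵐ z ∂μ, w z ≠ 0 → |h' z| ≤ C) (hq : AEStronglyMeasurable q μ)
    (hqC : ∀ᵐ z ∂μ, w z ≠ 0 → |q z| ≤ C)
    (hlim : ∀ p : Z → ℝ, ContDiff ℝ 1 p → HasCompactSupport p →
      Tendsto (fun n => ∫ z, h n z * (p z * w z) ∂μ) atTop (𝓝 (∫ z, h' z * (p z * w z) ∂μ))) :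
    Tendsto (fun n => ∫ z, h n z * (q z * w z) ∂μ) atTop (𝓝 (∫ z, h' z * (q z * w z) ∂μ)) := by
  have hbdd : ∀ (s : Z → ℝ), AEStronglyMeasurable s μ → (∀ᵐ z ∂μ, w z ≠ 0 → |s z| ≤ C) →
      ∀ v : Z → ℝ, Integrable (fun z => v z * w z) μ → Integrable (fun z => s z * (v z * w z)) μ ∧
        |∫ z, s z * (v z * w z) ∂μ| ≤ |C| * ∫ z, |v z * w z| ∂μ := by
    intro s hs hsC v hv
    have hle : ∀ᵐ z ∂μ, |s z * (v z * w z)| ≤ |C| * |v z * w z| := by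
      filter_upwards [hsC] with z hz
      by_cases h0 : w z = 0
      · simp [h0]
      · rw [abs_mul]
        exact mul_le_mul_of_nonneg_right ((hz h0).trans (le_abs_self _)) (abs_nonneg _)
    refine ⟨(hv.abs.const_mul |C|).mono' (hs.mul hv.aestronglyMeasurable) hle, ?_⟩
    rw [← integral_const_mul]
    exact abs_integral_le_integral_abs.trans (integral_mono_of_nonneg
      (Eventually.of_forall fun _ => abs_nonneg _) (hv.abs.const_mul |C|) hle)
  have hqw : Integrable (fun z => q z * w z) μ := by
    refine (hw.abs.const_mul |C|).mono' (hq.mul hw.aestronglyMeasurable) ?_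
    filter_upwards [hqC] with z hz
    by_cases h0 : w z = 0
    · simp [h0]
    · rw [norm_mul, Real.norm_eq_abs, Real.norm_eq_abs]
      exact mul_le_mul_of_nonneg_right ((hz h0).trans (le_abs_self _)) (abs_nonneg _)
  have happrox : ∀ ε : ℝ, 0 < ε → ∃ p : Z → ℝ, ContDiff ℝ 1 p ∧ HasCompactSupport p ∧
      Integrable (fun z => p z * w z) μ ∧ ∫ z, |(q z - p z) * w z| ∂μ ≤ ε := by
    intro ε hε
    -- Smooth functions are dense in `L¹(|w| μ)`, and `q` belongs to this space. The uniform bound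
    -- on the sequence controls the error of the replacement.
    set l := μ.withDensity fun z => ‖w z‖ₑ with hl
    have hfin : IsFiniteMeasure l := isFiniteMeasure_withDensity hw.hasFiniteIntegral.ne
    have hwm : AEMeasurable (fun z => ‖w z‖ₑ) μ := hw.aestronglyMeasurable.enorm
    have hac : l ≪ μ := withDensity_absolutelyContinuous _ _
    have hql : MemLp q 1 l := by
      refine MemLp.of_bound (hq.mono_ac hac) C ?_
      rw [hl, ae_withDensity_iff_ae_restrict' hwm]
      rw [ae_restrict_iff'₀ (show NullMeasurableSet {z | ‖w z‖ₑ ≠ 0} μ from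
        hwm.nullMeasurable (measurableSet_singleton 0).compl)]
      filter_upwards [hqC] with z hz hz0
      exact hz fun h0 => hz0 (by simp [h0])
    obtain ⟨p, hpc, hps, hp⟩ := hql.exist_eLpNorm_sub_le ENNReal.one_ne_top le_rfl hε
    have hpb := hps.continuous.bounded_above_of_compact_support hpc
    obtain ⟨Cp, hCp⟩ := hpb
    have hpw : Integrable (fun z => p z * w z) μ :=
      hw.bdd_mul hps.continuous.aestronglyMeasurable (Eventually.of_forall hCp)
    refine ⟨p, hps.of_le (by exact_mod_cast le_top), hpc, hpw, ?_⟩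
    have hsub : Integrable (fun z => (q z - p z) * w z) μ := by
      simp only [sub_mul]; exact hqw.sub hpw
    rw [eLpNorm_one_eq_lintegral_enorm, hl, lintegral_withDensity_eq_lintegral_mul₀' hwm
      (((hq.sub hps.continuous.aestronglyMeasurable).enorm).mono_ac hac)] at hp
    have h1 : ∫ z, |(q z - p z) * w z| ∂μ = (∫⁻ z, ‖(q z - p z) * w z‖ₑ ∂μ).toReal := by
      rw [← integral_norm_eq_lintegral_enorm hsub.aestronglyMeasurable]
      rfl
    rw [h1]
    refine ENNReal.toReal_le_of_le_ofReal hε.le (le_trans (le_of_eq ?_) hp)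
    refine lintegral_congr fun z => ?_
    simp only [Pi.mul_apply, Pi.sub_apply, enorm_mul]
    ring
  rw [Metric.tendsto_atTop]
  intro ε hε
  obtain ⟨p, hp1, hpc, hpi, hp⟩ := happrox (ε / (4 * (|C| + 1))) (by positivity)
  obtain ⟨N, hN⟩ := Metric.tendsto_atTop.1 (hlim p hp1 hpc) (ε / 2) (by positivity)
  refine ⟨N, fun n hn => ?_⟩
  have hsubi : Integrable (fun z => (q z - p z) * w z) μ := by
    simp only [sub_mul]; exact hqw.sub hpi
  have hsmall : |C| * ∫ z, |(q z - p z) * w z| ∂μ ≤ ε / 4 := by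
    refine (mul_le_mul_of_nonneg_left hp (abs_nonneg C)).trans ?_
    rw [mul_div_assoc', div_le_div_iff₀ (by positivity) (by positivity)]
    nlinarith [abs_nonneg C]
  have hdiff : ∀ s : Z → ℝ, AEStronglyMeasurable s μ → (∀ᵐ z ∂μ, w z ≠ 0 → |s z| ≤ C) →
      |∫ z, s z * (q z * w z) ∂μ - ∫ z, s z * (p z * w z) ∂μ| ≤ ε / 4 := by
    intro s hs hsC
    rw [← integral_sub (hbdd s hs hsC q hqw).1 (hbdd s hs hsC p hpi).1]
    have := (hbdd s hs hsC (fun z => q z - p z) hsubi).2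
    refine le_trans (le_of_eq ?_) (this.trans hsmall)
    congr 2; ext z; ring
  have e1 := abs_le.1 (hdiff (h n) (hm n) (hC n))
  have e2 := abs_le.1 (hdiff h' hm' hC')
  have e3 := hN n hn
  rw [Real.dist_eq] at e3 ⊢
  rw [abs_lt] at e3 ⊢
  constructor <;> linarith [e1.1, e1.2, e2.1, e2.2, e3.1, e3.2]

lemma interiorM_eq (Ω : Set R3) :
    interiorM Ω = (volume : Measure Z).restrict (Ici 0 ×ˢ (Ω ×ˢ univ)) := by
  have h1 : phaseMeasure Ω = (volume : Measure (R3 × R3)).restrict (Ω ×ˢ univ) := by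
    have h2 := Measure.prod_restrict (μ := (volume : Measure R3)) (ν := (volume : Measure R3))
      Ω univ
    rw [Measure.restrict_univ] at h2
    exact h2
  rw [interiorM, h1, Measure.prod_restrict]
  rfl

/-- Weak convergence of mollifications, tested on `[0, ∞) × Ω × ℝ³`. -/
lemma tendsto_integral_interiorM_moll {Ω : Set R3} (hΩ : IsOpen Ω) {k : ℕ → Z → ℝ}
    (hk : ∀ n, ContDiff ℝ 1 (k n))
    (hkc : ∀ n, HasCompactSupport (k n)) (hk0 : ∀ n u, 0 ≤ k n u) (hk1 : ∀ n, ∫ u, k n u = 1)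
    {δ : ℕ → ℝ} (hδ : Tendsto δ atTop (𝓝 0)) (hks : ∀ n u, k n u ≠ 0 → ‖u‖ ≤ δ n)
    {F : Z → ℝ} (hF : Integrable F) {C : ℝ} (hC : ∀ᵐ z, |F z| ≤ C)
    {w : Z → ℝ} (hw : Continuous w) (hwc : HasCompactSupport w) {q : Z → ℝ}
    (hq : AEStronglyMeasurable q (interiorM Ω)) {D : ℝ}
    (hqD : ∀ᵐ z ∂interiorM Ω, w z ≠ 0 → |q z| ≤ D) :
    Tendsto (fun n => ∫ z, moll (k n) F z * (q z * w z) ∂interiorM Ω) atTop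
      (𝓝 (∫ z, F z * (q z * w z) ∂interiorM Ω)) := by
  set Q : Set Z := Ici 0 ×ˢ (Ω ×ˢ univ) with hQ
  have hQm : MeasurableSet Q :=
    measurableSet_Ici.prod (hΩ.measurableSet.prod MeasurableSet.univ)
  have hind : ∀ s : Z → ℝ, ∫ z, s z * (q z * w z) ∂interiorM Ω
      = ∫ z, s z * (Q.indicator q z * w z) := fun s => by
    rw [interiorM_eq, ← integral_indicator hQm]
    congr 1
    ext z
    by_cases hz : z ∈ Q
    · rw [indicator_of_mem hz, indicator_of_mem hz]
    · rw [indicator_of_notMem hz, indicator_of_notMem hz]; ring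
  simp only [hind]
  have hFm : ∀ n z, |moll (k n) F z| ≤ C := fun n z =>
    abs_moll_le (hk n).continuous (hkc n) (hk0 n) (hk1 n) hC z
  refine tendsto_integral_of_smooth (C := max C (max D 0)) (hw.integrable_of_hasCompactSupport hwc)
    (fun n => (contDiff_moll (hk n) (hkc n) hF.locallyIntegrable).continuous.aestronglyMeasurable)
    hF.aestronglyMeasurable (fun n => Eventually.of_forall fun z _ =>
      (hFm n z).trans (le_max_left _ _)) ?_ ?_ ?_ fun p hp hpc => ?_
  · filter_upwards [hC] with z hz _ using hz.trans (le_max_left _ _)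
  · rw [interiorM_eq] at hq
    exact (aestronglyMeasurable_indicator_iff hQm).2 hq
  · rw [interiorM_eq, ae_restrict_iff' hQm] at hqD
    filter_upwards [hqD] with z hz hwz
    by_cases hzQ : z ∈ Q
    · rw [indicator_of_mem hzQ]
      exact (hz hzQ hwz).trans ((le_max_left _ _).trans (le_max_right _ _))
    · rw [indicator_of_notMem hzQ, abs_zero]
      exact (le_max_right _ _).trans (le_max_right _ _)
  · exact tendsto_integral_moll (fun n => (hk n).continuous) hkc hk0 hk1 hδ hks hF
      (hp.continuous.mul hw) hpc.mul_right

/-- Smooth approximations, near a point of space, of a solution with vanishing initial datum. -/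
lemma exists_regularization {Ω : Set R3} (hΩ : IsBoundedC1Domain Ω) {ν : R3 → ℝ}
    (hν : Continuous ν) {f g : Z → ℝ} (hf : LocBdd f (interiorM Ω))
    (hsol : IsSpacetimeSolution Ω ν 0 f g) (x₀ : R3) :
    ∃ r > 0, ∀ R : ℝ, ∃ (C : ℝ) (h G : ℕ → Z → ℝ), (∀ n, ContDiff ℝ 1 (h n)) ∧
      (∀ n z, |h n z| ≤ C) ∧ (∀ n z, h n (0, z) = 0) ∧ (∀ n, Continuous (G n)) ∧
      (∀ n z, z.2.1 ∈ closure Ω ∩ Metric.ball x₀ r → ‖z‖ ≤ R →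
        |transportDeriv (h n) z + G n z| ≤ C / (n + 1)) ∧
      (∀ w : Z → ℝ, Continuous w → HasCompactSupport w → (∀ z, w z ≠ 0 → ‖z‖ ≤ R) →
        ∀ (q : Z → ℝ) (D : ℝ), AEStronglyMeasurable q (interiorM Ω) →
          (∀ᵐ z ∂interiorM Ω, w z ≠ 0 → |q z| ≤ D) →
          Tendsto (fun n => ∫ z, h n z * (q z * w z) ∂interiorM Ω) atTop
            (𝓝 (∫ z, f z * (q z * w z) ∂interiorM Ω)) ∧
          Tendsto (fun n => ∫ z, G n z * (q z * w z) ∂interiorM Ω) atTop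
            (𝓝 (∫ z, ν z.2.2 * f z * (q z * w z) ∂interiorM Ω))) := by
  obtain ⟨a, r, hr, ε₀, hε₀, hshift⟩ := hΩ.exists_shift x₀
  refine ⟨r, hr, fun R => ?_⟩
  set δ : ℕ → ℝ := fun n => min 1 ε₀ / (n + 1) with hδdef
  have hm0 : 0 < min 1 ε₀ := lt_min one_pos hε₀
  have hδ0 : ∀ n, 0 < δ n := fun n => by positivity
  have hδm : ∀ n, δ n ≤ min 1 ε₀ := fun n =>
    div_le_self hm0.le (by have : (0 : ℝ) ≤ n := n.cast_nonneg; linarith)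
  have hδ1 : ∀ n, δ n ≤ 1 / (n + 1) := fun n =>
    div_le_div_of_nonneg_right (min_le_left _ _) (by positivity)
  have hδt : Tendsto δ atTop (𝓝 0) :=
    squeeze_zero (fun n => (hδ0 n).le) hδ1 tendsto_one_div_add_atTop_nhds_zero_nat
  choose ε hε k hk hkc hk0 hk1 hks hkd using fun n => exists_kernel a (hδ0 n)
  set Q : Set Z := Ici 0 ×ˢ (Ω ×ˢ univ) with hQ
  have hQm : MeasurableSet Q :=
    measurableSet_Ici.prod (hΩ.isOpen.measurableSet.prod MeasurableSet.univ)
  -- All kernels have radius at most `1`, so at points of norm at most `R` only values in `B`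
  -- matter. Restricting `f` to `B` and to `Q` makes it bounded and integrable on the whole space.
  set B : Set Z := Metric.closedBall 0 (R + 1) with hB
  have hBc : IsCompact B := isCompact_closedBall _ _
  set F : Z → ℝ := (Q ∩ B).indicator f with hFdef
  set νZ : Z → ℝ := fun z => ν z.2.2 with hνZ
  have hνc : Continuous νZ := hν.comp (by fun_prop)
  obtain ⟨C₁, hC₁⟩ := hf.bound B hBc
  have hνf : LocBdd (fun z => νZ z * f z) (interiorM Ω) := hνc.locBdd.mul hf
  obtain ⟨C₂, hC₂⟩ := hνf.bound B hBc
  have hQB : (interiorM Ω).restrict B = volume.restrict (Q ∩ B) := by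
    rw [interiorM_eq, Measure.restrict_restrict hBc.measurableSet, inter_comm]
  have hQBm : MeasurableSet (Q ∩ B) := hQm.inter hBc.measurableSet
  have hbound : ∀ (s : Z → ℝ) (c : ℝ), (∀ᵐ z ∂(interiorM Ω).restrict B, |s z| ≤ c) →
      ∀ᵐ z, |(Q ∩ B).indicator s z| ≤ max c 0 := by
    intro s c h
    rw [hQB, ae_restrict_iff' hQBm] at h
    filter_upwards [h] with z hz
    by_cases hzQ : z ∈ Q ∩ B
    · rw [indicator_of_mem hzQ]; exact (hz hzQ).trans (le_max_left _ _)
    · rw [indicator_of_notMem hzQ, abs_zero]; exact le_max_right _ _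
  have hint : ∀ s : Z → ℝ, LocBdd s (interiorM Ω) → Integrable ((Q ∩ B).indicator s) := by
    intro s hs
    have := hs.integrableOn hBc
    rw [IntegrableOn, hQB] at this
    exact (integrable_indicator_iff hQBm).2 this
  have hFi : Integrable F := hint f hf
  have hHi : Integrable ((Q ∩ B).indicator fun z => νZ z * f z) := hint _ hνf
  set H : Z → ℝ := (Q ∩ B).indicator fun z => νZ z * f z with hHdef
  have hFb := hbound _ _ hC₁
  have hHb := hbound _ _ hC₂
  have hHF : ∀ z, H z = νZ z * F z := fun z => by
    rw [hHdef, hFdef]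
    by_cases hz : z ∈ Q ∩ B
    · rw [indicator_of_mem hz, indicator_of_mem hz]
    · rw [indicator_of_notMem hz, indicator_of_notMem hz, mul_zero]
  have hkt : ∀ n, tsupport (k n) ⊆ Metric.closedBall 0 (δ n) := fun n =>
    closure_minimal (fun u hu => mem_closedBall_zero_iff.2 (hks n u hu).2.2)
      Metric.isClosed_closedBall
  refine ⟨max C₁ 0, fun n => moll (k n) F, fun n => moll (k n) H,
    fun n => contDiff_moll (hk n) (hkc n) hFi.locallyIntegrable,
    fun n z => abs_moll_le (hk n).continuous (hkc n) (hk0 n) (hk1 n) hFb z, fun n z => ?_,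
    fun n => (contDiff_moll (hk n) (hkc n) hHi.locallyIntegrable).continuous,
    fun n z hz hzR => ?_, fun w hw hwc hwR q D hq hqD => ⟨?_, ?_⟩⟩
  -- The kernel looks strictly backwards in time, where the extension of `f` is zero. Hence the
  -- regularization vanishes initially.
  · refine (integral_congr_ae (Eventually.of_forall fun y => ?_)).trans (integral_zero _ _)
    by_cases hy : k n ((0, z) - y) = 0
    · simp only [hy, mul_zero]
    · have h1 := (hks n _ hy).1
      have h2 : y ∉ Q ∩ B := fun hyQ => by
        have h3 : (0 : ℝ) ≤ y.1 := hyQ.1.1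
        simp only [Prod.fst_sub] at h1
        linarith
      simp only [hFdef, indicator_of_notMem h2, zero_mul]
  · -- the test function is the reflected kernel
    set φ : Z → ℝ := fun y => k n (z - y) with hφ
    have hφ1 : ContDiff ℝ 1 φ := (hk n).comp (contDiff_const.sub contDiff_id)
    have hφc : HasCompactSupport φ :=
      (hkc n).comp_homeomorph (Homeomorph.subLeft z)
    have hφd : ∀ y, transportDeriv φ y = -fderiv ℝ (k n) (z - y) (1, y.2.2, 0) := by
      intro y
      have h1 : HasFDerivAt (fun y : Z => z - y) (-ContinuousLinearMap.id ℝ Z) y :=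
        (hasFDerivAt_id y).const_sub z
      have h2 := ((hk n).differentiable one_ne_zero (z - y)).hasFDerivAt.comp y h1
      rw [transportDeriv, show φ = k n ∘ fun y => z - y from rfl, h2.fderiv]
      simp only [ContinuousLinearMap.comp_apply, _root_.neg_apply,
        ContinuousLinearMap.id_apply, map_neg]
    have hout : ∀ y, y ∉ B → φ y = 0 ∧ fderiv ℝ (k n) (z - y) = 0 := by
      intro y hy
      have h1 : z - y ∉ tsupport (k n) := fun h => by
        have h2 := mem_closedBall_zero_iff.1 (hkt n h)
        refine hy (mem_closedBall_zero_iff.2 ?_)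
        have h3 := norm_le_norm_add_norm_sub z y
        have h4 := (hδm n).trans (min_le_left _ _)
        linarith
      exact ⟨image_eq_zero_of_notMem_tsupport (f := k n) h1, by
        have := image_eq_zero_of_notMem_tsupport (f := fderiv ℝ (k n)) (x := z - y)
          fun h => h1 (tsupport_fderiv_subset ℝ h)
        exact this⟩
    have hGG := hsol φ hφ1 hφc
    -- The spatial shift along `a` keeps the support of the reflected kernel inside `Ω`, even for
    -- `z` on the boundary. The unknown trace therefore does not enter.
    have hb0 : ∫ y, g y * φ y * flux Ω y.2 ∂boundaryM Ω = 0 := by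
      refine (integral_congr_ae ?_).trans (integral_zero _ _)
      filter_upwards [hΩ.ae_boundaryM] with y hy
      have : φ y = 0 := by
        by_contra hne
        have h1 := (hks n _ hne).2.1
        have h2 : y.2.1 ∈ Metric.ball (z.2.1 - ε n • a) (ε n) := by
          rw [mem_ball_iff_norm] at h1 ⊢
          have h4 : y.2.1 - (z.2.1 - ε n • a) = -((z - y).2.1 - ε n • a) := by
            simp only [Prod.snd_sub, Prod.fst_sub]; module
          rwa [h4, norm_neg]
        have h3 := hshift z.2.1 hz (ε n) ⟨(hε n).1,
          (hε n).2.trans_le ((hδm n).trans (min_le_right _ _))⟩ h2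
        exact frontier_notMem hΩ.isOpen hy h3
      rw [this]; ring
    have hint2 : ∫ y, f y * adjointT ν φ y ∂interiorM Ω = ∫ y, F y * adjointT ν φ y := by
      rw [interiorM_eq, ← integral_indicator hQm]
      congr 1
      ext y
      by_cases hyQ : y ∈ Q
      · rw [indicator_of_mem hyQ, hFdef]
        by_cases hyB : y ∈ B
        · rw [indicator_of_mem (show y ∈ Q ∩ B from ⟨hyQ, hyB⟩)]
        · have := hout y hyB
          rw [adjointT, hφd, this.1, this.2]
          simp
      · rw [indicator_of_notMem hyQ, hFdef,
          indicator_of_notMem fun h : y ∈ Q ∩ B => hyQ h.1, zero_mul]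
    rw [hb0, hint2] at hGG
    simp only [Pi.zero_apply, zero_mul, integral_zero, zero_add, sub_zero] at hGG
    have hd : Continuous fun y : Z => fderiv ℝ (k n) (z - y) :=
      ((hk n).continuous_fderiv one_ne_zero).comp (by fun_prop)
    have hdc : ∀ e : Z → Z, Continuous e →
        Integrable fun y => F y * fderiv ℝ (k n) (z - y) (e y) := by
      intro e he
      have hc : Continuous fun y => fderiv ℝ (k n) (z - y) (e y) := hd.clm_apply he
      refine (hFi.bdd_mul (c := ?_) hc.aestronglyMeasurable (Eventually.of_forall ?_)).congr
        (Eventually.of_forall fun y => mul_comm _ _)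
      · exact (Classical.choose (hc.bounded_above_of_compact_support
          (HasCompactSupport.intro hBc fun y hy => by rw [(hout y hy).2]; simp)))
      · exact (Classical.choose_spec (hc.bounded_above_of_compact_support
          (HasCompactSupport.intro hBc fun y hy => by rw [(hout y hy).2]; simp)))
    have e1 : ∫ y, F y * adjointT ν φ y
        = -(∫ y, F y * fderiv ℝ (k n) (z - y) (1, y.2.2, 0)) - moll (k n) H z := by
      rw [moll, ← integral_neg, ← integral_sub]
      · congr 1; ext y
        rw [adjointT, hφd, hHF]
        simp only [hφ, hνZ]
        ring
      · exact (hdc (fun y => (1, y.2.2, 0)) (by fun_prop)).neg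
      · exact integrable_mul_sub (hk n).continuous (hkc n) hHi.locallyIntegrable z
    -- The mollification transports with the velocity of `z`, the equation with that of `y`. The
    -- difference is a commutator, small in `L¹` by the choice of velocity width.
    have e2 : transportDeriv (moll (k n) F) z
        - (∫ y, F y * fderiv ℝ (k n) (z - y) (1, y.2.2, 0))
        = ∫ y, F y * (fun u : Z => fderiv ℝ (k n) u (0, u.2.2, 0)) (z - y) := by
      rw [transportDeriv_moll (hk n) (hkc n) hFi.locallyIntegrable,
        ← integral_sub (hdc (fun _ => (1, z.2.2, 0)) continuous_const)
          (hdc (fun y => (1, y.2.2, 0)) (by fun_prop))]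
      congr 1; ext y
      rw [← mul_sub, ← map_sub]
      simp
    have e3 : transportDeriv (moll (k n) F) z + moll (k n) H z
        = ∫ y, F y * (fun u : Z => fderiv ℝ (k n) u (0, u.2.2, 0)) (z - y) := by
      rw [← e2]; linarith
    rw [e3]
    have hcd : Continuous fun u : Z => fderiv ℝ (k n) u (0, u.2.2, 0) :=
      ((hk n).continuous_fderiv one_ne_zero).clm_apply (by fun_prop)
    have hcdc : HasCompactSupport fun u : Z => fderiv ℝ (k n) u (0, u.2.2, 0) :=
      ((hkc n).fderiv ℝ).mono' fun u hu => subset_tsupport _ fun h => hu (by simp [h])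
    refine (abs_integral_mul_sub_le hcd hcdc hFb z).trans ?_
    rw [div_eq_mul_one_div]
    exact mul_le_mul_of_nonneg_left ((hkd n).trans (hδ1 n)) (le_max_right _ _)
  · have h1 := tendsto_integral_interiorM_moll hΩ.isOpen hk hkc hk0 hk1 hδt
      (fun n u hu => (hks n u hu).2.2) hFi hFb hw hwc hq hqD
    convert h1 using 2
    refine integral_congr_ae ?_
    rw [interiorM_eq]
    filter_upwards [ae_restrict_mem hQm] with z hz
    by_cases hw0 : w z = 0
    · simp [hw0]
    · rw [hFdef, indicator_of_mem]
      exact ⟨hz, mem_closedBall_zero_iff.2 ((hwR z hw0).trans (by linarith))⟩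
  · have h1 := tendsto_integral_interiorM_moll hΩ.isOpen hk hkc hk0 hk1 hδt
      (fun n u hu => (hks n u hu).2.2) hHi hHb hw hwc hq hqD
    convert h1 using 2
    refine integral_congr_ae ?_
    rw [interiorM_eq]
    filter_upwards [ae_restrict_mem hQm] with z hz
    by_cases hw0 : w z = 0
    · simp [hw0]
    · rw [hHdef, indicator_of_mem]
      exact ⟨hz, mem_closedBall_zero_iff.2 ((hwR z hw0).trans (by linarith))⟩

/-! ### The energy identity and uniqueness -/

/-- The identity satisfied by the square of a solution with vanishing initial datum. -/
def EnergyIdentity (Ω : Set R3) (ν : R3 → ℝ) (f g φ : Z → ℝ) : Prop :=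
  ∫ z, g z * (g z * (φ z * flux Ω z.2)) ∂boundaryM Ω
    = ∫ z, f z * (f z * (transportDeriv φ z - 2 * ν z.2.2 * φ z)) ∂interiorM Ω

lemma ae_interiorM_mem {Ω : Set R3} (hΩ : IsOpen Ω) :
    ∀ᵐ z ∂interiorM Ω, 0 ≤ z.1 ∧ z.2.1 ∈ Ω := by
  rw [interiorM_eq]
  filter_upwards [ae_restrict_mem (measurableSet_Ici.prod
    (hΩ.measurableSet.prod MeasurableSet.univ))] with z hz
  exact ⟨hz.1, hz.2.1⟩

lemma LocBdd.exists_bound_norm {μ : Measure Z} {f : Z → ℝ} (hf : LocBdd f μ) (R : ℝ) :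
    ∃ D, ∀ᵐ z ∂μ, ‖z‖ ≤ R → |f z| ≤ D := by
  obtain ⟨D, hD⟩ := hf.bound (Metric.closedBall 0 R) (isCompact_closedBall _ _)
  refine ⟨D, ?_⟩
  rw [ae_restrict_iff' (isCompact_closedBall _ _).measurableSet] at hD
  filter_upwards [hD] with z hz hzR using hz (mem_closedBall_zero_iff.2 hzR)

/-- The energy identity for test functions localized in space. -/
lemma exists_energyIdentity_local {Ω : Set R3} (hΩ : IsBoundedC1Domain Ω) {ν : R3 → ℝ}
    (hν : Continuous ν) {f g : Z → ℝ} (hf : LocBdd f (interiorM Ω)) (hg : LocBdd g (boundaryM Ω))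
    (hsol : IsSpacetimeSolution Ω ν 0 f g) (x₀ : R3) :
    ∃ r > 0, ∀ φ : Z → ℝ, ContDiff ℝ 1 φ → HasCompactSupport φ →
      (∀ z, φ z ≠ 0 → z.2.1 ∈ Metric.ball x₀ r) → EnergyIdentity Ω ν f g φ := by
  have := hΩ.finiteOnCompacts_boundaryM
  obtain ⟨r, hr, H⟩ := exists_regularization hΩ hν hf hsol x₀
  refine ⟨r, hr, fun φ hφ hφc hφr => ?_⟩
  obtain ⟨R, hR⟩ := hφc.isCompact.isBounded.subset_closedBall 0
  have hRt : ∀ z, z ∈ tsupport φ → ‖z‖ ≤ R := fun z hz => mem_closedBall_zero_iff.1 (hR hz)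
  have hRφ : ∀ z, φ z ≠ 0 → ‖z‖ ≤ R := fun z hz => hRt z (subset_tsupport _ hz)
  have hRD : ∀ z, transportDeriv φ z ≠ 0 → ‖z‖ ≤ R := fun z hz => hRt z <| by
    by_contra hn
    refine hz ?_
    have : fderiv ℝ φ z = 0 :=
      image_eq_zero_of_notMem_tsupport fun h => hn (tsupport_fderiv_subset ℝ h)
    simp [transportDeriv, this]
  obtain ⟨C, h, G, hh1, hhC, hh0, hGc, hPDE, hlim⟩ := H R
  have hνc : Continuous fun z : Z => ν z.2.2 := hν.comp (by fun_prop)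
  have hEc : ∀ n, Continuous fun z => transportDeriv (h n) z + G n z := fun n =>
    (continuous_transportDeriv (hh1 n)).add (hGc n)
  -- The regularized equation holds up to a uniform error `C/(n + 1)` wherever `φ ≠ 0`, so its
  -- residual disappears when integrated against bounded functions supported there.
  have herr : ∀ (w q : Z → ℝ) (D : ℝ), Continuous w → HasCompactSupport w →
      (∀ z, w z ≠ 0 → φ z ≠ 0) → AEStronglyMeasurable q (interiorM Ω) →
      (∀ᵐ z ∂interiorM Ω, w z ≠ 0 → |q z| ≤ D) →
      Tendsto (fun n => ∫ z, q z * (w z * (transportDeriv (h n) z + G n z)) ∂interiorM Ω) atTop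
        (𝓝 0) := by
    intro w q D hw hwc hwφ hq hqD
    have hwi : Integrable (fun z => |w z|) (interiorM Ω) :=
      (hw.integrable_of_hasCompactSupport hwc).abs
    refine squeeze_zero_norm (a := fun n : ℕ => |D| * |C| * (∫ z, |w z| ∂interiorM Ω)
      * (1 / ((n : ℝ) + 1))) (fun n => ?_) ?_
    · rw [Real.norm_eq_abs]
      have e : |D| * |C| * (∫ z, |w z| ∂interiorM Ω) * (1 / ((n : ℝ) + 1))
          = ∫ z, |D| * |C| * (1 / ((n : ℝ) + 1)) * |w z| ∂interiorM Ω := by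
        rw [integral_const_mul]; ring
      rw [e]
      refine abs_integral_le_integral_abs.trans (integral_mono_of_nonneg
        (Eventually.of_forall fun _ => abs_nonneg _) (hwi.const_mul _) ?_)
      filter_upwards [hqD, ae_interiorM_mem hΩ.isOpen] with z hz hzΩ
      by_cases hw0 : w z = 0
      · simp [hw0]
      · have h1 := hPDE n z ⟨subset_closure hzΩ.2, hφr z (hwφ z hw0)⟩ (hRφ z (hwφ z hw0))
        have h2 : C / ((n : ℝ) + 1) ≤ |C| * (1 / ((n : ℝ) + 1)) := by
          rw [div_eq_mul_one_div]
          exact mul_le_mul_of_nonneg_right (le_abs_self C) (by positivity)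
        have h3 := (hz hw0).trans (le_abs_self D)
        rw [abs_mul, abs_mul]
        calc |q z| * (|w z| * |transportDeriv (h n) z + G n z|)
            ≤ |D| * (|w z| * (|C| * (1 / ((n : ℝ) + 1)))) := by
              gcongr
              exact h1.trans h2
          _ = _ := by ring
    · have := (tendsto_one_div_add_atTop_nhds_zero_nat (𝕜 := ℝ)).const_mul
        (|D| * |C| * (∫ z, |w z| ∂interiorM Ω))
      rwa [mul_zero] at this
  have hone : ∀ w : Z → ℝ, ∀ᵐ z ∂interiorM Ω, w z ≠ 0 → |(fun _ : Z => (1 : ℝ)) z| ≤ 1 := fun w =>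
    Eventually.of_forall fun z _ => by simp
  obtain ⟨D, hD⟩ := hf.exists_bound_norm R
  obtain ⟨Dg, hDg⟩ := hg.exists_bound_norm R
  have hhl : ∀ n, LocBdd (h n) (interiorM Ω) := fun n => (hh1 n).continuous.locBdd
  have hGl : ∀ n, LocBdd (G n) (interiorM Ω) := fun n => (hGc n).locBdd
  -- weak convergence of the boundary values
  have hbdry : ∀ p : Z → ℝ, ContDiff ℝ 1 p → HasCompactSupport p →
      Tendsto (fun n => ∫ z, h n z * (p z * (φ z * flux Ω z.2)) ∂boundaryM Ω) atTop
        (𝓝 (∫ z, g z * (p z * (φ z * flux Ω z.2)) ∂boundaryM Ω)) := by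
    intro p hp hpc
    set ψ : Z → ℝ := fun z => p z * φ z with hψ
    have hψ1 : ContDiff ℝ 1 ψ := hp.mul hφ
    have hψc : HasCompactSupport ψ := hpc.mul_right
    have hψφ : ∀ z, ψ z ≠ 0 → φ z ≠ 0 := fun z hz => right_ne_zero_of_mul hz
    have hψD : ∀ z, transportDeriv ψ z ≠ 0 → ‖z‖ ≤ R := by
      intro z hz
      rw [hψ, transportDeriv_mul hp hφ] at hz
      by_cases h1 : φ z = 0
      · refine hRD z fun h2 => hz ?_
        rw [h1, h2]; ring
      · exact hRφ z h1
    have hDc := continuous_transportDeriv hψ1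
    have hDcs := hasCompactSupport_transportDeriv hψc
    have l1 := herr ψ (fun _ => 1) 1 hψ1.continuous hψc hψφ aestronglyMeasurable_const (hone ψ)
    have l2 := (hlim ψ hψ1.continuous hψc (fun z hz => hRφ z (hψφ z hz)) (fun _ => 1) 1
      aestronglyMeasurable_const (hone ψ)).2
    have l3 := (hlim (transportDeriv ψ) hDc hDcs hψD (fun _ => 1) 1
      aestronglyMeasurable_const (hone _)).1
    -- The weak formulation for `f` and Green's formula for `h n` express the two boundary pairings
    -- through the same interior integrals, up to the residual. Convergence inside thus yields
    -- convergence of the boundary values to `g`.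
    have hval : ∫ z, g z * (p z * (φ z * flux Ω z.2)) ∂boundaryM Ω
        = 0 - ∫ z, ν z.2.2 * f z * ((fun _ => 1) z * ψ z) ∂interiorM Ω
          + ∫ z, f z * ((fun _ => 1) z * transportDeriv ψ z) ∂interiorM Ω := by
      have h1 := hsol ψ hψ1 hψc
      simp only [Pi.zero_apply, zero_mul, integral_zero, zero_add] at h1
      have e1 : ∫ z, f z * adjointT ν ψ z ∂interiorM Ω
          = ∫ z, f z * ((fun _ => 1) z * transportDeriv ψ z) ∂interiorM Ω
            - ∫ z, ν z.2.2 * f z * ((fun _ => 1) z * ψ z) ∂interiorM Ω := by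
        simp only [one_mul]
        rw [← integral_sub]
        · congr 1; ext z; rw [adjointT]; ring
        · exact hf.integrable_mul hDc hDcs
        · exact (hνc.locBdd.mul hf).integrable_mul hψ1.continuous hψc
      have e2 : ∫ z, g z * (p z * (φ z * flux Ω z.2)) ∂boundaryM Ω
          = ∫ z, g z * ψ z * flux Ω z.2 ∂boundaryM Ω := by
        congr 1; ext z; simp only [hψ]; ring
      rw [e2]; linarith
    rw [hval]
    refine ((l1.sub l2).add l3).congr fun n => ?_
    have green := integral_transportDeriv hΩ (ω := fun _ => 1) continuous_const
      (hψ1.mul (hh1 n)) (hψc.mul_right (f' := h n))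
    simp only [hh0, mul_zero, integral_zero, neg_zero, zero_add, one_mul,
      transportDeriv_mul hψ1 (hh1 n)] at green
    have e3 : ∫ z, h n z * (p z * (φ z * flux Ω z.2)) ∂boundaryM Ω
        = ∫ z, ψ z * h n z * flux Ω z.2 ∂boundaryM Ω := by
      congr 1; ext z; simp only [hψ]; ring
    rw [e3, ← green]
    simp only [one_mul]
    rw [← integral_sub, ← integral_add]
    · congr 1; ext z; ring
    · exact ((hψ1.continuous.mul (hEc n)).integrable_of_hasCompactSupport hψc.mul_right).sub
        ((hGl n).integrable_mul hψ1.continuous hψc)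
    · exact (hhl n).integrable_mul hDc hDcs
    · exact (hψ1.continuous.mul (hEc n)).integrable_of_hasCompactSupport hψc.mul_right
    · exact (hGl n).integrable_mul hψ1.continuous hψc
  have hwi : Integrable (fun z => φ z * flux Ω z.2) (boundaryM Ω) :=
    (hΩ.locBdd_flux_boundaryM.integrable_mul hφ.continuous hφc).congr
      (Eventually.of_forall fun z => mul_comm _ _)
  -- Uniform bounds allow the merely bounded `g` as a test function, so the weak limit produces
  -- `g²`.
  have hright : Tendsto (fun n => ∫ z, h n z * (g z * (φ z * flux Ω z.2)) ∂boundaryM Ω) atTop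
      (𝓝 (∫ z, g z * (g z * (φ z * flux Ω z.2)) ∂boundaryM Ω)) := by
    have hgb : ∀ᵐ z ∂boundaryM Ω, φ z * flux Ω z.2 ≠ 0 → |g z| ≤ max C Dg := by
      filter_upwards [hDg] with z hz h0
      exact (hz (hRφ z (left_ne_zero_of_mul h0))).trans (le_max_right _ _)
    exact tendsto_integral_of_smooth (C := max C Dg) hwi
      (fun n => (hh1 n).continuous.aestronglyMeasurable) hg.aesm
      (fun n => Eventually.of_forall fun z _ => (hhC n z).trans (le_max_left _ _)) hgb hg.aesm hgb
      hbdry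
  have hDφ := continuous_transportDeriv hφ
  have hDφc := hasCompactSupport_transportDeriv hφc
  have hνφ : Continuous fun z => ν z.2.2 * φ z := hνc.mul hφ.continuous
  have hνφc : HasCompactSupport fun z => ν z.2.2 * φ z := hφc.mul_left
  have l1 := herr φ f D hφ.continuous hφc (fun _ h => h) hf.aesm (by
    filter_upwards [hD] with z hz h0 using hz (hRφ z h0))
  have l2 := (hlim φ hφ.continuous hφc hRφ f D hf.aesm (by
    filter_upwards [hD] with z hz h0 using hz (hRφ z h0))).2
  have l3 := (hlim _ hDφ hDφc hRD f D hf.aesm (by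
    filter_upwards [hD] with z hz h0 using hz (hRD z h0))).1
  have l4 := (hlim _ hνφ hνφc (fun z hz => hRφ z (right_ne_zero_of_mul hz)) f D hf.aesm (by
    filter_upwards [hD] with z hz h0 using hz (hRφ z (right_ne_zero_of_mul h0)))).1
  -- The weak formulation of `f` is tested with `φ h n`, and `∂_t + v·∇_x` of `h n` is traded for
  -- `-G n`. Each term is then a weakly convergent sequence against a fixed function, and the
  -- damping appears twice in the limit.
  have hleft : ∀ n, ∫ z, h n z * (g z * (φ z * flux Ω z.2)) ∂boundaryM Ω
      = ∫ z, f z * (φ z * (transportDeriv (h n) z + G n z)) ∂interiorM Ω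
        - ∫ z, G n z * (f z * φ z) ∂interiorM Ω
        + ∫ z, h n z * (f z * transportDeriv φ z) ∂interiorM Ω
        - ∫ z, h n z * (f z * (ν z.2.2 * φ z)) ∂interiorM Ω := by
    intro n
    have h1 := hsol _ (hφ.mul (hh1 n)) (hφc.mul_right (f' := h n))
    simp only [Pi.zero_apply, zero_mul, integral_zero, zero_add] at h1
    have e1 : ∫ z, h n z * (g z * (φ z * flux Ω z.2)) ∂boundaryM Ω
        = ∫ z, g z * (φ z * h n z) * flux Ω z.2 ∂boundaryM Ω := by
      congr 1; ext z; ring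
    rw [e1, ← sub_eq_zero.1 h1]
    have i1 : Integrable (fun z => f z * (φ z * (transportDeriv (h n) z + G n z)))
        (interiorM Ω) :=
      hf.integrable_mul (hφ.continuous.mul (hEc n)) hφc.mul_right
    have i2 : Integrable (fun z => G n z * (f z * φ z)) (interiorM Ω) :=
      (((hGl n).mul hf).integrable_mul hφ.continuous hφc).congr
        (Eventually.of_forall fun z => mul_assoc _ _ _)
    have i3 : Integrable (fun z => h n z * (f z * transportDeriv φ z)) (interiorM Ω) :=
      (((hhl n).mul hf).integrable_mul hDφ hDφc).congr
        (Eventually.of_forall fun z => mul_assoc _ _ _)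
    have i4 : Integrable (fun z => h n z * (f z * (ν z.2.2 * φ z))) (interiorM Ω) :=
      (((hhl n).mul hf).integrable_mul hνφ hνφc).congr
        (Eventually.of_forall fun z => mul_assoc _ _ _)
    have i12 : Integrable (fun z => f z * (φ z * (transportDeriv (h n) z + G n z))
        - G n z * (f z * φ z)) (interiorM Ω) := i1.sub i2
    have i123 : Integrable (fun z => f z * (φ z * (transportDeriv (h n) z + G n z))
        - G n z * (f z * φ z) + h n z * (f z * transportDeriv φ z)) (interiorM Ω) := i12.add i3
    rw [← integral_sub i1 i2, ← integral_add i12 i3, ← integral_sub i123 i4]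
    congr 1; ext z
    rw [adjointT, transportDeriv_mul hφ (hh1 n)]
    ring
  simp only [hleft] at hright
  have huniq := tendsto_nhds_unique hright (((l1.sub l2).add l3).sub l4)
  rw [EnergyIdentity, huniq, zero_sub]
  have hff := hf.mul hf
  have j1 : Integrable (fun z => ν z.2.2 * f z * (f z * φ z)) (interiorM Ω) :=
    (hff.integrable_mul hνφ hνφc).congr (Eventually.of_forall fun z => by simp only; ring)
  have j2 : Integrable (fun z => f z * (f z * transportDeriv φ z)) (interiorM Ω) :=
    (hff.integrable_mul hDφ hDφc).congr (Eventually.of_forall fun z => by simp only; ring)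
  have j3 : Integrable (fun z => f z * (f z * (ν z.2.2 * φ z))) (interiorM Ω) :=
    (hff.integrable_mul hνφ hνφc).congr (Eventually.of_forall fun z => by simp only; ring)
  have j1' : Integrable (fun z => -(ν z.2.2 * f z * (f z * φ z))) (interiorM Ω) := j1.neg
  have j12 : Integrable (fun z => -(ν z.2.2 * f z * (f z * φ z))
      + f z * (f z * transportDeriv φ z)) (interiorM Ω) := j1'.add j2
  rw [← integral_neg, ← integral_add j1' j2, ← integral_sub j12 j3]
  congr 1; ext z
  ring

lemma EnergyIdentity.add {Ω : Set R3} (hΩ : IsBoundedC1Domain Ω) {ν : R3 → ℝ}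
    (hν : Continuous ν) {f g φ ψ : Z → ℝ} (hf : LocBdd f (interiorM Ω))
    (hg : LocBdd g (boundaryM Ω)) (hφ : ContDiff ℝ 1 φ) (hφc : HasCompactSupport φ)
    (hψ : ContDiff ℝ 1 ψ) (hψc : HasCompactSupport ψ) (h1 : EnergyIdentity Ω ν f g φ)
    (h2 : EnergyIdentity Ω ν f g ψ) : EnergyIdentity Ω ν f g (φ + ψ) := by
  have := hΩ.finiteOnCompacts_boundaryM
  have hνc : Continuous fun z : Z => 2 * ν z.2.2 := by fun_prop
  have hb : ∀ χ : Z → ℝ, ContDiff ℝ 1 χ → HasCompactSupport χ →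
      Integrable (fun z => g z * (g z * (χ z * flux Ω z.2))) (boundaryM Ω) := fun χ hχ hχc =>
    (((hg.mul hg).mul hΩ.locBdd_flux_boundaryM).integrable_mul hχ.continuous hχc).congr
      (Eventually.of_forall fun z => by simp only; ring)
  have hi : ∀ χ : Z → ℝ, ContDiff ℝ 1 χ → HasCompactSupport χ →
      Integrable (fun z => f z * (f z * (transportDeriv χ z - 2 * ν z.2.2 * χ z)))
        (interiorM Ω) := fun χ hχ hχc =>
    ((hf.mul hf).integrable_mul ((continuous_transportDeriv hχ).sub (hνc.mul hχ.continuous))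
      ((hasCompactSupport_transportDeriv hχc).sub hχc.mul_left)).congr
      (Eventually.of_forall fun z => by simp only [Pi.sub_apply, Pi.mul_apply]; ring)
  rw [EnergyIdentity] at h1 h2 ⊢
  have e1 : ∫ z, g z * (g z * ((φ + ψ) z * flux Ω z.2)) ∂boundaryM Ω
      = ∫ z, g z * (g z * (φ z * flux Ω z.2)) ∂boundaryM Ω
        + ∫ z, g z * (g z * (ψ z * flux Ω z.2)) ∂boundaryM Ω := by
    rw [← integral_add (hb φ hφ hφc) (hb ψ hψ hψc)]
    congr 1; ext z; simp only [Pi.add_apply]; ring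
  rw [e1, h1, h2, ← integral_add (hi φ hφ hφc) (hi ψ hψ hψc)]
  congr 1; ext z
  rw [transportDeriv_add hφ hψ]
  simp only [Pi.add_apply]; ring

/-- The energy identity. -/
theorem energyIdentity {Ω : Set R3} (hΩ : IsBoundedC1Domain Ω) {ν : R3 → ℝ}
    (hν : Continuous ν) {f g : Z → ℝ} (hf : LocBdd f (interiorM Ω)) (hg : LocBdd g (boundaryM Ω))
    (hsol : IsSpacetimeSolution Ω ν 0 f g) {φ : Z → ℝ} (hφ : ContDiff ℝ 1 φ)
    (hφc : HasCompactSupport φ) : EnergyIdentity Ω ν f g φ := by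
  choose r hr hloc using exists_energyIdentity_local hΩ hν hf hg hsol
  obtain ⟨s, ρ, hρ, hρs, hρ1⟩ := exists_finite_partition hΩ.isBounded.isCompact_closure hr
  have hρZ : ∀ i ∈ s, ContDiff ℝ 1 fun z : Z => ρ i z.2.1 := fun i hi =>
    (hρ i hi).comp (contDiff_fst.comp contDiff_snd)
  have hsum : ∀ t ⊆ s, ContDiff ℝ 1 (fun z : Z => (∑ i ∈ t, ρ i z.2.1) * φ z) ∧
      EnergyIdentity Ω ν f g fun z => (∑ i ∈ t, ρ i z.2.1) * φ z := by
    intro t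
    induction t using Finset.induction_on with
    | empty =>
      intro _
      simp only [Finset.sum_empty, zero_mul]
      refine ⟨contDiff_const, ?_⟩
      have : transportDeriv (fun _ : Z => (0 : ℝ)) = 0 := by
        ext z; simp [transportDeriv]
      simp [EnergyIdentity, this]
    | insert i t hit ih =>
      intro hts
      have his : i ∈ s := hts (Finset.mem_insert_self i t)
      obtain ⟨c1, c2⟩ := ih fun j hj => hts (Finset.mem_insert_of_mem hj)
      have d1 : ContDiff ℝ 1 fun z : Z => ρ i z.2.1 * φ z := (hρZ i his).mul hφ
      have e : (fun z : Z => (∑ j ∈ insert i t, ρ j z.2.1) * φ z)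
          = (fun z : Z => ρ i z.2.1 * φ z) + fun z : Z => (∑ j ∈ t, ρ j z.2.1) * φ z := by
        ext z
        simp only [Finset.sum_insert hit, Pi.add_apply]
        ring
      rw [e]
      refine ⟨d1.add c1, EnergyIdentity.add hΩ hν hf hg d1 hφc.mul_left c1 hφc.mul_left
        (hloc i _ d1 hφc.mul_left fun z hz => ?_) c2⟩
      exact hρs i his (subset_tsupport _ (left_ne_zero_of_mul hz))
  have h1 := (hsum s subset_rfl).2
  rw [EnergyIdentity] at h1 ⊢
  have e1 : ∫ z, g z * (g z * ((∑ i ∈ s, ρ i z.2.1) * φ z * flux Ω z.2)) ∂boundaryM Ω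
      = ∫ z, g z * (g z * (φ z * flux Ω z.2)) ∂boundaryM Ω := by
    refine integral_congr_ae ?_
    filter_upwards [hΩ.ae_boundaryM] with z hz
    rw [hρ1 _ (frontier_subset_closure hz), one_mul]
  rw [← e1, h1]
  refine integral_congr_ae ?_
  filter_upwards [ae_interiorM_mem hΩ.isOpen] with z hz
  -- The partition sums to `1` near every interior point, so its derivatives do not contribute.
  have hev : (fun z : Z => (∑ i ∈ s, ρ i z.2.1) * φ z) =ᶠ[𝓝 z] φ := by
    have : ∀ᶠ y : Z in 𝓝 z, y.2.1 ∈ Ω :=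
      (by fun_prop : Continuous fun y : Z => y.2.1).continuousAt.eventually
        (hΩ.isOpen.mem_nhds hz.2)
    filter_upwards [this] with y hy
    rw [hρ1 _ (subset_closure hy), one_mul]
  rw [transportDeriv, hev.fderiv_eq, hρ1 _ (subset_closure hz.2), one_mul]
  rfl

lemma deriv_smoothTransition_nonneg (x : ℝ) : 0 ≤ deriv Real.smoothTransition x :=
  Real.smoothTransition.monotone.deriv_nonneg

/-- A smooth cutoff that decreases in time, is constant in space near a given ball, and is radial
in velocity. -/
noncomputable def cutoff (ρ : ContDiffBump (0 : R3)) (T : ℝ) (z : Z) : ℝ :=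
  Real.smoothTransition (T - z.1 ^ 2) * (ρ z.2.1 * Real.smoothTransition (T - ‖z.2.2‖ ^ 2))

lemma contDiff_cutoff (ρ : ContDiffBump (0 : R3)) (T : ℝ) : ContDiff ℝ 1 (cutoff ρ T) := by
  have h1 : ContDiff ℝ 1 fun z : Z => T - z.1 ^ 2 := by fun_prop
  have h2 : ContDiff ℝ 1 fun z : Z => T - ‖z.2.2‖ ^ 2 :=
    contDiff_const.sub ((contDiff_snd.comp contDiff_snd).norm_sq ℝ)
  have h3 : ContDiff ℝ 1 fun z : Z => ρ z.2.1 :=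
    ρ.contDiff.comp (contDiff_fst.comp contDiff_snd)
  exact (Real.smoothTransition.contDiff.comp h1).mul
    (h3.mul (Real.smoothTransition.contDiff.comp h2))

lemma hasCompactSupport_cutoff (ρ : ContDiffBump (0 : R3)) (T : ℝ) :
    HasCompactSupport (cutoff ρ T) := by
  have hle : ∀ s : ℝ, T - s ^ 2 ≤ 0 ∨ |s| ≤ |T| + 1 := by
    intro s
    by_contra! h
    have h1 := le_abs_self T
    have h2 := abs_nonneg T
    have h3 : |s| ^ 2 = s ^ 2 := sq_abs s
    nlinarith
  refine HasCompactSupport.intro ((isCompact_closedBall (0 : ℝ) (|T| + 1)).prod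
    (ρ.hasCompactSupport.isCompact.prod (isCompact_closedBall (0 : R3) (|T| + 1)))) fun z hz => ?_
  by_contra hne
  have h1 := left_ne_zero_of_mul hne
  have h2 := left_ne_zero_of_mul (right_ne_zero_of_mul hne)
  have h3 := right_ne_zero_of_mul (right_ne_zero_of_mul hne)
  refine hz ⟨?_, subset_tsupport _ h2, ?_⟩
  · rw [mem_closedBall_zero_iff]
    exact (hle z.1).resolve_left fun h => h1 (Real.smoothTransition.zero_of_nonpos h)
  · rw [mem_closedBall_zero_iff]
    have := (hle ‖z.2.2‖).resolve_left fun h => h3 (Real.smoothTransition.zero_of_nonpos h)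
    rwa [abs_norm] at this

lemma cutoff_nonneg (ρ : ContDiffBump (0 : R3)) (T : ℝ) (z : Z) : 0 ≤ cutoff ρ T z :=
  mul_nonneg (Real.smoothTransition.nonneg _)
    (mul_nonneg ρ.nonneg (Real.smoothTransition.nonneg _))

/-- Near points of the inner ball the spatial factor is constant, and transport does not act on the
velocity factor. Only the time derivative is left, which is nonpositive for `t ≥ 0`. -/
lemma transportDeriv_cutoff_nonpos (ρ : ContDiffBump (0 : R3)) (T : ℝ) {z : Z} (hz : 0 ≤ z.1)
    (hx : z.2.1 ∈ Metric.ball 0 ρ.rIn) : transportDeriv (cutoff ρ T) z ≤ 0 := by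
  have h1 : ContDiff ℝ 1 fun t : ℝ => Real.smoothTransition (T - t ^ 2) :=
    Real.smoothTransition.contDiff.comp (by fun_prop)
  have hd : deriv (fun t : ℝ => Real.smoothTransition (T - t ^ 2)) z.1 ≤ 0 := by
    have h2 : HasDerivAt (fun t : ℝ => T - t ^ 2) (-(2 * z.1)) z.1 := by
      simpa using (hasDerivAt_pow 2 z.1).const_sub T
    have h3 : HasDerivAt Real.smoothTransition (deriv Real.smoothTransition (T - z.1 ^ 2))
        (T - z.1 ^ 2) :=
      ((Real.smoothTransition.contDiff (n := 1)).differentiable one_ne_zero _).hasDerivAt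
    have h4 := h3.comp z.1 h2
    have h5 : deriv (fun t : ℝ => Real.smoothTransition (T - t ^ 2)) z.1
      = deriv Real.smoothTransition (T - z.1 ^ 2) * -(2 * z.1) := h4.deriv
    rw [h5]
    have := deriv_smoothTransition_nonneg (T - z.1 ^ 2)
    nlinarith [mul_nonneg this hz]
  set p : Z → ℝ := fun z => Real.smoothTransition (T - ‖z.2.2‖ ^ 2) with hp
  have hp1 : ContDiff ℝ 1 p := Real.smoothTransition.contDiff.comp
    (contDiff_const.sub ((contDiff_snd.comp contDiff_snd).norm_sq ℝ))
  have hev : cutoff ρ T =ᶠ[𝓝 z] fun z : Z => Real.smoothTransition (T - z.1 ^ 2) * p z := by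
    have hnear : ∀ᶠ y : Z in 𝓝 z, y.2.1 ∈ Metric.ball (0 : R3) ρ.rIn :=
      (by fun_prop : Continuous fun y : Z => y.2.1).continuousAt.eventually
        (Metric.isOpen_ball.mem_nhds hx)
    filter_upwards [hnear] with y hy
    rw [cutoff, ρ.one_of_mem_closedBall (Metric.ball_subset_closedBall hy), one_mul]
  have hpd : transportDeriv p z = 0 := by
    have hc : ContDiff ℝ 1 fun v : R3 => Real.smoothTransition (T - ‖v‖ ^ 2) :=
      Real.smoothTransition.contDiff.comp (contDiff_const.sub (contDiff_id.norm_sq ℝ))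
    have h2 : HasFDerivAt (fun z : Z => z.2.2)
        ((ContinuousLinearMap.snd ℝ R3 R3) ∘L (ContinuousLinearMap.snd ℝ ℝ (R3 × R3))) z :=
      ((ContinuousLinearMap.snd ℝ R3 R3) ∘L (ContinuousLinearMap.snd ℝ ℝ (R3 × R3))).hasFDerivAt
    have h3 := ((hc.differentiable one_ne_zero z.2.2).hasFDerivAt.comp z h2)
    rw [transportDeriv, show p = (fun v : R3 => Real.smoothTransition (T - ‖v‖ ^ 2))
      ∘ fun z : Z => z.2.2 from rfl, h3.fderiv]
    simp
  rw [transportDeriv, hev.fderiv_eq]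
  have h4 := transportDeriv_mul (φ := fun z : Z => Real.smoothTransition (T - z.1 ^ 2)) (ψ := p)
    (h1.comp contDiff_fst) hp1 z
  rw [transportDeriv] at h4
  rw [h4, hpd, mul_zero, zero_add, transportDeriv_time h1]
  exact mul_nonpos_of_nonneg_of_nonpos (Real.smoothTransition.nonneg _) hd

/-- For each boundary point the grazing velocities form a proper subspace, which is null; Fubini
does the rest. -/
lemma IsBoundedC1Domain.ae_flux_ne_zero {Ω : Set R3} (hΩ : IsBoundedC1Domain Ω) :
    ∀ᵐ z ∂boundaryMeasure Ω, flux Ω z ≠ 0 := by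
  have := hΩ.isFiniteMeasure_surf
  have hae : ∀ᵐ z ∂boundaryMeasure Ω, z.1 ∈ frontier Ω → flux' Ω z ≠ 0 := by
    have hm : MeasurableSet {z : R3 × R3 | z.1 ∈ frontier Ω → flux' Ω z ≠ 0} := by
      have h1 : MeasurableSet {z : R3 × R3 | z.1 ∈ frontier Ω} :=
        measurable_fst isClosed_frontier.measurableSet
      have h2 : MeasurableSet {z : R3 × R3 | flux' Ω z ≠ 0} :=
        (measurable_flux' hΩ) (measurableSet_singleton 0).compl
      exact h1.imp h2
    refine (Measure.ae_prod_iff_ae_ae hm).2 (Eventually.of_forall fun x => ?_)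
    by_cases hx : x ∈ frontier Ω
    · have h1 := hΩ.norm_outwardNormal hx
      have h2 : (ℝ ∙ outwardNormal Ω x)ᗮ ≠ ⊤ := by
        intro h
        have h3 : outwardNormal Ω x ∈ (ℝ ∙ outwardNormal Ω x)ᗮ := h ▸ Submodule.mem_top
        rw [Submodule.mem_orthogonal_singleton_iff_inner_right, real_inner_self_eq_norm_sq,
          h1] at h3
        norm_num at h3
      have h4 := Measure.addHaar_submodule (volume : Measure R3) _ h2
      have h5 : ∀ᵐ v : R3, v ∉ ((ℝ ∙ outwardNormal Ω x)ᗮ : Submodule ℝ R3) :=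
        measure_eq_zero_iff_ae_notMem.1 h4
      filter_upwards [h5] with v hv _ h0
      refine hv (Submodule.mem_orthogonal_singleton_iff_inner_right.2 ?_)
      rw [flux'_eq (z := (x, v)) hx, flux] at h0
      rw [real_inner_comm]; exact h0
    · exact Eventually.of_forall fun v h => absurd h hx
  filter_upwards [hae, hΩ.ae_boundaryMeasure] with z h1 h2
  rw [← flux'_eq h2]
  exact h1 h2

/-- Uniqueness for the transport equation with specular reflection. -/
theorem ae_eq_zero_of_isSpacetimeSolution {Ω : Set R3} (hΩ : IsBoundedC1Domain Ω) {ν : R3 → ℝ}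
    (hν : Continuous ν) (hν0 : ∀ v, 0 < ν v) {f g : Z → ℝ} (hf : LocBdd f (interiorM Ω))
    (hg : LocBdd g (boundaryM Ω)) (hgs : ∀ᵐ z ∂boundaryM Ω, g (bounceZ hΩ z) = g z)
    (hsol : IsSpacetimeSolution Ω ν 0 f g) :
    f =ᵐ[interiorM Ω] 0 ∧ g =ᵐ[boundaryM Ω] 0 := by
  have := hΩ.finiteOnCompacts_boundaryM
  have := hΩ.sigmaFinite_boundaryMeasure
  have hνc : Continuous fun z : Z => 2 * ν z.2.2 := by fun_prop
  obtain ⟨b, hb⟩ := hΩ.isBounded.subset_closedBall 0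
  let ρ : ContDiffBump (0 : R3) := ⟨max b 0 + 1, max b 0 + 2, by positivity, by linarith⟩
  have hρ : ∀ x ∈ Ω, x ∈ Metric.ball (0 : R3) ρ.rIn := fun x hx => by
    have h1 := mem_closedBall_zero_iff.1 (hb hx)
    rw [mem_ball_zero_iff]
    change ‖x‖ < max b 0 + 1
    have := le_max_left b 0
    linarith
  have hstep : ∀ n : ℕ, ∀ᵐ z ∂interiorM Ω, cutoff ρ n z ≠ 0 → f z = 0 := by
    intro n
    have hφ := contDiff_cutoff ρ n
    have hφc := hasCompactSupport_cutoff ρ n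
    have hE := energyIdentity hΩ hν hf hg hsol hφ hφc
    rw [EnergyIdentity] at hE
    have hφb : ∀ z, cutoff ρ n (bounceZ hΩ z) = cutoff ρ n z := fun z => by
      simp only [cutoff, bounceZ_apply, norm_bounce_snd, bounce_fst]
    -- Both `g²` and the cutoff are invariant under reflection while the normal velocity changes
    -- sign, so incoming and outgoing fluxes cancel.
    have hL : ∫ z, g z * (g z * (cutoff ρ n z * flux Ω z.2)) ∂boundaryM Ω = 0 := by
      have e : ∀ z, g z * (g z * (cutoff ρ n z * flux Ω z.2))
          = (g z * g z * cutoff ρ n z) * flux Ω z.2 := fun z => by ring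
      simp only [e]
      rw [integral_mul_flux hΩ]
      · refine (integral_congr_ae ?_).trans (integral_zero _ _)
        filter_upwards [hgs] with z hz
        rw [hz, hφb, sub_self, zero_mul]
      · exact (((hg.mul hg).mul hΩ.locBdd_flux_boundaryM).integrable_mul hφ.continuous hφc).congr
          (Eventually.of_forall fun z => by simp only; ring)
    have hi : Integrable (fun z => f z * (f z * (transportDeriv (cutoff ρ n) z
        - 2 * ν z.2.2 * cutoff ρ n z))) (interiorM Ω) :=
      ((hf.mul hf).integrable_mul ((continuous_transportDeriv hφ).sub (hνc.mul hφ.continuous))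
        ((hasCompactSupport_transportDeriv hφc).sub hφc.mul_left)).congr
        (Eventually.of_forall fun z => by simp only [Pi.sub_apply, Pi.mul_apply]; ring)
    have hle : ∀ᵐ z ∂interiorM Ω, transportDeriv (cutoff ρ n) z ≤ 0 := by
      filter_upwards [ae_interiorM_mem hΩ.isOpen] with z hz
      exact transportDeriv_cutoff_nonpos ρ n hz.1 (hρ _ hz.2)
    -- Decrease of the cutoff and positivity of `ν` give the integrand a sign. As its integral is
    -- zero, `f` vanishes wherever the cutoff does not.
    have hnn : 0 ≤ᵐ[interiorM Ω] fun z => -(f z * (f z * (transportDeriv (cutoff ρ n) z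
        - 2 * ν z.2.2 * cutoff ρ n z))) := by
      filter_upwards [hle] with z hz
      have h1 := mul_nonneg (hν0 z.2.2).le (cutoff_nonneg ρ n z)
      simp only [Pi.zero_apply]
      nlinarith [mul_self_nonneg (f z)]
    have hz0 := (integral_eq_zero_iff_of_nonneg_ae hnn hi.neg).1 (by
      rw [integral_neg, ← hE, hL, neg_zero])
    filter_upwards [hz0, hle] with z h1 h2 h3
    have h4 : 0 < ν z.2.2 * cutoff ρ n z :=
      mul_pos (hν0 _) (lt_of_le_of_ne (cutoff_nonneg ρ n z) h3.symm)
    simp only [Pi.zero_apply, neg_eq_zero, mul_eq_zero] at h1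
    rcases h1 with h1 | h1 | h1
    · exact h1
    · exact h1
    · nlinarith
  have hf0 : f =ᵐ[interiorM Ω] 0 := by
    filter_upwards [ae_all_iff.2 hstep, ae_interiorM_mem hΩ.isOpen] with z hz hzΩ
    obtain ⟨n, hn⟩ := exists_nat_gt (max (z.1 ^ 2) (‖z.2.2‖ ^ 2))
    refine hz n (mul_pos ?_ (mul_pos (lt_of_lt_of_eq one_pos
      (ρ.one_of_mem_closedBall (Metric.ball_subset_closedBall (hρ _ hzΩ.2))).symm) ?_)).ne'
    · exact Real.smoothTransition.pos_of_pos (sub_pos.2 ((le_max_left _ _).trans_lt hn))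
    · exact Real.smoothTransition.pos_of_pos (sub_pos.2 ((le_max_right _ _).trans_lt hn))
  refine ⟨hf0, ?_⟩
  -- With `f = 0` and zero datum, the weak formulation reduces to the vanishing of the boundary flux
  -- against all test functions.
  have hgf : ∀ᵐ z ∂boundaryM Ω, g z * flux Ω z.2 = 0 := by
    refine ae_eq_zero_of_integral_contDiff_smul_eq_zero
      (hg.mul hΩ.locBdd_flux_boundaryM).locallyIntegrable fun φ hφ hφc => ?_
    have h1 := hsol φ (hφ.of_le (by exact_mod_cast le_top)) hφc
    have h2 : ∫ z, f z * adjointT ν φ z ∂interiorM Ω = 0 := by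
      refine (integral_congr_ae ?_).trans (integral_zero _ _)
      filter_upwards [hf0] with z hz
      rw [hz, Pi.zero_apply, zero_mul]
    simp only [Pi.zero_apply, zero_mul, integral_zero, h2, zero_add, zero_sub, neg_eq_zero] at h1
    rw [← h1]
    congr 1; ext z; simp only [smul_eq_mul]; ring
  have hne : ∀ᵐ z ∂boundaryM Ω, flux Ω z.2 ≠ 0 :=
    Measure.quasiMeasurePreserving_snd.ae hΩ.ae_flux_ne_zero
  filter_upwards [hgf, hne] with z h1 h2
  exact (mul_eq_zero.1 h1).resolve_right h2

/-! ### Weighted norms and the passage from specular solutions to the space-time formulation -/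

lemma ae_abs_le_of_weightedNorm_le {ρ : Measure (R3 × R3)} {m : R3 → ℝ} {h : R3 × R3 → ℝ}
    {C : ℝ≥0} (hC : weightedNorm ρ m h ≤ C) : ∀ᵐ z ∂ρ, |h z * m z.2| ≤ C := by
  rw [weightedNorm, eLpNorm_exponent_top] at hC
  filter_upwards [ae_le_eLpNormEssSup (f := fun z => h z * m z.2) (μ := ρ)] with z hz
  have := hz.trans hC
  rw [← ofReal_norm, Real.norm_eq_abs, ← ENNReal.ofReal_coe_nnreal] at this
  exact (ENNReal.ofReal_le_ofReal_iff C.2).1 this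

lemma ae_abs_le_of_weightedNorm_le' {ρ : Measure (R3 × R3)} {m : R3 → ℝ} (hm : ∀ v, 1 ≤ m v)
    {h : R3 × R3 → ℝ} {C : ℝ≥0} (hC : weightedNorm ρ m h ≤ C) : ∀ᵐ z ∂ρ, |h z| ≤ C := by
  filter_upwards [ae_abs_le_of_weightedNorm_le hC] with z hz
  rw [abs_mul, abs_of_pos (one_pos.trans_le (hm z.2))] at hz
  exact (le_mul_of_one_le_right (abs_nonneg _) (hm _)).trans hz

lemma weightedNorm_le_of_abs_le {ρ : Measure (R3 × R3)} {m : R3 → ℝ} (hm : ∀ v, 0 < m v)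
    {h : R3 × R3 → ℝ} {C : ℝ} (hC : ∀ z, |h z| ≤ C * (m z.2)⁻¹) :
    weightedNorm ρ m h ≤ ENNReal.ofReal C := by
  rw [weightedNorm, eLpNorm_exponent_top]
  refine eLpNormEssSup_le_of_ae_bound (Eventually.of_forall fun z => ?_)
  rw [Real.norm_eq_abs, abs_mul, abs_of_pos (hm _)]
  exact (le_div_iff₀ (hm _)).1 (by rw [div_eq_mul_inv]; exact hC z)

/-- A function that is bounded on bounded time intervals, for almost every time, is locally
bounded in space-time. -/
lemma locBdd_of_ae_ae {ρ : Measure (R3 × R3)} [SFinite ρ] {F : Z → ℝ}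
    (hF : AEStronglyMeasurable F ((volume.restrict (Ici (0 : ℝ))).prod ρ))
    (h : ∀ T : ℝ, ∃ C : ℝ≥0, ∀ᵐ t ∂volume.restrict (Icc 0 T), ∀ᵐ z ∂ρ, |F (t, z)| ≤ C) :
    LocBdd F ((volume.restrict (Ici (0 : ℝ))).prod ρ) := by
  refine ⟨hF, fun K hK => ?_⟩
  obtain ⟨T, hT⟩ := (hK.image continuous_fst).bddAbove
  obtain ⟨C, hC⟩ := h T
  refine ⟨C, ?_⟩
  -- Going from "almost every time, almost every point" to almost every space-time point requires a
  -- measurable set, hence the measurable representative.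
  have hm : MeasurableSet {z : Z | z.1 ≤ T → |hF.mk F z| ≤ C} := by
    have h1 : MeasurableSet {z : Z | z.1 ≤ T} := measurableSet_le measurable_fst measurable_const
    have h2 : MeasurableSet {z : Z | |hF.mk F z| ≤ C} :=
      measurableSet_le hF.stronglyMeasurable_mk.measurable.abs measurable_const
    exact h1.imp h2
  have hae : ∀ᵐ z ∂(volume.restrict (Ici (0 : ℝ))).prod ρ, z.1 ≤ T → |hF.mk F z| ≤ C := by
    rw [Measure.ae_prod_iff_ae_ae hm]
    rw [ae_restrict_iff' measurableSet_Icc] at hC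
    filter_upwards [Measure.ae_ae_of_ae_prod hF.ae_eq_mk, ae_restrict_of_ae hC,
      ae_restrict_mem measurableSet_Ici] with t h1 h2 h3
    by_cases ht : t ≤ T
    · filter_upwards [h1, h2 ⟨h3, ht⟩] with z hz1 hz2 _
      rwa [← hz1]
    · exact Eventually.of_forall fun z hz => absurd hz ht
  rw [ae_restrict_iff' hK.measurableSet]
  filter_upwards [hae, hF.ae_eq_mk] with z h1 h2 h3
  rw [h2]
  exact h1 (hT ⟨z, h3, rfl⟩)

section Solution

variable {Ω : Set R3} {ν m : R3 → ℝ} {f₀ : R3 × R3 → ℝ} {f g : ℝ → R3 × R3 → ℝ}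

lemma IsSpecularSolution.locBdd (h : IsSpecularSolution Ω ν m f₀ f g) (hm : ∀ v, 1 ≤ m v) :
    LocBdd (Function.uncurry f) (interiorM Ω) := by
  refine locBdd_of_ae_ae h.aestronglyMeasurable_uncurry fun T => ?_
  obtain ⟨C, hC⟩ := h.bounded T
  refine ⟨C, ?_⟩
  filter_upwards [ae_restrict_mem measurableSet_Icc] with t ht
  exact ae_abs_le_of_weightedNorm_le' hm (hC t ht)

lemma IsSpecularSolution.locBdd_trace (hΩ : IsBoundedC1Domain Ω)
    (h : IsSpecularSolution Ω ν m f₀ f g) (hm : ∀ v, 1 ≤ m v) :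
    LocBdd (Function.uncurry g) (boundaryM Ω) := by
  have := hΩ.sigmaFinite_boundaryMeasure
  refine locBdd_of_ae_ae h.trace_aestronglyMeasurable fun T => ?_
  obtain ⟨C, hC⟩ := h.trace_bounded T
  refine ⟨C, ?_⟩
  filter_upwards [hC] with t ht
  exact ae_abs_le_of_weightedNorm_le' hm ht

lemma IsSpecularSolution.locBdd_slice (h : IsSpecularSolution Ω ν m f₀ f g) (hm : ∀ v, 1 ≤ m v)
    {t : ℝ} (ht : 0 ≤ t) : LocBdd (f t) (phaseMeasure Ω) := by
  obtain ⟨C, hC⟩ := h.bounded t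
  exact locBdd_of_bound (h.aestronglyMeasurable t ht)
    (ae_abs_le_of_weightedNorm_le' hm (hC t ⟨ht, le_rfl⟩))

/-- The condition on incoming velocities transfers to outgoing ones, because reflection is an
involution that exchanges them and preserves null sets. Grazing velocities are negligible. -/
lemma IsSpecularSolution.ae_bounceZ (hΩ : IsBoundedC1Domain Ω)
    (h : IsSpecularSolution Ω ν m f₀ f g) :
    ∀ᵐ z ∂boundaryM Ω, Function.uncurry g (bounceZ hΩ z) = Function.uncurry g z := by
  have := hΩ.sigmaFinite_boundaryMeasure
  have hG := h.trace_aestronglyMeasurable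
  set G := hG.mk _ with hGdef
  have hGm : Measurable G := hG.stronglyMeasurable_mk.measurable
  have hgG : Function.uncurry g =ᵐ[boundaryM Ω] G := hG.ae_eq_mk
  have hbm : Measurable (bounceZ hΩ) := (measurePreserving_bounceZ hΩ).measurable
  have hq := (measurePreserving_bounceZ hΩ).quasiMeasurePreserving
  have hq' := (measurePreserving_bounce hΩ).quasiMeasurePreserving
  have key : ∀ᵐ z ∂boundaryM Ω, G (bounceZ hΩ z) = G z := by
    refine (Measure.ae_prod_iff_ae_ae (measurableSet_eq_fun (hGm.comp hbm) hGm)).2 ?_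
    have hs := h.specular
    rw [← Measure.restrict_congr_set Ioi_ae_eq_Ici]
    have h1 := Measure.ae_ae_of_ae_prod hgG
    rw [← Measure.restrict_congr_set Ioi_ae_eq_Ici] at h1
    filter_upwards [hs, h1] with t ht1 ht2
    filter_upwards [ht1, hq'.ae ht1, ht2, hq'.ae ht2, hΩ.ae_boundaryMeasure,
      hΩ.ae_flux_ne_zero] with z a1 a2 a3 a4 hz hne
    have hzb : (bounce hΩ z).1 ∈ frontier Ω := by rwa [bounce_fst]
    change G (t, bounce hΩ z) = G (t, z)
    change g t z = G (t, z) at a3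
    change g t (bounce hΩ z) = G (t, bounce hΩ z) at a4
    rw [← a3, ← a4]
    rcases lt_or_gt_of_ne hne with hlt | hgt
    · rw [a1 hlt, bounce_eq_reflection hΩ hz]
    · have := a2 (by
        change flux Ω (bounce hΩ z) < 0
        rw [flux_bounce hΩ hz]; linarith)
      rw [this, ← bounce_eq_reflection hΩ hzb, bounce_bounce]
  filter_upwards [key, hgG, hq.ae hgG] with z h1 h2 h3
  rw [h2, h3, h1]

/-- It is the weak formulation at a time beyond the support of the test function, where the final
term vanishes. -/
lemma IsSpecularSolution.isSpacetimeSolution (hΩ : IsBoundedC1Domain Ω) (hν : Continuous ν)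
    (h : IsSpecularSolution Ω ν m f₀ f g) (hm : ∀ v, 1 ≤ m v) :
    IsSpacetimeSolution Ω ν f₀ (Function.uncurry f) (Function.uncurry g) := by
  intro φ hφ hφc
  obtain ⟨T, hT⟩ := (hφc.isCompact.image continuous_fst).bddAbove
  set t := max T 0 + 1 with ht
  have ht0 : 0 ≤ t := by positivity
  have hz : ∀ s, t ≤ s → ∀ z, (s, z) ∉ tsupport φ := fun s hs z hmem => by
    have := hT ⟨_, hmem, rfl⟩
    have := le_max_left T 0
    simp only at *
    linarith
  have hz' : ∀ s, t ≤ s → ∀ z, φ (s, z) = 0 := fun s hs z =>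
    image_eq_zero_of_notMem_tsupport (hz s hs z)
  have hTz : ∀ s, t ≤ s → ∀ z, adjointT ν φ (s, z) = 0 := fun s hs z => by
    have h1 : fderiv ℝ φ (s, z) = 0 := image_eq_zero_of_notMem_tsupport
      fun hmem => hz s hs z (tsupport_fderiv_subset ℝ hmem)
    rw [adjointT, transportDeriv, h1, hz' s hs z]; simp
  have hw := h.weakSolution φ hφ hφc t ht0
  have hfi := (h.locBdd hm).integrable_mul (continuous_adjointT hν hφ)
    (hasCompactSupport_adjointT hφc)
  have hgi := integrable_mul_mul_flux hΩ (h.locBdd_trace hΩ hm) hφ.continuous hφc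
  have hI : ∀ A : ℝ → ℝ, (∀ s, t ≤ s → A s = 0) →
      ∫ s in Ici (0 : ℝ), A s = ∫ s in (0 : ℝ)..t, A s := fun A hA => by
    rw [integral_Ici_eq_integral_Ioi, intervalIntegral.integral_of_le ht0]
    refine setIntegral_eq_of_subset_of_forall_sdiff_eq_zero measurableSet_Ioi
      Ioc_subset_Ioi_self fun s hs => hA s ?_
    by_contra hlt
    exact hs.2 ⟨hs.1, (not_le.1 hlt).le⟩
  rw [integral_interiorM hfi, integral_boundaryM hΩ hgi,
    hI _ fun s hs => by simp only [hTz s hs, mul_zero, integral_zero],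
    hI _ fun s hs => by simp only [hz' s hs, mul_zero, zero_mul, integral_zero]]
  simp only [hz' t le_rfl, mul_zero, integral_zero, zero_sub] at hw
  have e : (∫ s in (0 : ℝ)..t, ∫ z, f s z * (transportDeriv φ (s, z) - ν z.2 * φ (s, z))
      ∂phaseMeasure Ω) = ∫ s in (0 : ℝ)..t, ∫ z, Function.uncurry f (s, z) * adjointT ν φ (s, z)
      ∂phaseMeasure Ω := rfl
  have e' : (∫ s in (0 : ℝ)..t, ∫ z, g s z * φ (s, z) * inner ℝ z.2 (outwardNormal Ω z.1)
      ∂boundaryMeasure Ω) = ∫ s in (0 : ℝ)..t, ∫ z, Function.uncurry g (s, z) * φ (s, z) *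
      flux Ω (s, z).2 ∂boundaryMeasure Ω := rfl
  rw [e, e'] at hw
  linarith

variable {f' g' : ℝ → R3 × R3 → ℝ}

/-- Solutions with the same initial datum, and their traces, agree almost everywhere. -/
theorem IsSpecularSolution.unique (hΩ : IsBoundedC1Domain Ω) (hν : Continuous ν)
    (hν0 : ∀ v, 0 < ν v) (hm : ∀ v, 1 ≤ m v)
    (h : IsSpecularSolution Ω ν m f₀ f g) (h' : IsSpecularSolution Ω ν m f₀ f' g') :
    (∀ t : ℝ, 0 ≤ t → f' t =ᵐ[phaseMeasure Ω] f t) ∧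
      ∀ᵐ t ∂(volume.restrict (Ioi (0 : ℝ))), g' t =ᵐ[boundaryMeasure Ω] g t := by
  have := hΩ.sigmaFinite_boundaryMeasure
  have hl := h.locBdd hm
  have hl' := h'.locBdd hm
  have hb := h.locBdd_trace hΩ hm
  have hb' := h'.locBdd_trace hΩ hm
  have hsol : IsSpacetimeSolution Ω ν 0
      (fun z => Function.uncurry f' z - Function.uncurry f z)
      (fun z => Function.uncurry g' z - Function.uncurry g z) := by
    intro φ hφ hφc
    have h1 := h.isSpacetimeSolution hΩ hν hm φ hφ hφc
    have h2 := h'.isSpacetimeSolution hΩ hν hm φ hφ hφc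
    have c1 := continuous_adjointT hν hφ
    have c2 := hasCompactSupport_adjointT (ν := ν) hφc
    simp only [sub_mul, Pi.zero_apply, zero_mul, integral_zero]
    rw [integral_sub (hl'.integrable_mul c1 c2) (hl.integrable_mul c1 c2),
      integral_sub (integrable_mul_mul_flux hΩ hb' hφ.continuous hφc)
        (integrable_mul_mul_flux hΩ hb hφ.continuous hφc)]
    linarith
  obtain ⟨hf0, hg0⟩ := ae_eq_zero_of_isSpacetimeSolution hΩ hν hν0 (hl'.sub hl) (hb'.sub hb)
    (by
      filter_upwards [h.ae_bounceZ hΩ, h'.ae_bounceZ hΩ] with z h1 h2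
      rw [h1, h2]) hsol
  have hfa : ∀ᵐ s ∂volume.restrict (Ici (0 : ℝ)), f' s =ᵐ[phaseMeasure Ω] f s := by
    filter_upwards [Measure.ae_ae_of_ae_prod hf0] with s hs
    filter_upwards [hs] with z hz
    exact sub_eq_zero.1 hz
  have hga : ∀ᵐ s ∂volume.restrict (Ici (0 : ℝ)), g' s =ᵐ[boundaryMeasure Ω] g s := by
    filter_upwards [Measure.ae_ae_of_ae_prod hg0] with s hs
    filter_upwards [hs] with z hz
    exact sub_eq_zero.1 hz
  refine ⟨fun t ht => ?_, ae_restrict_of_ae_restrict_of_subset Ioi_subset_Ici_self hga⟩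
  have hd := (h'.locBdd_slice hm ht).sub (h.locBdd_slice hm ht)
  have hz := ae_eq_zero_of_integral_contDiff_smul_eq_zero hd.locallyIntegrable fun θ hθ hθc => ?_
  · filter_upwards [hz] with z hz
    exact sub_eq_zero.1 hz
  -- Agreement for almost every time makes the right-hand sides of the weak formulations equal at
  -- every `t`. A time cutoff with `χ t = 1` then isolates the slices at time `t`.
  let χ : ContDiffBump t := ⟨1, 2, one_pos, one_lt_two⟩
  have hφ : ContDiff ℝ 1 fun z : Z => χ z.1 * θ z.2 :=
    (χ.contDiff.comp contDiff_fst).mul ((hθ.of_le (by exact_mod_cast le_top)).comp contDiff_snd)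
  have hφc : HasCompactSupport fun z : Z => χ z.1 * θ z.2 := by
    refine HasCompactSupport.intro (χ.hasCompactSupport.isCompact.prod hθc.isCompact)
      fun z hz => ?_
    by_cases h1 : z.1 ∈ tsupport χ
    · rw [image_eq_zero_of_notMem_tsupport fun h2 => hz ⟨h1, h2⟩, mul_zero]
    · rw [image_eq_zero_of_notMem_tsupport h1, zero_mul]
  have h1 := h.weakSolution _ hφ hφc t ht
  have h2 := h'.weakSolution _ hφ hφc t ht
  have e : ∀ (p q : ℝ → R3 × R3 → ℝ) (ρ : Measure (R3 × R3)) (k : ℝ → R3 × R3 → ℝ),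
      (∀ᵐ s ∂volume.restrict (Ici (0 : ℝ)), q s =ᵐ[ρ] p s) →
      ∫ s in (0 : ℝ)..t, ∫ z, q s z * k s z ∂ρ = ∫ s in (0 : ℝ)..t, ∫ z, p s z * k s z ∂ρ := by
    intro p q ρ k hpq
    refine intervalIntegral.integral_congr_ae ?_
    rw [ae_restrict_iff' measurableSet_Ici] at hpq
    filter_upwards [hpq] with s hs hs1
    rw [uIoc_of_le ht] at hs1
    refine integral_congr_ae ?_
    filter_upwards [hs hs1.1.le] with z hz
    rw [hz]
  simp only [mul_assoc] at h1 h2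
  rw [e f f' _ _ hfa, e g g' _ _ hga] at h2
  have hχt : χ t = 1 := χ.one_of_mem_closedBall (by simp [χ])
  have c1 : Continuous θ := hθ.continuous
  simp only [hχt, one_mul] at h1 h2
  simp only [smul_eq_mul, mul_comm (θ _), sub_mul]
  rw [integral_sub ((h'.locBdd_slice hm ht).integrable_mul c1 hθc)
    ((h.locBdd_slice hm ht).integrable_mul c1 hθc)]
  linarith

end Solution

/-! ### Isometry invariance and null sets of the surface measure of the sphere -/

/-- The surface measure of the unit sphere. -/
noncomputable abbrev sphereM : Measure (Metric.sphere (0 : R3) 1) := (volume : Measure R3).toSphere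

open Metric in
/-- The action of a linear isometry on the unit sphere. -/
noncomputable def sphereMap (A : R3 ≃ₗᵢ[ℝ] R3) (σ : sphere (0 : R3) 1) : sphere (0 : R3) 1 :=
  ⟨A σ, by simp⟩

-- The measure of a set on the sphere is defined through the volume of the cone over it, and an
-- isometry maps cones to cones of equal volume.
open scoped Pointwise in
lemma measurePreserving_sphereMap (A : R3 ≃ₗᵢ[ℝ] R3) :
    MeasurePreserving (sphereMap A) sphereM sphereM := by
  have hc : Continuous (sphereMap A) := by
    unfold sphereMap; fun_prop
  refine ⟨hc.measurable, Measure.ext fun s hs => ?_⟩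
  rw [Measure.map_apply hc.measurable hs, Measure.toSphere_apply' _ hs,
    Measure.toSphere_apply' _ (hc.measurable hs)]
  congr 1
  have h1 : (A.symm ⁻¹' (Ioo (0 : ℝ) 1 • ((↑) '' (sphereMap A ⁻¹' s)) : Set R3))
      = Ioo (0 : ℝ) 1 • ((↑) '' s) := by
    ext x
    constructor
    · rintro ⟨r, hr, y, ⟨σ, hσ, rfl⟩, hxy⟩
      refine ⟨r, hr, A σ, ⟨sphereMap A σ, hσ, rfl⟩, ?_⟩
      have h2 : r • (σ : R3) = A.symm x := hxy
      change r • A (σ : R3) = x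
      rw [← map_smul, h2, A.apply_symm_apply]
    · rintro ⟨r, hr, y, ⟨σ, hσ, rfl⟩, rfl⟩
      refine ⟨r, hr, A.symm σ, ⟨sphereMap A.symm σ, ?_, rfl⟩, ?_⟩
      · have h2 : sphereMap A (sphereMap A.symm σ) = σ := Subtype.ext (A.apply_symm_apply _)
        rwa [mem_preimage, h2]
      · exact (map_smul A.symm r (σ : R3)).symm
  rw [← h1]
  exact (A.symm.measurePreserving.measure_preimage_emb
    A.symm.toHomeomorph.measurableEmbedding _).symm

-- The cone over a point lies in a line, which has zero volume.
open scoped Pointwise in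
lemma toSphere_singleton (e : Metric.sphere (0 : R3) 1) : sphereM {e} = 0 := by
  rw [Measure.toSphere_apply' _ (measurableSet_singleton e)]
  have h1 : (Ioo (0 : ℝ) 1 • ((↑) '' ({e} : Set (Metric.sphere (0 : R3) 1))) : Set R3)
      ⊆ (Submodule.span ℝ {(e : R3)} : Submodule ℝ R3) := by
    rw [image_singleton]
    rintro x ⟨r, -, y, hy, rfl⟩
    rw [mem_singleton_iff.1 hy]
    exact Submodule.smul_mem _ _ (Submodule.mem_span_singleton_self _)
  rw [measure_mono_null h1 (Measure.addHaar_submodule _ _ fun htop => ?_), mul_zero]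
  have h2 := finrank_span_singleton (K := ℝ) (v := (e : R3)) (by
    intro h; have := e.2; simp [h] at this)
  rw [htop, finrank_top, finrank_euclideanSpace_fin] at h2
  omega

/-- Equality in Cauchy–Schwarz occurs only at the two poles `±e`. Discarding them avoids the values
of `b` at `±1`, about which nothing pointwise is known. -/
lemma ae_inner_mem_Ioo (e : Metric.sphere (0 : R3) 1) :
    ∀ᵐ σ : Metric.sphere (0 : R3) 1 ∂sphereM, inner ℝ (e : R3) (σ : R3) ∈ Ioo (-1 : ℝ) 1 := by
  have h1 : ∀ᵐ σ : Metric.sphere (0 : R3) 1 ∂sphereM, σ ≠ e :=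
    measure_mono_null (fun σ hσ => by simpa using hσ) (toSphere_singleton e)
  have h2 : ∀ᵐ σ : Metric.sphere (0 : R3) 1 ∂sphereM, σ ≠ -e :=
    measure_mono_null (fun σ hσ => by simpa using hσ) (toSphere_singleton (-e))
  filter_upwards [h1, h2] with σ a1 a2
  have he : ‖(e : R3)‖ = 1 := by simp
  have hs : ‖(σ : R3)‖ = 1 := by simp
  have hle := abs_real_inner_le_norm (e : R3) (σ : R3)
  rw [he, hs, one_mul, abs_le] at hle
  refine ⟨lt_of_le_of_ne hle.1 fun h => a2 ?_, lt_of_le_of_ne hle.2 fun h => a1 ?_⟩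
  · have h3 : inner ℝ (e : R3) (-(σ : R3)) = 1 := by rw [inner_neg_right, ← h, neg_neg]
    have h4 := (inner_eq_one_iff_of_norm_eq_one he (by rw [norm_neg, hs])).1 h3
    exact Subtype.ext (by rw [coe_neg_sphere, h4, neg_neg])
  · exact Subtype.ext ((inner_eq_one_iff_of_norm_eq_one he hs).1 h).symm

/-! ### Continuity and positivity of the collision frequency -/

section Kernel

variable {CΦ γ : ℝ} {b : ℝ → ℝ}

lemma IsHardPotentialCutoff.continuousOn_Ioo (hB : IsHardPotentialCutoff CΦ γ b) :
    ContinuousOn b (Ioo (-1) 1) := by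
  have h1 := hB.continuousOn.comp (t := Ioo 0 Real.pi) (s := Ioo (-1) 1)
    Real.continuous_arccos.continuousOn fun x hx =>
      ⟨Real.arccos_pos.2 hx.2, Real.arccos_lt_pi.2 hx.1⟩
  exact h1.congr fun x hx => by
    simp only [Function.comp_apply]
    rw [Real.cos_arccos hx.1.le hx.2.le]

lemma IsHardPotentialCutoff.pos_of_mem (hB : IsHardPotentialCutoff CΦ γ b) {x : ℝ}
    (hx : x ∈ Ioo (-1 : ℝ) 1) : 0 < b x := by
  have := hB.pos (Real.arccos x) ⟨Real.arccos_pos.2 hx.2, Real.arccos_lt_pi.2 hx.1⟩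
  rwa [Real.cos_arccos hx.1.le hx.2.le] at this

/-- Continuity on the open interval turns the essential bound into a pointwise one. -/
lemma IsHardPotentialCutoff.exists_bound (hB : IsHardPotentialCutoff CΦ γ b) :
    ∃ B : ℝ, ∀ x ∈ Ioo (-1 : ℝ) 1, b x ≤ B := by
  set B := (eLpNorm b ∞ (volume.restrict (Icc (-1) 1))).toReal with hBdef
  refine ⟨B, fun x hx => ?_⟩
  have hae : (fun x => max (b x) B) =ᵐ[volume.restrict (Ioo (-1) 1)] fun _ => B := by
    refine ae_restrict_of_ae_restrict_of_subset Ioo_subset_Icc_self ?_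
    filter_upwards [ae_le_eLpNormEssSup (f := b) (μ := volume.restrict (Icc (-1) 1))] with x hx
    rw [← eLpNorm_exponent_top, ← ofReal_norm, ENNReal.ofReal_le_iff_le_toReal hB.bounded.ne] at hx
    exact max_eq_right ((le_abs_self _).trans hx)
  have := Measure.eqOn_open_of_ae_eq hae isOpen_Ioo
    (hB.continuousOn_Ioo.sup continuousOn_const) continuousOn_const hx
  exact (le_max_left _ _).trans this.le

/-- The total angular cross section in the direction `e`. -/
noncomputable def angularMass (b : ℝ → ℝ) (e : R3) : ℝ :=
  ∫ σ : Metric.sphere (0 : R3) 1, b (inner ℝ e (σ : R3)) ∂sphereM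

lemma IsHardPotentialCutoff.angularMass_pos (hB : IsHardPotentialCutoff CΦ γ b)
    (e : Metric.sphere (0 : R3) 1) : 0 < angularMass b e := by
  obtain ⟨B, hBB⟩ := hB.exists_bound
  have hcont : Continuous fun σ : Metric.sphere (0 : R3) 1 => inner ℝ (e : R3) (σ : R3) := by
    fun_prop
  have hae := ae_inner_mem_Ioo e
  -- No global measurability of `b` is needed: it is continuous on the open interval, which contains
  -- the cosine for almost every `σ`.
  have hm : Measurable ((Ioo (-1 : ℝ) 1).indicator b) := by
    rw [← piecewise_eq_indicator]
    exact hB.continuousOn_Ioo.measurable_piecewise continuousOn_const measurableSet_Ioo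
  have hpos : 0 ≤ᵐ[sphereM] fun σ : Metric.sphere (0 : R3) 1 => b (inner ℝ (e : R3) (σ : R3)) := by
    filter_upwards [hae] with σ hσ using (hB.pos_of_mem hσ).le
  have hint : Integrable (fun σ : Metric.sphere (0 : R3) 1 => b (inner ℝ (e : R3) (σ : R3)))
      sphereM := by
    refine Integrable.of_bound (C := B) ?_ ?_
    · refine (hm.comp hcont.measurable).aestronglyMeasurable.congr ?_
      filter_upwards [hae] with σ hσ
      simp only [Function.comp_apply]
      rw [indicator_of_mem hσ]
    · filter_upwards [hae] with σ hσ
      rw [Real.norm_eq_abs, abs_of_pos (hB.pos_of_mem hσ)]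
      exact hBB _ hσ
  refine lt_of_le_of_ne (integral_nonneg_of_ae hpos) fun h0 => ?_
  have h1 := (integral_eq_zero_iff_of_nonneg_ae hpos hint).1 h0.symm
  have : ∀ᵐ σ : Metric.sphere (0 : R3) 1 ∂sphereM, False := by
    filter_upwards [h1, hae] with σ a1 a2
    exact (hB.pos_of_mem a2).ne' a1
  rw [eventually_false_iff_eq_bot, ae_eq_bot] at this
  exact Measure.toSphere_ne_zero _ this

/-- Two vectors of equal norm are exchanged by the reflection in the hyperplane orthogonal to their
difference, and this reflection preserves the sphere measure. -/
lemma angularMass_eq (b : ℝ → ℝ) {e e' : R3} (h : ‖e‖ = ‖e'‖) :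
    angularMass b e = angularMass b e' := by
  set A : R3 ≃ₗᵢ[ℝ] R3 := (Submodule.span ℝ {e - e'})ᗮ.reflection with hA
  have hAe : A e = e' := Submodule.reflection_sub h
  have hme : MeasurableEmbedding (sphereMap A) := by
    refine (Continuous.isClosedEmbedding (by unfold sphereMap; fun_prop)
      fun σ τ hστ => ?_).measurableEmbedding
    exact Subtype.ext (A.injective (congrArg Subtype.val hστ))
  have h1 := (measurePreserving_sphereMap A).integral_comp hme
    fun σ : Metric.sphere (0 : R3) 1 => b (inner ℝ e' (σ : R3))
  rw [angularMass, angularMass, ← h1]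
  congr 1; ext σ
  rw [← hAe]
  change _ = b (inner ℝ (A e) (A (σ : R3)))
  rw [A.inner_map_map]

/-- The radial profile of the collision frequency. -/
noncomputable def radialFrequency (γ : ℝ) (v : R3) : ℝ := ∫ w : R3, ‖v - w‖ ^ γ * maxwellian w

/-- The angular integral depends on the relative velocity only through its unit direction, hence not
at all, and it factors out for every `w ≠ v`. -/
lemma collisionFrequency_eq (CΦ γ : ℝ) (b : ℝ → ℝ) {e : R3} (he : ‖e‖ = 1) (v : R3) :
    collisionFrequency CΦ γ b v = CΦ * angularMass b e * radialFrequency γ v := by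
  rw [collisionFrequency, radialFrequency, ← integral_const_mul]
  refine integral_congr_ae ?_
  have hne : ∀ᵐ w : R3, w ≠ v := by
    rw [ae_iff]; simp
  filter_upwards [hne] with w hw
  have hn : ‖v - w‖ ≠ 0 := norm_ne_zero_iff.2 (sub_ne_zero.2 hw.symm)
  rw [angularMass_eq b (e := e) (e' := ‖v - w‖⁻¹ • (v - w)) (by
    rw [he, norm_smul, norm_inv, norm_norm, inv_mul_cancel₀ hn])]
  rw [integral_mul_const, integral_const_mul, angularMass]
  ring

lemma maxwellian_pos (w : R3) : 0 < maxwellian w := by unfold maxwellian; positivity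

lemma continuous_maxwellian : Continuous maxwellian := by unfold maxwellian; fun_prop

/-- Half of the Gaussian exponent absorbs the linear growth; the other half remains integrable. -/
lemma integrable_add_norm_mul_maxwellian {c : ℝ} (hc : 0 ≤ c) :
    Integrable fun w : R3 => (c + ‖w‖) * maxwellian w := by
  have h1 : Integrable fun w : R3 => Real.exp (-(‖w‖ ^ 2) / 4) := by
    have := (GaussianFourier.integrable_cexp_neg_mul_sq_norm_add (V := R3) (b := (1 / 4 : ℂ))
      (by norm_num) 0 0).norm
    refine this.congr (Eventually.of_forall fun w => ?_)
    simp only [Complex.norm_exp]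
    congr 1
    simp [← Complex.ofReal_pow]
    ring
  refine (h1.const_mul ((c + 1) * (2 * Real.pi) ^ (-(3 / 2) : ℝ))).mono'
    ((continuous_const.add continuous_norm).mul continuous_maxwellian).aestronglyMeasurable
    (Eventually.of_forall fun w => ?_)
  rw [Real.norm_of_nonneg (by have := maxwellian_pos w; positivity), maxwellian]
  have h2 : Real.exp (-(‖w‖ ^ 2) / 2) = Real.exp (-(‖w‖ ^ 2) / 4) * Real.exp (-(‖w‖ ^ 2) / 4) := by
    rw [← Real.exp_add]; ring_nf
  have h3 : (c + ‖w‖) * Real.exp (-(‖w‖ ^ 2) / 4) ≤ c + 1 := by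
    have h4 := Real.add_one_le_exp (‖w‖ ^ 2 / 4)
    have h5 : Real.exp (‖w‖ ^ 2 / 4) * Real.exp (-(‖w‖ ^ 2) / 4) = 1 := by
      rw [← Real.exp_add]; ring_nf; simp
    have h6 : c + ‖w‖ ≤ (c + 1) * Real.exp (‖w‖ ^ 2 / 4) := by
      nlinarith [sq_nonneg (‖w‖ / 2 - 1), sq_nonneg ‖w‖]
    calc (c + ‖w‖) * Real.exp (-(‖w‖ ^ 2) / 4)
        ≤ (c + 1) * Real.exp (‖w‖ ^ 2 / 4) * Real.exp (-(‖w‖ ^ 2) / 4) :=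
          mul_le_mul_of_nonneg_right h6 (Real.exp_pos _).le
      _ = c + 1 := by rw [mul_assoc, h5, mul_one]
  rw [h2]
  have h7 : 0 ≤ (2 * Real.pi) ^ (-(3 / 2) : ℝ) * Real.exp (-(‖w‖ ^ 2) / 4) := by positivity
  nlinarith [mul_le_mul_of_nonneg_right h3 h7]

lemma rpow_le_one_add {γ x : ℝ} (hγ : γ ∈ Icc (0 : ℝ) 1) (hx : 0 ≤ x) : x ^ γ ≤ 1 + x := by
  rcases le_total x 1 with h | h
  · exact (Real.rpow_le_one hx h hγ.1).trans (by linarith)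
  · have := Real.rpow_le_rpow_of_exponent_le h hγ.2
    rw [Real.rpow_one] at this
    linarith

lemma continuous_norm_rpow (hγ : γ ∈ Icc (0 : ℝ) 1) : Continuous fun w : R3 => ‖w‖ ^ γ :=
  continuous_norm.rpow_const fun _ => Or.inr hγ.1

lemma integrable_radialFrequency (hγ : γ ∈ Icc (0 : ℝ) 1) (v : R3) :
    Integrable fun w : R3 => ‖v - w‖ ^ γ * maxwellian w := by
  refine (integrable_add_norm_mul_maxwellian (c := 1 + ‖v‖) (by positivity)).mono'
    (((continuous_norm_rpow hγ).comp (continuous_const.sub continuous_id)).mul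
      continuous_maxwellian).aestronglyMeasurable (Eventually.of_forall fun w => ?_)
  rw [Real.norm_of_nonneg (mul_nonneg (by positivity) (maxwellian_pos w).le)]
  refine mul_le_mul_of_nonneg_right ?_ (maxwellian_pos w).le
  have := rpow_le_one_add hγ (norm_nonneg (v - w))
  have := norm_sub_le v w
  linarith

lemma continuous_radialFrequency (hγ : γ ∈ Icc (0 : ℝ) 1) : Continuous (radialFrequency γ) := by
  refine continuous_iff_continuousAt.2 fun v₀ => ?_
  refine continuousAt_of_dominated (bound := fun w => (2 + ‖v₀‖ + ‖w‖) * maxwellian w)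
    (Eventually.of_forall fun v => (integrable_radialFrequency hγ v).aestronglyMeasurable)
    ?_ (integrable_add_norm_mul_maxwellian (by positivity)) (Eventually.of_forall fun w =>
      (((continuous_norm_rpow hγ).comp (continuous_id.sub continuous_const)).mul
        continuous_const).continuousAt)
  filter_upwards [Metric.ball_mem_nhds v₀ one_pos] with v hv
  refine Eventually.of_forall fun w => ?_
  rw [Real.norm_of_nonneg (mul_nonneg (by positivity) (maxwellian_pos w).le)]
  refine mul_le_mul_of_nonneg_right ?_ (maxwellian_pos w).le
  have := rpow_le_one_add hγ (norm_nonneg (v - w))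
  have := norm_sub_le v w
  have := norm_sub_norm_le v v₀
  rw [mem_ball_iff_norm] at hv
  linarith

lemma radialFrequency_zero_pos (hγ : γ ∈ Icc (0 : ℝ) 1) : 0 < radialFrequency γ 0 := by
  refine (integral_pos_iff_support_of_nonneg (fun w =>
    mul_nonneg (by positivity) (maxwellian_pos w).le) (integrable_radialFrequency hγ 0)).2 ?_
  have h1 : ({0}ᶜ : Set R3) ⊆ Function.support fun w : R3 => ‖(0 : R3) - w‖ ^ γ * maxwellian w := by
    intro w hw
    have : 0 < ‖(0 : R3) - w‖ := by
      rw [zero_sub, norm_neg]; exact norm_pos_iff.2 hw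
    exact (mul_pos (Real.rpow_pos_of_pos this _) (maxwellian_pos w)).ne'
  exact (isOpen_compl_singleton.measure_pos volume
    ((nontrivial_iff_exists_ne 0).1 inferInstance)).trans_le (measure_mono h1)

/-- As the Maxwellian is even, `w` may be replaced by `-w`. From `2|w| ≤ |v - w| + |v + w|`, one of
the two norms is at least `|w|`, so `|w|^γ ≤ |v - w|^γ + |v + w|^γ`, which is then integrated. -/
lemma radialFrequency_ge (hγ : γ ∈ Icc (0 : ℝ) 1) (v : R3) :
    radialFrequency γ 0 / 2 ≤ radialFrequency γ v := by
  have hneg : radialFrequency γ v = ∫ w : R3, ‖v + w‖ ^ γ * maxwellian w := by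
    rw [radialFrequency, ← integral_neg_eq_self]
    simp [maxwellian]
  have hi := integrable_radialFrequency hγ v
  have hi' : Integrable fun w : R3 => ‖v + w‖ ^ γ * maxwellian w := by
    have := hi.comp_neg
    simpa [maxwellian] using this
  have h2 : radialFrequency γ 0 ≤ radialFrequency γ v + radialFrequency γ v := by
    nth_rewrite 2 [hneg]
    rw [radialFrequency, radialFrequency, ← integral_add hi hi']
    refine integral_mono (integrable_radialFrequency hγ 0) (hi.add hi') fun w => ?_
    simp only [zero_sub, norm_neg, ← add_mul]
    refine mul_le_mul_of_nonneg_right ?_ (maxwellian_pos w).le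
    have h3 : ‖w‖ ≤ max ‖v - w‖ ‖v + w‖ := by
      have h4 : (2 : ℝ) * ‖w‖ ≤ ‖v + w‖ + ‖v - w‖ := by
        have h5 : (2 : ℝ) • w = (v + w) - (v - w) := by rw [two_smul]; abel
        calc (2 : ℝ) * ‖w‖ = ‖(2 : ℝ) • w‖ := by rw [norm_smul]; simp
          _ ≤ _ := by rw [h5]; exact norm_sub_le _ _
      by_contra! hlt
      rw [max_lt_iff] at hlt
      linarith
    rcases le_max_iff.1 h3 with h | h
    · exact (Real.rpow_le_rpow (norm_nonneg _) h hγ.1).trans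
        (le_add_of_nonneg_right (by positivity))
    · exact (Real.rpow_le_rpow (norm_nonneg _) h hγ.1).trans
        (le_add_of_nonneg_left (by positivity))
  linarith

lemma IsHardPotentialCutoff.continuous_collisionFrequency (hB : IsHardPotentialCutoff CΦ γ b) :
    Continuous (collisionFrequency CΦ γ b) := by
  obtain ⟨e, he⟩ : ∃ e : R3, ‖e‖ = 1 := ⟨EuclideanSpace.single 0 1, by simp⟩
  rw [funext (collisionFrequency_eq CΦ γ b he)]
  exact continuous_const.mul (continuous_radialFrequency hB.γ_mem)

lemma IsHardPotentialCutoff.exists_pos_le (hB : IsHardPotentialCutoff CΦ γ b) :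
    ∃ c : ℝ, 0 < c ∧ ∀ v, c ≤ collisionFrequency CΦ γ b v := by
  obtain ⟨e, he⟩ : ∃ e : R3, ‖e‖ = 1 := ⟨EuclideanSpace.single 0 1, by simp⟩
  have h1 := hB.angularMass_pos ⟨e, by simpa using he⟩
  have h2 : 0 < CΦ * angularMass b e := mul_pos hB.CΦ_pos h1
  refine ⟨CΦ * angularMass b e * (radialFrequency γ 0 / 2),
    mul_pos h2 (half_pos (radialFrequency_zero_pos hB.γ_mem)), fun v => ?_⟩
  rw [collisionFrequency_eq CΦ γ b he]
  exact mul_le_mul_of_nonneg_left (radialFrequency_ge hB.γ_mem v) h2.le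

end Kernel

/-! ### Continuity, lower bound and radial symmetry of the weights -/

section Weight

variable {m : R3 → ℝ}

lemma IsAdmissibleWeight.continuous (hm : IsAdmissibleWeight m) : Continuous m := by
  rcases hm with ⟨κ, α, -, hα, -, h⟩ | ⟨k, h⟩
  · rw [funext h]
    exact Real.continuous_exp.comp (continuous_const.mul
      (continuous_norm.rpow_const fun _ => Or.inr hα.le))
  · rw [funext h]; fun_prop

lemma IsAdmissibleWeight.one_le (hm : IsAdmissibleWeight m) (v : R3) : 1 ≤ m v := by
  rcases hm with ⟨κ, α, hκ, -, -, h⟩ | ⟨k, h⟩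
  · rw [h, Real.one_le_exp_iff]; positivity
  · rw [h]
    exact one_le_pow₀ (Real.one_le_sqrt.2 (by nlinarith [sq_nonneg ‖v‖]))

lemma IsAdmissibleWeight.radial (hm : IsAdmissibleWeight m) {v w : R3} (h : ‖v‖ = ‖w‖) :
    m v = m w := by
  rcases hm with ⟨κ, α, -, -, -, hm⟩ | ⟨k, hm⟩ <;> rw [hm, hm, h]

end Weight

end SpecularTransport

/-! ### The theorem -/

open SpecularTransport in
theorem proposition3p1
    (Ω : Set R3) (hΩ : IsBoundedC1Domain Ω)
    (CΦ γ : ℝ) (b : ℝ → ℝ) (hB : IsHardPotentialCutoff CΦ γ b)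
    (m : R3 → ℝ) (hm : IsAdmissibleWeight m)
    (f₀ : R3 × R3 → ℝ) (hf₀ : AEStronglyMeasurable f₀ (phaseMeasure Ω))
    (hf₀' : weightedNorm (phaseMeasure Ω) m f₀ < ∞) :
    (0 < ⨅ v, collisionFrequency CΦ γ b v) ∧
    ∃ f g : ℝ → R3 × R3 → ℝ,
      IsSpecularSolution Ω (collisionFrequency CΦ γ b) m f₀ f g ∧
      (∃ C : ℝ≥0, ∀ᵐ t ∂(volume.restrict (Ioi (0 : ℝ))),
        weightedNorm (boundaryMeasure Ω) m (g t) ≤ C) ∧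
      (∀ f' g' : ℝ → R3 × R3 → ℝ,
        IsSpecularSolution Ω (collisionFrequency CΦ γ b) m f₀ f' g' →
          (∀ t : ℝ, 0 ≤ t → f' t =ᵐ[phaseMeasure Ω] f t) ∧
          ∀ᵐ t ∂(volume.restrict (Ioi (0 : ℝ))), g' t =ᵐ[boundaryMeasure Ω] g t) ∧
      ∀ t : ℝ, 0 ≤ t →
        weightedNorm (phaseMeasure Ω) m (f t) ≤
          ENNReal.ofReal (Real.exp (-(⨅ v, collisionFrequency CΦ γ b v) * t)) *
            weightedNorm (phaseMeasure Ω) m f₀ := by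
  obtain ⟨c, hc, hcle⟩ := hB.exists_pos_le
  have hν := hB.continuous_collisionFrequency
  set ν := collisionFrequency CΦ γ b
  have hν₀ : 0 < ⨅ v, ν v := hc.trans_le (le_ciInf hcle)
  refine ⟨hν₀, ?_⟩
  have hle : ∀ v, ⨅ v, ν v ≤ ν v := ciInf_le ⟨c, forall_mem_range.2 hcle⟩
  set ν₀ := ⨅ v, ν v
  have hm1 := hm.one_le
  have hm0 : ∀ v, 0 < m v := fun v => one_pos.trans_le (hm1 v)
  lift weightedNorm (phaseMeasure Ω) m f₀ to ℝ≥0 using hf₀'.ne with M hM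
  have hf₀M : ∀ᵐ z ∂phaseMeasure Ω, |f₀ z| ≤ M * (m z.2)⁻¹ := by
    filter_upwards [ae_abs_le_of_weightedNorm_le hM.ge] with z hz
    rw [abs_mul, abs_of_pos (hm0 _)] at hz
    rwa [← div_eq_mul_inv, le_div_iff₀ (hm0 _)]
  -- The duality argument is applied with `ω = 1/m` and `M = ‖f₀‖`, so that the bound `M e^{-ν₀t} ω`
  -- is exactly the decay of the weighted norm.
  obtain ⟨f, g, hfm, hfm', hfM, hgm, hgM, hgs, hw⟩ := exists_weakSolution hΩ hν hν₀.le hle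
    (ω := fun v => (m v)⁻¹) (hm.continuous.inv₀ fun v => (hm0 v).ne')
    (fun v => inv_pos.2 (hm0 v)) (fun v w h => by rw [hm.radial h]) hf₀ M.2 hf₀M
  have hdecay : ∀ t, 0 ≤ t → (M : ℝ) * Real.exp (-ν₀ * t) ≤ M := fun t ht =>
    mul_le_of_le_one_right M.2 (Real.exp_le_one_iff.2 (by nlinarith))
  have hfn : ∀ t, 0 ≤ t → weightedNorm (phaseMeasure Ω) m (f t) ≤
      ENNReal.ofReal (M * Real.exp (-ν₀ * t)) := fun t ht =>
    weightedNorm_le_of_abs_le hm0 (hfM t ht)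
  have hgn : ∀ t, 0 ≤ t → weightedNorm (boundaryMeasure Ω) m (g t) ≤ M := fun t ht =>
    (weightedNorm_le_of_abs_le hm0 (hgM t)).trans
      ((ENNReal.ofReal_le_ofReal (hdecay t ht)).trans_eq ENNReal.ofReal_coe_nnreal)
  have hsol : IsSpecularSolution Ω ν m f₀ f g := by
    refine ⟨hfm, fun t ht => (hfm' t ht).aestronglyMeasurable, fun T => ⟨M, fun t ht =>
      (hfn t ht.1).trans ((ENNReal.ofReal_le_ofReal (hdecay t ht.1)).trans_eq
        ENNReal.ofReal_coe_nnreal)⟩, hgm.aestronglyMeasurable, fun T => ⟨M, ?_⟩, hw,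
      Filter.Eventually.of_forall fun t => ?_⟩
    · filter_upwards [ae_restrict_mem measurableSet_Icc] with t ht using hgn t ht.1
    · filter_upwards [hΩ.ae_boundaryMeasure] with z hz _
      rw [← bounce_eq_reflection hΩ hz, hgs]
  refine ⟨f, g, hsol, ⟨M, ?_⟩, fun f' g' h' =>
    hsol.unique hΩ hν (fun v => hc.trans_le (hcle v)) hm1 h', fun t ht => ?_⟩
  · filter_upwards [ae_restrict_mem measurableSet_Ioi] with t ht using hgn t (le_of_lt ht)
  · refine (hfn t ht).trans_eq ?_
    rw [mul_comm, ENNReal.ofReal_mul (Real.exp_pos _).le, ENNReal.ofReal_coe_nnreal]
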